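/- Let $n\ge 1$ and let $P=\{x\in\mathbb R^n:\langle x,\ell_i\rangle\le 1,\ i=1,\dots,d\}$, $\ell_i\in\mathbb Z^n$, be the moment polytope of an $n$-dimensional toric Fano manifold $M$ polarized by $-K_M$; that is, $P$ is bounded, each $\ell_i$ is the outer normal of a facet, and at each vertex of $P$ the normals of the facets through it form a basis of $\mathbb Z^n$. Let $X=\sum_j\theta_j w_j\partial/\partial w_j$ with $\theta_j\in\mathbb R$ (for instance, the soliton vector field) and $\theta(x)=\sum_j\theta_jx_j$. Let $u=\max_\lambda(\langle a^\lambda,x\rangle+c^\lambda)$ be a rational piecewise linear convex function that is positive on $P$, and let $l\ge1$ be an integer such that $lu$ has integral slopes $la^\lambda$ (if the slopes of $u$ are integral, take $l=1$). Let $R,r\ge 1$ be integers such that $lu<R$ on $P$ and $rQ$ is a lattice polytope, where $$Q=\{(x,t):x\in P,\ 0\le t\le R-l\,u(x)\}\subset\mathbb R^{n+1}.$$ Let $M_Q=\operatorname{Proj}\bigoplus_{k\ge0}\mathbb C[krQ\cap\mathbb Z^{n+1}]$ be the toric variety of $rQ$ with its line bundle $\mathfrak L=\mathcal O(1)$, let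 $\pi:M_Q\to\mathbb{CP}^1$ be the equivariant map $[\chi^{(I,i)}:\chi^{(I,i+1)}]$, whose fibre over $\infty$ is the divisor of the face $t=0$, and let $M_0=\pi^{-1}(0)$ (as a scheme) and $L=\mathfrak L|_{M_0}$; this is the central fibre of the toric degeneration induced by $u$. Let $X$ act on $\chi^{(I,i)}$ with weight $\sum_j\theta_jI_j$ and let the $\mathbb C^*$-action of the degeneration act with weight $i$. For $k\ge1$ put $K=kr$ and $N_k=\dim H^0(M_0,L^k)$, let $(e^{X_\alpha},e^{v_\alpha})$ be the pairs of joint eigenvalues, counted with multiplicity, on $H^0(M_0,L^k)$ of the time-one maps of the one-parameter groups generated by $X$ and by the $\mathbb C^*$-action, and let $$S_1=\sum_\alpha e^{X_\alpha/K}v_\alpha,\qquad S_2=\frac12\sum_\alpha e^{X_\alpha/K}\,\frac{X_\alpha}{K}\,\frac{v_\alpha}{K}.$$ The modified Futaki invariant of the degeneration is the number $F_1$ in the expansion $$-\frac{S_1-S_2}{K\,N_k}=F_0+F_1K^{-1}+O(K^{-2})\qquad(k\to\infty).$$ For a continuous function $f$ on $P$ let $$\mathcal L(f)=\int_{\partial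 P}f\,e^{\theta}\,d\sigma-\int_P(n+\theta)\,e^{\theta}f\,dx,\qquad d\sigma=\langle\vec n,x\rangle\,d\sigma_0,$$ where $\vec n$ is the unit outer normal and $d\sigma_0$ is the $(n-1)$-dimensional Lebesgue measure on $\partial P$. Then this expansion holds for exactly one pair $(F_0,F_1)$, namely $$F_0=-\frac1{\mathrm{Vol}(P)}\int_Pe^{\theta}(R-l\,u)\,dx,\qquad F_1=\frac{\mathcal L(l\,u)}{2\,\mathrm{Vol}(P)}.$$ In particular, if $l=1$ then $F_1=\mathcal L(u)/(2\mathrm{Vol}(P))$. For fixed $u$ and $l$, any two admissible choices of $(R,r)$ give the same $F_1$, while different values of $R$ give different values of $F_0$. -/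

import Mathlib

open scoped MeasureTheory Pointwise

noncomputable section

namespace ToricFutaki

/-! ### Sections of `O(k)` on a closed subscheme of `Proj` -/

section ProjFibre

variable {A : Type*} [CommRing A] [Algebra ℂ A]
variable (𝒜 : ℕ → Submodule ℂ A) [GradedAlgebra 𝒜] (J : Ideal A)

/-- The underlying space of the closed subscheme `V₊(J)` of `Proj 𝒜`. -/
abbrev ClosedSub : Type _ :=
  {x : ProjectiveSpectrum 𝒜 // J ≤ x.asHomogeneousIdeal.toIdeal}

variable {𝒜} in
/-- The ideal generated by `J` in the localization of `A` at a point. -/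
abbrev stalkIdeal (x : ProjectiveSpectrum 𝒜) :
    Ideal (Localization.AtPrime x.asHomogeneousIdeal.toIdeal) :=
  J.map (algebraMap A (Localization.AtPrime x.asHomogeneousIdeal.toIdeal))

variable {𝒜 J} in
/-- The localization of `A ⧸ J` at a point of `V₊(J)`. The elements `a / b` with `a`, `b`
homogeneous and `deg a = deg b + k` form the stalk of `O(k)` on `V₊(J)`. -/
abbrev Stalk (x : ClosedSub 𝒜 J) : Type _ :=
  Localization.AtPrime x.1.asHomogeneousIdeal.toIdeal ⧸ stalkIdeal J x.1

variable {𝒜 J} in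
/-- The class of the fraction `a / b` in the stalk at `x`. -/
def stalkFrac (x : ClosedSub 𝒜 J) (a : A) (b : x.1.asHomogeneousIdeal.toIdeal.primeCompl) :
    Stalk x :=
  Ideal.Quotient.mk (stalkIdeal J x.1)
    (IsLocalization.mk' (Localization.AtPrime x.1.asHomogeneousIdeal.toIdeal) a b)

variable {𝒜 J} in
theorem smul_stalkFrac (z : ℂ) (x : ClosedSub 𝒜 J) (a : A)
    (b : x.1.asHomogeneousIdeal.toIdeal.primeCompl) :
    z • stalkFrac x a b = stalkFrac x (z • a) b := by
  have h : z • IsLocalization.mk' (Localization.AtPrime x.1.asHomogeneousIdeal.toIdeal) a b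
      = IsLocalization.mk' (Localization.AtPrime x.1.asHomogeneousIdeal.toIdeal) (z • a) b := by
    rw [Algebra.smul_def, Algebra.smul_def, IsScalarTower.algebraMap_apply ℂ A,
      IsLocalization.mul_mk'_eq_mk'_of_mul]
  rw [stalkFrac, stalkFrac, ← h]
  rfl

variable {𝒜 J} in
/-- A family of germs is a section of `O(k)` if it is locally a fraction `a / b` of homogeneous
elements with `deg a = deg b + k`. -/
def IsSection (k : ℕ) (s : ∀ x : ClosedSub 𝒜 J, Stalk x) : Prop :=
  ∀ x : ClosedSub 𝒜 J, ∃ U : Set (ClosedSub 𝒜 J), IsOpen U ∧ x ∈ U ∧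
    ∃ (i : ℕ) (a b : A), a ∈ 𝒜 (i + k) ∧ b ∈ 𝒜 i ∧
      ∀ y ∈ U, ∃ hb : b ∈ y.1.asHomogeneousIdeal.toIdeal.primeCompl,
        s y = stalkFrac y a ⟨b, hb⟩

/-- The complex vector space `H⁰(V₊(J), O(k))`. -/
def globalSections (k : ℕ) : Submodule ℂ (∀ x : ClosedSub 𝒜 J, Stalk x) where
  carrier := {s | IsSection k s}
  zero_mem' := by
    intro x
    refine ⟨Set.univ, isOpen_univ, trivial, 0, 0, 1, zero_mem _, SetLike.GradedOne.one_mem, ?_⟩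
    intro y _
    refine ⟨(Ideal.ne_top_iff_one _).1 y.1.isPrime.ne_top, ?_⟩
    simp [stalkFrac]
  add_mem' := by
    intro s t hs ht x
    obtain ⟨U, hU, hxU, i, a, b, ha, hb, h⟩ := hs x
    obtain ⟨V, hV, hxV, j, c, d, hc, hd, h'⟩ := ht x
    refine ⟨U ∩ V, hU.inter hV, ⟨hxU, hxV⟩, i + j, a * d + c * b, b * d, ?_,
      SetLike.mul_mem_graded hb hd, ?_⟩
    · refine add_mem ?_ ?_
      · have := SetLike.mul_mem_graded ha hd
        rwa [add_right_comm] at this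
      · have := SetLike.mul_mem_graded hc hb
        rwa [add_comm (j + k) i, ← add_assoc] at this
    · rintro y ⟨hyU, hyV⟩
      obtain ⟨hb', e⟩ := h y hyU
      obtain ⟨hd', e'⟩ := h' y hyV
      refine ⟨fun hbd => (y.1.isPrime.mem_or_mem hbd).elim hb' hd', ?_⟩
      rw [Pi.add_apply, e, e', stalkFrac, stalkFrac, stalkFrac, ← map_add,
        ← IsLocalization.mk'_add]
      rfl
  smul_mem' := by
    intro z s hs x
    obtain ⟨U, hU, hxU, i, a, b, ha, hb, h⟩ := hs x
    refine ⟨U, hU, hxU, i, z • a, b, Submodule.smul_mem _ _ ha, hb, ?_⟩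
    intro y hy
    obtain ⟨hb', e⟩ := h y hy
    refine ⟨hb', ?_⟩
    rw [Pi.smul_apply, e, smul_stalkFrac]

/-- An automorphism of the graded algebra `A` that preserves the ideal `J`. It induces an
automorphism of `V₊(J)` that is lifted to the sheaves `O(k)`. -/
structure FibreAut where
  /-- the underlying algebra automorphism -/
  e : A ≃ₐ[ℂ] A
  deg : ∀ i a, a ∈ 𝒜 i → e a ∈ 𝒜 i
  deg_symm : ∀ i a, a ∈ 𝒜 i → e.symm a ∈ 𝒜 i
  map_mem : ∀ a ∈ J, e a ∈ J

variable {𝒜 J}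

/-- The automorphism as a homomorphism of graded rings. -/
def FibreAut.hom (τ : FibreAut 𝒜 J) : GradedRingHom 𝒜 𝒜 where
  toRingHom := (τ.e : A →+* A)
  map_mem := by
    intro i a ha
    exact τ.deg i a ha

theorem FibreAut.irrelevant_le (τ : FibreAut 𝒜 J) :
    HomogeneousIdeal.irrelevant 𝒜 ≤ (HomogeneousIdeal.irrelevant 𝒜).map τ.hom := by
  rw [HomogeneousIdeal.irrelevant_le]
  intro i hi a ha
  have h : τ.e.symm a ∈ HomogeneousIdeal.irrelevant 𝒜 :=
    HomogeneousIdeal.mem_irrelevant_of_mem 𝒜 hi (τ.deg_symm i a ha)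
  have h2 : τ.hom (τ.e.symm a) ∈ ((HomogeneousIdeal.irrelevant 𝒜).map τ.hom).toIdeal :=
    Ideal.mem_map_of_mem (τ.hom : A →+* A) h
  have h3 : τ.hom (τ.e.symm a) = a := τ.e.apply_symm_apply a
  rwa [h3] at h2

/-- The induced map on the points of `V₊(J)`. -/
def FibreAut.point (τ : FibreAut 𝒜 J) (x : ClosedSub 𝒜 J) : ClosedSub 𝒜 J :=
  ⟨AlgebraicGeometry.ProjectiveSpectrum.comapFun τ.hom τ.irrelevant_le x.1,
    fun a ha => x.2 (τ.map_mem a ha)⟩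

theorem FibreAut.toIdeal_point (τ : FibreAut 𝒜 J) (x : ClosedSub 𝒜 J) :
    (τ.point x).1.asHomogeneousIdeal.toIdeal
      = x.1.asHomogeneousIdeal.toIdeal.comap (τ.e : A →+* A) := rfl

/-- The induced map on stalks, which sends `a / b` to `τ a / τ b`. -/
def FibreAut.stalkMap (τ : FibreAut 𝒜 J) (x : ClosedSub 𝒜 J) :
    Stalk (τ.point x) →+* Stalk x :=
  Ideal.quotientMap (stalkIdeal J x.1)
    (Localization.localRingHom (τ.point x).1.asHomogeneousIdeal.toIdeal
      x.1.asHomogeneousIdeal.toIdeal (τ.e : A →+* A) (τ.toIdeal_point x))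
    (by
      rw [Ideal.map_le_iff_le_comap]
      intro a ha
      rw [Ideal.mem_comap, Ideal.mem_comap, Localization.localRingHom_to_map]
      exact Ideal.mem_map_of_mem _ (τ.map_mem a ha))

theorem FibreAut.stalkMap_stalkFrac (τ : FibreAut 𝒜 J) (x : ClosedSub 𝒜 J) (a : A)
    (b : (τ.point x).1.asHomogeneousIdeal.toIdeal.primeCompl) :
    τ.stalkMap x (stalkFrac (τ.point x) a b) = stalkFrac x (τ.e a) ⟨τ.e b, b.2⟩ := by
  rw [stalkFrac, FibreAut.stalkMap, Ideal.quotientMap_mk, Localization.localRingHom_mk']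
  rfl

theorem FibreAut.stalkMap_smul (τ : FibreAut 𝒜 J) (x : ClosedSub 𝒜 J) (z : ℂ)
    (t : Stalk (τ.point x)) : τ.stalkMap x (z • t) = z • τ.stalkMap x t := by
  obtain ⟨t, rfl⟩ := Ideal.Quotient.mk_surjective t
  obtain ⟨a, b, rfl⟩ := IsLocalization.exists_mk'_eq
    (τ.point x).1.asHomogeneousIdeal.toIdeal.primeCompl t
  change τ.stalkMap x (z • stalkFrac (τ.point x) a b)
    = z • τ.stalkMap x (stalkFrac (τ.point x) a b)
  rw [smul_stalkFrac, FibreAut.stalkMap_stalkFrac, FibreAut.stalkMap_stalkFrac, smul_stalkFrac,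
    map_smul]

/-- The induced operator on families of germs; it maps the section given by a homogeneous
element `a` to the one given by `τ a`. -/
def FibreAut.act (τ : FibreAut 𝒜 J) : Module.End ℂ (∀ x : ClosedSub 𝒜 J, Stalk x) where
  toFun s x := τ.stalkMap x (s (τ.point x))
  map_add' s t := by
    funext x
    simp
  map_smul' z s := by
    funext x
    simp [FibreAut.stalkMap_smul]

end ProjFibre

/-! ### Polytopes and piecewise linear functions -/

/-- The pairing of an integral covector with a vector. -/
def pair {n : ℕ} (ℓ : Fin n → ℤ) (x : EuclideanSpace ℝ (Fin n)) : ℝ := ∑ j, (ℓ j : ℝ) * x j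

/-- `P = {x : ⟨x, ℓ i⟩ ≤ 1 for all i}`. -/
def polytope {n d : ℕ} (ℓ : Fin d → Fin n → ℤ) : Set (EuclideanSpace ℝ (Fin n)) :=
  {x | ∀ i, pair (ℓ i) x ≤ 1}

/-- The face `⟨x, ℓ i⟩ = 1` of `P`. -/
def facet {n d : ℕ} (ℓ : Fin d → Fin n → ℤ) (i : Fin d) : Set (EuclideanSpace ℝ (Fin n)) :=
  {x | x ∈ polytope ℓ ∧ pair (ℓ i) x = 1}

/-- `P` is a smooth Fano polytope, i.e. the moment polytope of a toric Fano manifold polarized by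
its anticanonical bundle: it is bounded, no inequality is redundant, and at each vertex the normals
of the facets through it form a basis of the lattice `ℤⁿ`. -/
structure IsSmoothFano {n d : ℕ} (ℓ : Fin d → Fin n → ℤ) : Prop where
  bounded : Bornology.IsBounded (polytope ℓ)
  facet_nonempty : ∀ i, (facet ℓ i).Nonempty
  linearIndependent : ∀ v ∈ (polytope ℓ).extremePoints ℝ,
    LinearIndependent ℤ (fun i : {i : Fin d // pair (ℓ i) v = 1} => ℓ i.1)
  span_eq_top : ∀ v ∈ (polytope ℓ).extremePoints ℝ,
    Submodule.span ℤ (Set.range (fun i : {i : Fin d // pair (ℓ i) v = 1} => ℓ i.1)) = ⊤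

/-- The data of a rational piecewise linear convex function `max_λ (⟨a λ, x⟩ + c λ)`. -/
structure RatPL (n : ℕ) where
  /-- the number of linear pieces, minus one -/
  m : ℕ
  /-- the slopes -/
  a : Fin (m + 1) → Fin n → ℚ
  /-- the constants -/
  c : Fin (m + 1) → ℚ

/-- The value of the function at a point. -/
def RatPL.eval {n : ℕ} (u : RatPL n) (x : EuclideanSpace ℝ (Fin n)) : ℝ :=
  Finset.univ.sup' Finset.univ_nonempty
    (fun t : Fin (u.m + 1) => ∑ j, (u.a t j : ℝ) * x j + (u.c t : ℝ))

/-- The function `l u`. -/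
def RatPL.scale {n : ℕ} (l : ℕ) (u : RatPL n) : RatPL n where
  m := u.m
  a t j := l * u.a t j
  c t := l * u.c t

theorem RatPL.eval_scale {n : ℕ} (l : ℕ) (u : RatPL n) (x : EuclideanSpace ℝ (Fin n)) :
    (u.scale l).eval x = l * u.eval x := by
  have h : (0 : ℝ) ≤ l := Nat.cast_nonneg l
  unfold RatPL.eval
  rw [Finset.mul₀_sup' h]
  refine Finset.sup'_congr _ rfl fun t _ => ?_
  simp [RatPL.scale, Finset.mul_sum, mul_add, mul_assoc]

/-- The closed polytope `Q = {(x, t) : x ∈ P, 0 ≤ t ≤ R - w(x)}`. -/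
def degPolytope {n d : ℕ} (ℓ : Fin d → Fin n → ℤ) (w : RatPL n) (R : ℕ) :
    Set (EuclideanSpace ℝ (Fin n) × ℝ) :=
  {p | p.1 ∈ polytope ℓ ∧ 0 ≤ p.2 ∧ p.2 ≤ R - w.eval p.1}

/-- A lattice point of `ℤⁿ × ℤ` as a point of `ℝⁿ × ℝ`. -/
def latticePoint {n : ℕ} (p : (Fin n → ℤ) × ℤ) : EuclideanSpace ℝ (Fin n) × ℝ :=
  (WithLp.toLp 2 (fun j => (p.1 j : ℝ)), (p.2 : ℝ))

/-- The conditions under which `w`, `R` and `r` define a toric degeneration: the slopes of `w` are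
integral, `0 ≤ t ≤ R - w(x)` has positive height over all of `P`, and `r Q` is the convex hull of
finitely many lattice points. The degeneration is polarized by the line bundle of `r Q`, which
restricts to the `r`-th power of the anticanonical bundle on the general fibre. -/
structure IsDegeneration {n d : ℕ} (ℓ : Fin d → Fin n → ℤ) (w : RatPL n) (R r : ℕ) : Prop where
  pos_R : 0 < R
  pos_r : 0 < r
  slopes : ∀ t j, ∃ z : ℤ, w.a t j = z
  lt_R : ∀ x ∈ polytope ℓ, w.eval x < R
  lattice : ∃ V : Finset ((Fin n → ℤ) × ℤ),
    (r : ℝ) • degPolytope ℓ w R = convexHull ℝ (latticePoint '' (V : Set ((Fin n → ℤ) × ℤ)))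

/-! ### The toric variety of `r Q` and its fibre over zero -/

/-- The monoid of all `(k, I, i)` with `(I, i)` a lattice point of `k r Q`
(see `mem_coneMonoid_iff`). -/
def coneMonoid {n d : ℕ} (ℓ : Fin d → Fin n → ℤ) (w : RatPL n) (R r : ℕ) :
    AddSubmonoid (ℕ × (Fin n → ℤ) × ℤ) where
  carrier := {p | (∀ i, ∑ j, (ℓ i j : ℝ) * p.2.1 j ≤ p.1 * r) ∧ (0 : ℝ) ≤ p.2.2 ∧
    ∀ t, (p.2.2 : ℝ) + ∑ j, (w.a t j : ℝ) * p.2.1 j + p.1 * r * w.c t ≤ p.1 * r * R}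
  zero_mem' := by simp
  add_mem' := by
    rintro ⟨k, I, i⟩ ⟨k', I', i'⟩ ⟨h1, h2, h3⟩ ⟨h1', h2', h3'⟩
    refine ⟨fun s => ?_, ?_, fun t => ?_⟩
    · have e := h1 s
      have e' := h1' s
      simp only [Prod.mk_add_mk, Pi.add_apply, Int.cast_add, mul_add, Finset.sum_add_distrib,
        Nat.cast_add] at *
      linarith
    · simp only [Prod.mk_add_mk, Int.cast_add] at *
      linarith
    · have e := h3 t
      have e' := h3' t
      simp only [Prod.mk_add_mk, Pi.add_apply, Int.cast_add, mul_add, Finset.sum_add_distrib,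
        Nat.cast_add] at *
      linarith

theorem mem_coneMonoid_iff {n d : ℕ} (ℓ : Fin d → Fin n → ℤ) (w : RatPL n) (R r k : ℕ)
    (hr : 0 < r) (hk : 0 < k) (I : Fin n → ℤ) (i : ℤ) :
    (k, I, i) ∈ coneMonoid ℓ w R r ↔
      latticePoint (I, i) ∈ ((k * r : ℕ) : ℝ) • degPolytope ℓ w R := by
  have hK : (0 : ℝ) < (k * r : ℕ) := by positivity
  rw [Set.mem_smul_set_iff_inv_smul_mem₀ hK.ne']
  have hc : ((k * r : ℕ) : ℝ) = k * r := by push_cast; ring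
  have e1 : ∀ (b : Fin n → ℝ) (K : ℝ),
      ∑ j, b j * (K⁻¹ • (latticePoint (I, i))).1 j = K⁻¹ * ∑ j, b j * I j := by
    intro b K
    rw [Finset.mul_sum]
    refine Finset.sum_congr rfl fun j _ => ?_
    simp [latticePoint]
    ring
  have e2 : ∀ K : ℝ, (K⁻¹ • (latticePoint (I, i))).2 = K⁻¹ * i := by
    intro K
    simp [latticePoint]
  simp only [degPolytope, polytope, pair, Set.mem_ofPred_eq, e1, e2, RatPL.eval]
  change ((∀ s, ∑ j, (ℓ s j : ℝ) * I j ≤ k * r) ∧ (0 : ℝ) ≤ i ∧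
    ∀ t, (i : ℝ) + ∑ j, (w.a t j : ℝ) * I j + k * r * w.c t ≤ k * r * R) ↔ _
  rw [← hc]
  generalize ((k * r : ℕ) : ℝ) = K at hK
  refine and_congr (forall_congr' fun s => ?_) (and_congr ?_ ?_)
  · rw [inv_mul_le_iff₀ hK, mul_one]
  · rw [mul_nonneg_iff_of_pos_left (inv_pos.2 hK)]
  · rw [le_sub_comm, Finset.sup'_le_iff]
    simp only [Finset.mem_univ, true_implies]
    refine forall_congr' fun t => ?_
    have hK' := hK.ne'
    have e3 : K * (K⁻¹ * ∑ j, (w.a t j : ℝ) * I j + w.c t)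
        = ∑ j, (w.a t j : ℝ) * I j + K * w.c t := by
      field_simp
    have e4 : K * (R - K⁻¹ * i) = K * R - i := by
      field_simp
    rw [← mul_le_mul_iff_right₀ hK (b := K⁻¹ * ∑ j, (w.a t j : ℝ) * I j + w.c t), e3, e4]
    constructor <;> intro h <;> linarith

section Degeneration

variable {n d : ℕ} (ℓ : Fin d → Fin n → ℤ) (w : RatPL n) (R r : ℕ)

/-- The semigroup algebra of the cone over `r Q`. The toric variety `M_Q` is its `Proj`, and the
line bundle is `O(1)`. -/
abbrev CoordRing : Type := AddMonoidAlgebra ℂ (coneMonoid ℓ w R r)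

/-- The degree `k` of `(k, I, i)`. -/
def degHom : coneMonoid ℓ w R r →+ ℕ where
  toFun p := p.1.1
  map_zero' := rfl
  map_add' _ _ := rfl

/-- The grading of the coordinate ring by `k`. -/
abbrev grading : ℕ → Submodule ℂ (CoordRing ℓ w R r) :=
  AddMonoidAlgebra.gradeBy ℂ (degHom ℓ w R r)

/-- The equivariant map `π : M_Q → ℙ¹` is `[χ^(k, I, i) : χ^(k, I, i + 1)]`, for all pairs of
lattice points of this form. Its fibre over `∞` is the divisor of the face `t = 0` of `Q`; its
fibre over `0`, the central fibre `M₀` of the degeneration, is cut out by this ideal. -/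
def centralIdeal : Ideal (CoordRing ℓ w R r) :=
  Ideal.span {f | ∃ p : coneMonoid ℓ w R r,
    (p.1.1, p.1.2.1, p.1.2.2 + 1) ∈ coneMonoid ℓ w R r ∧ f = AddMonoidAlgebra.single p 1}

/-- `H⁰(M₀, L ^ k)` as a space of families of germs. -/
abbrev centralSections (k : ℕ) :
    Submodule ℂ (∀ x : ClosedSub (grading ℓ w R r) (centralIdeal ℓ w R r), Stalk x) :=
  globalSections (grading ℓ w R r) (centralIdeal ℓ w R r) k

variable {ℓ w R r} in
/-- The endomorphism `χ^p ↦ exp (f p) χ^p` of the coordinate ring. -/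
def torusHom (f : coneMonoid ℓ w R r →+ ℝ) : CoordRing ℓ w R r →ₐ[ℂ] CoordRing ℓ w R r :=
  AddMonoidAlgebra.lift ℂ (CoordRing ℓ w R r) (coneMonoid ℓ w R r)
    { toFun := fun p => AddMonoidAlgebra.single p.toAdd ((Real.exp (f p.toAdd) : ℝ) : ℂ)
      map_one' := by simp [AddMonoidAlgebra.one_def]
      map_mul' := by
        intro p q
        simp [AddMonoidAlgebra.single_mul_single, Complex.exp_add] }

variable {ℓ w R r} in
theorem torusHom_single (f : coneMonoid ℓ w R r →+ ℝ) (p : coneMonoid ℓ w R r) (z : ℂ) :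
    torusHom f (AddMonoidAlgebra.single p z)
      = AddMonoidAlgebra.single p (z * ((Real.exp (f p) : ℝ) : ℂ)) := by
  simp [torusHom, AddMonoidAlgebra.lift_single]

variable {ℓ w R r} in
theorem torusHom_comp (f g : coneMonoid ℓ w R r →+ ℝ) (h : ∀ p, f p + g p = 0) :
    (torusHom f).comp (torusHom g) = AlgHom.id ℂ (CoordRing ℓ w R r) := by
  refine AddMonoidAlgebra.algHom_ext (fun p => ?_) (by ext)
  have : g p + f p = 0 := by rw [add_comm]; exact h p
  simp [torusHom_single, ← Complex.exp_add, ← Complex.ofReal_add, this]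

variable {ℓ w R r} in
theorem torusHom_mem (f : coneMonoid ℓ w R r →+ ℝ) (i : ℕ) (a : CoordRing ℓ w R r)
    (ha : a ∈ grading ℓ w R r i) : torusHom f a ∈ grading ℓ w R r i := by
  rw [← AddMonoidAlgebra.sum_coeff_single a, Finsupp.sum, map_sum]
  refine Submodule.sum_mem _ fun p hp => ?_
  have hi : degHom ℓ w R r p = i := (AddMonoidAlgebra.mem_gradeBy_iff _ _ _ _).1 ha hp
  rw [torusHom_single, ← hi]
  exact AddMonoidAlgebra.single_mem_gradeBy _ _ _

variable {ℓ w R r} in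
/-- The automorphism `χ^p ↦ exp (f p) χ^p`, an element of the torus acting on `M₀` and `L`. -/
def torusAut (f : coneMonoid ℓ w R r →+ ℝ) :
    FibreAut (grading ℓ w R r) (centralIdeal ℓ w R r) where
  e := AlgEquiv.ofAlgHom (torusHom f) (torusHom (-f)) (torusHom_comp _ _ (by simp))
    (torusHom_comp _ _ (by simp))
  deg i a ha := torusHom_mem f i a ha
  deg_symm i a ha := torusHom_mem (-f) i a ha
  map_mem a ha := by
    have h : centralIdeal ℓ w R r ≤ (centralIdeal ℓ w R r).comap (torusHom f) := by
      refine Ideal.span_le.2 ?_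
      rintro _ ⟨p, hp, rfl⟩
      have h1 : torusHom f (AddMonoidAlgebra.single p 1)
          = ((Real.exp (f p) : ℝ) : ℂ) • AddMonoidAlgebra.single p (1 : ℂ) := by
        simp [torusHom_single]
      have h2 : AddMonoidAlgebra.single p (1 : ℂ) ∈ centralIdeal ℓ w R r :=
        Ideal.subset_span ⟨p, hp, rfl⟩
      change torusHom f (AddMonoidAlgebra.single p 1) ∈ centralIdeal ℓ w R r
      rw [h1, Algebra.smul_def]
      exact Ideal.mul_mem_left _ _ h2
    exact h ha

/-- The value at `x` of the linear function `θ(x) = ∑ θ_j x_j`. -/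
def thetaFun (θ : Fin n → ℝ) (x : EuclideanSpace ℝ (Fin n)) : ℝ := ∑ j, θ j * x j

/-- The weight of `X = ∑ θ_j w_j ∂/∂w_j` on `χ^(k, I, i)`. -/
def weightX (θ : Fin n → ℝ) : coneMonoid ℓ w R r →+ ℝ where
  toFun p := ∑ j, θ j * (p.1.2.1 j : ℝ)
  map_zero' := by simp
  map_add' p q := by simp [mul_add, Finset.sum_add_distrib]

/-- The weight on `χ^(k, I, i)` of the generator of the `ℂ*`-action of the degeneration. -/
def weightV : coneMonoid ℓ w R r →+ ℝ where
  toFun p := (p.1.2.2 : ℝ)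
  map_zero' := by simp
  map_add' p q := by simp

/-- The subspace of `H⁰(M₀, L ^ k)` on which the time-one maps of the one-parameter groups of `X`
and of the `ℂ*`-action of the degeneration act with eigenvalues `exp x` and `exp v`. -/
def jointEigenspace (θ : Fin n → ℝ) (k : ℕ) (x v : ℝ) :
    Submodule ℂ (∀ x : ClosedSub (grading ℓ w R r) (centralIdeal ℓ w R r), Stalk x) :=
  centralSections ℓ w R r k ⊓
    Module.End.eigenspace (torusAut (weightX ℓ w R r θ)).act ((Real.exp x : ℝ) : ℂ) ⊓
    Module.End.eigenspace (torusAut (weightV ℓ w R r)).act ((Real.exp v : ℝ) : ℂ)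

/-- `N_k = dim H⁰(M₀, L ^ k)`. -/
def dimSections (k : ℕ) : ℕ := Module.finrank ℂ (centralSections ℓ w R r k)

/-- `S₁ = ∑ exp (X_α / K) v_α`, over the pairs of eigenvalues `(exp X_α, exp v_α)` counted with
multiplicity, where `K = k r`. -/
def sumS1 (θ : Fin n → ℝ) (k : ℕ) : ℝ :=
  ∑ᶠ p : ℝ × ℝ, (Module.finrank ℂ (jointEigenspace ℓ w R r θ k p.1 p.2) : ℝ) *
    (Real.exp (p.1 / (k * r)) * p.2)

/-- `S₂ = (1 / 2) ∑ exp (X_α / K) (X_α / K) (v_α / K)`, where `K = k r`. -/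
def sumS2 (θ : Fin n → ℝ) (k : ℕ) : ℝ :=
  1 / 2 * ∑ᶠ p : ℝ × ℝ, (Module.finrank ℂ (jointEigenspace ℓ w R r θ k p.1 p.2) : ℝ) *
    (Real.exp (p.1 / (k * r)) * (p.1 / (k * r)) * (p.2 / (k * r)))

/-- `-(S₁ - S₂) / (K N_k) = F₀ + F₁ K⁻¹ + O(K⁻²)` as `K = k r` tends to infinity. The number `F₁`
is the modified Futaki invariant of the degeneration. -/
def HasFutakiExpansion (θ : Fin n → ℝ) (F₀ F₁ : ℝ) : Prop :=
  Asymptotics.IsBigO Filter.atTop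
    (fun k : ℕ => -(sumS1 ℓ w R r θ k - sumS2 ℓ w R r θ k) /
        ((k * r : ℝ) * dimSections ℓ w R r k) - (F₀ + F₁ / (k * r)))
    (fun k : ℕ => 1 / (k * r : ℝ) ^ 2)

end Degeneration

/-- The unit outer normal of the facet `i`. -/
def unitNormal {n d : ℕ} (ℓ : Fin d → Fin n → ℤ) (i : Fin d) : EuclideanSpace ℝ (Fin n) :=
  let v : EuclideanSpace ℝ (Fin n) := WithLp.toLp 2 (fun j => (ℓ i j : ℝ))
  ‖v‖⁻¹ • v

/-- `∫_{∂P} f dσ`, where `dσ = ⟨ν, x⟩ dσ₀` with the unit outer normal `ν` and the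
`(n - 1)`-dimensional Lebesgue measure `dσ₀` on the facets. -/
def boundaryIntegral {n d : ℕ} (ℓ : Fin d → Fin n → ℤ) (f : EuclideanSpace ℝ (Fin n) → ℝ) : ℝ :=
  ∑ i, ∫ x in facet ℓ i, f x * inner ℝ (unitNormal ℓ i) x ∂μHE[n - 1]

/-- `𝓛(f) = ∫_{∂P} f e^θ dσ - ∫_P (n + θ) e^θ f dx`. -/
def calL {n d : ℕ} (ℓ : Fin d → Fin n → ℤ) (θ : Fin n → ℝ)
    (f : EuclideanSpace ℝ (Fin n) → ℝ) : ℝ :=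
  boundaryIntegral ℓ (fun x => f x * Real.exp (thetaFun θ x)) -
    ∫ x in polytope ℓ, (n + thetaFun θ x) * Real.exp (thetaFun θ x) * f x

/-- The Lebesgue volume of `P`. -/
def volP {n d : ℕ} (ℓ : Fin d → Fin n → ℤ) : ℝ := (MeasureTheory.volume (polytope ℓ)).toReal

end ToricFutaki

end

noncomputable section

namespace ToricFutaki

/-! ### Sections of `O(k)` on a reduced closed subscheme of `Proj`, as fractions with a global
denominator -/

section ProjFibre

variable {A : Type*} [CommRing A] [Algebra ℂ A]
variable {𝒜 : ℕ → Submodule ℂ A} [GradedAlgebra 𝒜] {J : Ideal A}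

/-! Put `w = l u` and `K = k r`. The proof turns `N_k`, `S₁` and `S₂` into sums over the lattice
points of `K P`, and then expands these sums to second order.

Algebra. The ideal of `M₀` in the semigroup algebra of the cone over `r Q` is spanned by the
monomials that can be raised by one in the direction `t`. Because `r Q` is a lattice polytope and
the slopes of `w` are integral, the roof `t = K (R - w)` has integral height over every lattice
point of `K P`. So the surviving monomials are exactly the roof points, one over each lattice point
(`isTop_iff`, `exists_isTop`). The ideal is an intersection of the prime ideals of the linear
pieces, up to degree zero (`isSaturatedRadical_centralIdeal`). Hence a section `s` of `L ^ k`, given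
only by germs, becomes a global element after multiplication by a power of any monomial of positive
degree, and comparing such numerators shows that no poles occur (`IsNumerator.exists_sub`). For `k ≥
1` the roof monomials of degree `k` are therefore a basis of `H⁰(M₀, L ^ k)` (`exists_eq_germ`,
`sectionOf_injective`). They are joint eigenvectors with weights `⟨θ, I⟩` and `K (R - w(I / K))`.

Analysis. The sums are controlled by `K⁻ⁿ ∑ g(I / K) = ∫_P g + (2 K)⁻¹ ∫_{∂P} g dσ + O(K⁻²)`
(`IsTame.abs_riemannSum_sub_le`), where `g` may have the kinks of `w`. Around each lattice point put
a unit cube. Interior cubes obey the midpoint rule. The weight of a cube cut by one facet depends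
only on the lattice distance from that facet, and central symmetry of the cube shows that each
lattice point of a facet is overcounted by one half. Points near two facets are `O(K ^ (n - 2))` in
number. The same collapse onto facets identifies the sum over the facet points with the integral
over the shell between `(K - 1) P` and `K P`. Polar coordinates on the cones over the facets turn
the shell into the boundary integral.

Conclusion. With `A = ∫_P e^θ (R - w)`, `A' = ∫_P θ e^θ (R - w)`, `B = ∫_{∂P} e^θ (R - w) dσ` and `V
= Vol(P)`, the numerator over `K ^ (n + 1)` is `-A + (A' - B) / (2 K)` and the denominator is `V + n
V / (2 K)`. The quotient has `F₀ = -A / V` and `F₁ = (n A + A' - B) / (2 V)`. The divergence theorem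
for `e^θ x` says that `𝓛` kills constants, so the last numerator is `𝓛(w)` and `R` disappears from
`F₁`. -/

theorem stalkFrac_eq_iff (x : ClosedSub 𝒜 J) (a a' : A)
    (b b' : x.1.asHomogeneousIdeal.toIdeal.primeCompl) :
    stalkFrac x a b = stalkFrac x a' b' ↔
      ∃ c ∈ x.1.asHomogeneousIdeal.toIdeal.primeCompl, c * (a * b' - a' * b) ∈ J := by
  rw [stalkFrac, stalkFrac, Ideal.Quotient.eq, ← IsLocalization.mk'_sub, stalkIdeal,
    IsLocalization.mk'_mem_map_algebraMap_iff]

/-- The germ at `x` of the section given by an element of `A`. -/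
def germ (x : ClosedSub 𝒜 J) : A →+* Stalk x :=
  (Ideal.Quotient.mk (stalkIdeal J x.1)).comp
    (algebraMap A (Localization.AtPrime x.1.asHomogeneousIdeal.toIdeal))

theorem germ_eq_stalkFrac (x : ClosedSub 𝒜 J) (a : A) : germ x a = stalkFrac x a 1 := by
  rw [stalkFrac, IsLocalization.mk'_one]
  rfl

theorem germ_mul_stalkFrac (x : ClosedSub 𝒜 J) (c a : A)
    (b : x.1.asHomogeneousIdeal.toIdeal.primeCompl) :
    germ x c * stalkFrac x a b = stalkFrac x (c * a) b := by
  rw [germ, stalkFrac, stalkFrac, ← IsLocalization.mul_mk'_eq_mk'_of_mul, map_mul]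
  rfl

theorem smul_germ (z : ℂ) (x : ClosedSub 𝒜 J) (a : A) : z • germ x a = germ x (z • a) := by
  rw [germ_eq_stalkFrac, smul_stalkFrac, germ_eq_stalkFrac]

theorem germ_eq_zero_of_mem (x : ClosedSub 𝒜 J) {a : A} (ha : a ∈ J) : germ x a = 0 :=
  Ideal.Quotient.eq_zero_iff_mem.2 (Ideal.mem_map_of_mem _ ha)

theorem isUnit_germ (x : ClosedSub 𝒜 J) {a : A} (ha : a ∉ x.1.asHomogeneousIdeal.toIdeal) :
    IsUnit (germ x a) :=
  (IsLocalization.map_units (Localization.AtPrime x.1.asHomogeneousIdeal.toIdeal)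
    (⟨a, ha⟩ : x.1.asHomogeneousIdeal.toIdeal.primeCompl)).map (Ideal.Quotient.mk _)

theorem mem_of_germ_eq_zero (x : ClosedSub 𝒜 J) {a : A} (h : germ x a = 0) :
    a ∈ x.1.asHomogeneousIdeal.toIdeal := by
  rw [← map_zero (germ x), germ_eq_stalkFrac, germ_eq_stalkFrac, stalkFrac_eq_iff] at h
  obtain ⟨c, hc, h⟩ := h
  have h' := x.2 h
  simp only [OneMemClass.coe_one, mul_one, sub_zero] at h'
  exact (x.1.isPrime.mem_or_mem h').resolve_left hc

theorem exists_basicOpen_subset {U : Set (ClosedSub 𝒜 J)} (hU : IsOpen U) {x : ClosedSub 𝒜 J}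
    (hx : x ∈ U) : ∃ (e : ℕ) (c : A), c ∈ 𝒜 e ∧ c ∉ x.1.asHomogeneousIdeal.toIdeal ∧
      ∀ y : ClosedSub 𝒜 J, c ∉ y.1.asHomogeneousIdeal.toIdeal → y ∈ U := by
  obtain ⟨V, hV, rfl⟩ := isOpen_induced_iff.1 hU
  obtain ⟨S, hS⟩ := (ProjectiveSpectrum.isOpen_iff 𝒜 V).1 hV
  have hx' : x.1 ∉ ProjectiveSpectrum.zeroLocus 𝒜 S := by
    rw [← hS]
    exact fun h => h hx
  rw [ProjectiveSpectrum.mem_zeroLocus, Set.not_subset] at hx'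
  obtain ⟨f, hf, hfx⟩ := hx'
  have hfx' : f ∉ x.1.asHomogeneousIdeal.toIdeal := hfx
  rw [x.1.asHomogeneousIdeal.isHomogeneous.mem_iff] at hfx'
  push Not at hfx'
  obtain ⟨e, he⟩ := hfx'
  refine ⟨e, _, SetLike.coe_mem _, he, fun y hy => ?_⟩
  by_contra hyV
  have h1 : y.1 ∈ ProjectiveSpectrum.zeroLocus 𝒜 S := by
    rw [← hS]
    exact hyV
  have h2 : f ∈ y.1.asHomogeneousIdeal.toIdeal := h1 hf
  exact hy (y.1.asHomogeneousIdeal.isHomogeneous e h2)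

/-- `J` is reduced and has no irrelevant components, as seen by elements of positive degree. -/
def IsSaturatedRadical (𝒜 : ℕ → Submodule ℂ A) [GradedAlgebra 𝒜] (J : Ideal A) : Prop :=
  ∀ e, 0 < e → ∀ z ∈ 𝒜 e,
    (∀ x : ClosedSub 𝒜 J, z ∈ x.1.asHomogeneousIdeal.toIdeal) → z ∈ J

theorem mem_of_forall_germ_eq (hJ : IsSaturatedRadical 𝒜 J) {e : ℕ} (he : 0 < e) {a b : A}
    (ha : a ∈ 𝒜 e) (hb : b ∈ 𝒜 e) (h : ∀ x : ClosedSub 𝒜 J, germ x a = germ x b) :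
    a - b ∈ J := by
  refine hJ e he _ (sub_mem ha hb) fun x => mem_of_germ_eq_zero x ?_
  rw [map_sub, h, sub_self]

/-- If `s = a / b` on the basic open set of `c`, then `c b` is a denominator valid everywhere: `c b
s = c a` holds where `c` is invertible, and both sides vanish pointwise elsewhere. Reducedness turns
this pointwise statement into an identity, so no higher power of `c` is needed. -/
theorem exists_mul_eq_germ_of_point (hJ : IsSaturatedRadical 𝒜 J) {k : ℕ} (hk : 0 < k)
    {s : ∀ x : ClosedSub 𝒜 J, Stalk x} (hs : IsSection k s) (x : ClosedSub 𝒜 J) :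
    ∃ (e : ℕ) (g F : A), g ∈ 𝒜 e ∧ g ∉ x.1.asHomogeneousIdeal.toIdeal ∧
      ∀ y, germ y g * s y = germ y F := by
  obtain ⟨U, hU, hxU, i, a, b, ha, hb, h⟩ := hs x
  obtain ⟨m, c, hc, hcx, hcU⟩ := exists_basicOpen_subset hU hxU
  obtain ⟨hbx, -⟩ := h x hxU
  refine ⟨m + i, c * b, c * a, SetLike.mul_mem_graded hc hb,
    fun hcb => (x.1.isPrime.mem_or_mem hcb).elim hcx hbx, fun y => ?_⟩
  obtain ⟨V, hV, hyV, j, a', b', ha', hb', h'⟩ := hs y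
  obtain ⟨m', c', hc', hcy', hcV'⟩ := exists_basicOpen_subset hV hyV
  obtain ⟨hby, e⟩ := h' y hyV
  rw [e, germ_mul_stalkFrac, germ_eq_stalkFrac, stalkFrac_eq_iff]
  refine ⟨c', hcy', ?_⟩
  have hdeg : c' * (c * b * a' * (1 : y.1.asHomogeneousIdeal.toIdeal.primeCompl) - c * a * b')
      ∈ 𝒜 (m' + (m + (i + (j + k)))) := by
    refine SetLike.mul_mem_graded hc' (sub_mem ?_ ?_)
    · rw [OneMemClass.coe_one, mul_one, mul_assoc]
      exact SetLike.mul_mem_graded hc (SetLike.mul_mem_graded hb ha')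
    · have := SetLike.mul_mem_graded hc (SetLike.mul_mem_graded ha hb')
      rwa [← mul_assoc, show m + (i + k + j) = m + (i + (j + k)) by omega] at this
  -- The degree is positive because `k > 0`. At a prime containing `c` or `c'` there is nothing to
  -- prove; at the others both fractions compute `s z`.
  refine hJ _ (by omega) _ hdeg fun z => ?_
  by_cases hcz : c ∈ z.1.asHomogeneousIdeal.toIdeal
  · refine Ideal.mul_mem_left _ _ (sub_mem ?_ ?_)
    · exact Ideal.mul_mem_right _ _ (Ideal.mul_mem_right _ _ (Ideal.mul_mem_right _ _ hcz))
    · exact Ideal.mul_mem_right _ _ (Ideal.mul_mem_right _ _ hcz)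
  by_cases hcz' : c' ∈ z.1.asHomogeneousIdeal.toIdeal
  · exact Ideal.mul_mem_right _ _ hcz'
  obtain ⟨hbz, e1⟩ := h z (hcU z hcz)
  obtain ⟨hbz', e2⟩ := h' z (hcV' z hcz')
  obtain ⟨w, hw, hwJ⟩ := (stalkFrac_eq_iff _ _ _ _ _).1 (e1.symm.trans e2)
  have h3 := (z.1.isPrime.mem_or_mem (z.2 hwJ)).resolve_left hw
  have : c' * (c * b * a' * (1 : y.1.asHomogeneousIdeal.toIdeal.primeCompl) - c * a * b')
      = -(c' * c) * (a * b' - a' * b) := by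
    rw [OneMemClass.coe_one]; ring
  rw [this]
  exact Ideal.mul_mem_left _ _ h3

/-- The homogeneous denominators of `s` generate an ideal `I` that lies in no point of `Proj`, by
the local statement. A homogeneous prime over `I` is thus irrelevant and contains every `f` of
positive degree. Since the radical of `I` is the intersection of such primes, a power of `f` is a
denominator. -/
theorem exists_pow_mul_eq_germ (hJ : IsSaturatedRadical 𝒜 J) (hJh : J.IsHomogeneous 𝒜)
    {k : ℕ} (hk : 0 < k)
    {s : ∀ x : ClosedSub 𝒜 J, Stalk x} (hs : IsSection k s) {e : ℕ} (he : 0 < e) {f : A}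
    (hf : f ∈ 𝒜 e) :
    ∃ (M : ℕ) (F : A), 0 < M ∧ F ∈ 𝒜 (M * e + k) ∧ ∀ y, germ y (f ^ M) * s y = germ y F := by
  let I₀ : Ideal A :=
    { carrier := {g | ∃ F, ∀ y : ClosedSub 𝒜 J, germ y g * s y = germ y F}
      zero_mem' := ⟨0, fun y => by simp⟩
      add_mem' := by
        rintro g g' ⟨F, h⟩ ⟨F', h'⟩
        exact ⟨F + F', fun y => by rw [map_add, add_mul, h, h', map_add]⟩
      smul_mem' := by
        rintro c g ⟨F, h⟩
        exact ⟨c * F, fun y => by rw [smul_eq_mul, map_mul, mul_assoc, h, map_mul]⟩ }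
  let I : Ideal A := Ideal.span {g | g ∈ I₀ ∧ SetLike.IsHomogeneousElem 𝒜 g}
  have hI : I.IsHomogeneous 𝒜 := Ideal.homogeneous_span 𝒜 _ fun x hx => hx.2
  have hII : I ≤ I₀ := Ideal.span_le.2 fun x hx => hx.1
  have hJI : J ≤ I := by
    intro z hz
    rw [hI.mem_iff]
    intro i
    refine Ideal.subset_span ⟨⟨0, fun y => ?_⟩, i, SetLike.coe_mem _⟩
    rw [germ_eq_zero_of_mem y (hJh i hz), zero_mul, map_zero]
  have hrad : f ∈ I.radical := by
    rw [hI.radical_eq, Ideal.mem_sInf]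
    rintro P ⟨hP, hIP, hPp⟩
    by_contra hfP
    let x : ClosedSub 𝒜 J := ⟨⟨⟨P, hP⟩, hPp, fun hirr =>
      hfP (hirr (HomogeneousIdeal.mem_irrelevant_of_mem 𝒜 he hf))⟩, hJI.trans hIP⟩
    obtain ⟨m, g, F, hg, hgx, h⟩ := exists_mul_eq_germ_of_point hJ hk hs x
    exact hgx (hIP (Ideal.subset_span ⟨⟨F, h⟩, m, hg⟩))
  obtain ⟨M, hM⟩ := hrad
  obtain ⟨F, hF⟩ := hII hM
  -- One more factor `f`, of positive degree, removes the component of degree zero of the numerator,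
  -- about which `IsSaturatedRadical` says nothing.
  have hF' : ∀ y, germ y (f ^ (M + 1)) * s y = germ y (f * F) := fun y => by
    rw [pow_succ', map_mul, mul_assoc, hF, map_mul]
  set F' := f * F with hF'def
  classical
  refine ⟨M + 1, DirectSum.decompose 𝒜 F' ((M + 1) * e + k), M.succ_pos, SetLike.coe_mem _,
    fun y => ?_⟩
  have hcomp : ∀ j, j ≠ (M + 1) * e + k → (DirectSum.decompose 𝒜 F' j : A) ∈ J := by
    intro j hj
    rcases Nat.eq_zero_or_pos j with rfl | hj0
    · rw [hF'def, DirectSum.coe_decompose_mul_of_left_mem_of_not_le 𝒜 hf (by omega)]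
      exact J.zero_mem
    -- With `s = a / b` near `x`, the element `f ^ (M + 1) a - F' b` lies in the prime of `x`. In
    -- degree `j + i` only the `j`-th component of `F'` times `b` is left, and `b` is not in the
    -- prime.
    refine hJ j hj0 _ (SetLike.coe_mem _) fun x => ?_
    obtain ⟨U, hU, hxU, i, a, b, ha, hb, h⟩ := hs x
    obtain ⟨hbx, e1⟩ := h x hxU
    have h1 := hF' x
    rw [e1, germ_mul_stalkFrac, germ_eq_stalkFrac, stalkFrac_eq_iff] at h1
    obtain ⟨w, hw, h2⟩ := h1
    have h3 := (x.1.isPrime.mem_or_mem (x.2 h2)).resolve_left hw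
    have h4 := x.1.asHomogeneousIdeal.isHomogeneous (j + i) h3
    rw [OneMemClass.coe_one, mul_one, DirectSum.decompose_sub] at h4
    have hfa : f ^ (M + 1) * a ∈ 𝒜 ((M + 1) * e + (i + k)) := by
      refine SetLike.mul_mem_graded ?_ ha
      have := SetLike.pow_mem_graded (M + 1) hf
      rwa [smul_eq_mul] at this
    change (DirectSum.decompose 𝒜 (f ^ (M + 1) * a) (j + i) : A) -
      (DirectSum.decompose 𝒜 (F' * b) (j + i) : A) ∈ _ at h4
    rw [DirectSum.decompose_of_mem_ne 𝒜 hfa (by omega), zero_sub,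
      DirectSum.coe_decompose_mul_of_right_mem_of_le 𝒜 hb (Nat.le_add_left i j),
      Nat.add_sub_cancel] at h4
    have h5 := neg_mem h4
    rw [neg_neg] at h5
    exact (x.1.isPrime.mem_or_mem h5).resolve_right hbx
  rw [hF']
  conv_lhs => rw [← DirectSum.sum_support_decompose 𝒜 F', map_sum]
  by_cases hsupp : (M + 1) * e + k ∈ (DirectSum.decompose 𝒜 F').support
  · rw [Finset.sum_eq_single_of_mem _ hsupp]
    exact fun j _ hj => germ_eq_zero_of_mem y (hcomp j hj)
  · rw [Finset.sum_eq_zero fun j hj =>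
      germ_eq_zero_of_mem y (hcomp j fun h => hsupp (h ▸ hj))]
    rw [DFinsupp.notMem_support_iff] at hsupp
    rw [hsupp]
    simp

theorem isSection_germ {k : ℕ} {a : A} (ha : a ∈ 𝒜 k) :
    IsSection (𝒜 := 𝒜) (J := J) k fun x => germ x a := by
  intro x
  refine ⟨Set.univ, isOpen_univ, trivial, 0, a, 1, by simpa using ha,
    SetLike.GradedOne.one_mem, fun y _ => ?_⟩
  exact ⟨(Ideal.ne_top_iff_one _).1 y.1.isPrime.ne_top, germ_eq_stalkFrac y a⟩

theorem FibreAut.act_germ (τ : FibreAut 𝒜 J) (a : A) :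
    τ.act (fun x => germ x a) = fun x => germ x (τ.e a) := by
  funext x
  change τ.stalkMap x (germ (τ.point x) a) = _
  rw [germ_eq_stalkFrac, FibreAut.stalkMap_stalkFrac, germ_eq_stalkFrac]
  congr 1
  ext
  simp

end ProjFibre

/-! ### The cone over `r Q` and the roof `t = K (R - w)` -/

section Cone

variable {n d : ℕ} {ℓ : Fin d → Fin n → ℤ} {w : RatPL n} {R r : ℕ}

/-- The slack of the inequality of the facet `i` at `(k, I, i)`. -/
def facetSlack (ℓ : Fin d → Fin n → ℤ) (r : ℕ) (s : Fin d) :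
    ℕ × (Fin n → ℤ) × ℤ →+ ℚ where
  toFun p := p.1 * r - ∑ j, (ℓ s j : ℚ) * p.2.1 j
  map_zero' := by simp
  map_add' p q := by
    simp only [Prod.fst_add, Prod.snd_add, Pi.add_apply, Int.cast_add, Nat.cast_add, mul_add,
      Finset.sum_add_distrib]
    ring

/-- The slack of the inequality `i ≤ k r (R - w)` for one linear piece of `w`. -/
def pieceSlack (w : RatPL n) (R r : ℕ) (t : Fin (w.m + 1)) :
    ℕ × (Fin n → ℤ) × ℤ →+ ℚ where
  toFun p := p.1 * r * (R - w.c t) - ∑ j, w.a t j * p.2.1 j - p.2.2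
  map_zero' := by simp
  map_add' p q := by
    simp only [Prod.fst_add, Prod.snd_add, Pi.add_apply, Int.cast_add, Nat.cast_add, mul_add,
      Finset.sum_add_distrib]
    ring

theorem facetSlack_apply (s : Fin d) (p : ℕ × (Fin n → ℤ) × ℤ) :
    facetSlack ℓ r s p = p.1 * r - ∑ j, (ℓ s j : ℚ) * p.2.1 j := rfl

theorem pieceSlack_apply (t : Fin (w.m + 1)) (p : ℕ × (Fin n → ℤ) × ℤ) :
    pieceSlack w R r t p = p.1 * r * (R - w.c t) - ∑ j, w.a t j * p.2.1 j - p.2.2 := rfl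

theorem mem_coneMonoid {p : ℕ × (Fin n → ℤ) × ℤ} :
    p ∈ coneMonoid ℓ w R r ↔
      (∀ s, 0 ≤ facetSlack ℓ r s p) ∧ 0 ≤ p.2.2 ∧ ∀ t, 0 ≤ pieceSlack w R r t p := by
  change ((∀ i, ∑ j, (ℓ i j : ℝ) * p.2.1 j ≤ p.1 * r) ∧ (0 : ℝ) ≤ p.2.2 ∧
    ∀ t, (p.2.2 : ℝ) + ∑ j, (w.a t j : ℝ) * p.2.1 j + p.1 * r * w.c t ≤ p.1 * r * R) ↔ _
  refine and_congr (forall_congr' fun s => ?_) (and_congr (by norm_cast) (forall_congr' fun t => ?_))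
  · rw [facetSlack_apply, sub_nonneg, ← Rat.cast_le (K := ℝ)]
    push_cast
    rfl
  · rw [pieceSlack_apply, ← Rat.cast_le (K := ℝ)]
    push_cast
    constructor <;> intro h <;> linarith

/-- The elements of the cone that lie on the graph of `R - w`. -/
def IsTop (p : coneMonoid ℓ w R r) : Prop := ∃ t, pieceSlack w R r t p.1 = 0

theorem pieceSlack_nonneg (t : Fin (w.m + 1)) (p : coneMonoid ℓ w R r) :
    0 ≤ pieceSlack w R r t p.1 := (mem_coneMonoid.1 p.2).2.2 t

theorem facetSlack_nonneg (s : Fin d) (p : coneMonoid ℓ w R r) :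
    0 ≤ facetSlack ℓ r s p.1 := (mem_coneMonoid.1 p.2).1 s

/-- Each linear piece cuts out a face of the monoid. This makes the projection `faceHom`
multiplicative and its kernel a candidate for a point of `M₀`. -/
theorem pieceSlack_add_eq_zero {t : Fin (w.m + 1)} {p q : coneMonoid ℓ w R r} :
    pieceSlack w R r t (p + q).1 = 0 ↔ pieceSlack w R r t p.1 = 0 ∧ pieceSlack w R r t q.1 = 0 := by
  rw [AddSubmonoid.coe_add, map_add]
  exact add_eq_zero_iff_of_nonneg (pieceSlack_nonneg t p) (pieceSlack_nonneg t q)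

theorem pieceSlack_nsmul_eq_zero {t : Fin (w.m + 1)} {p : coneMonoid ℓ w R r} {N : ℕ}
    (hN : 0 < N) : pieceSlack w R r t (N • p).1 = 0 ↔ pieceSlack w R r t p.1 = 0 := by
  rw [AddSubmonoidClass.coe_nsmul, map_nsmul, smul_eq_zero]
  simp [hN.ne']

/-- The point `I / (k r)`. -/
def scaledPoint (k r : ℕ) (I : Fin n → ℤ) : EuclideanSpace ℝ (Fin n) :=
  WithLp.toLp 2 fun j => (I j : ℝ) / (k * r)

theorem sum_mul_scaledPoint (b : Fin n → ℝ) {k r : ℕ} (I : Fin n → ℤ) :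
    ∑ j, b j * scaledPoint k r I j = (∑ j, b j * I j) / (k * r) := by
  rw [Finset.sum_div]
  exact Finset.sum_congr rfl fun j _ => by simp [scaledPoint, mul_div_assoc]

theorem scaledPoint_mem_polytope {k r : ℕ} (hk : 0 < k) (hr : 0 < r) {I : Fin n → ℤ} {i : ℤ} :
    scaledPoint k r I ∈ polytope ℓ ↔ ∀ s, 0 ≤ facetSlack ℓ r s (k, I, i) := by
  have hK : (0 : ℝ) < k * r := by positivity
  refine forall_congr' fun s => ?_
  rw [pair, sum_mul_scaledPoint, div_le_one hK, facetSlack_apply, sub_nonneg,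
    ← Rat.cast_le (K := ℝ)]
  push_cast
  rfl

theorem le_eval (w : RatPL n) (t : Fin (w.m + 1)) (x : EuclideanSpace ℝ (Fin n)) :
    ∑ j, (w.a t j : ℝ) * x j + w.c t ≤ w.eval x :=
  Finset.le_sup' (fun t : Fin (w.m + 1) => ∑ j, (w.a t j : ℝ) * x j + (w.c t : ℝ))
    (Finset.mem_univ t)

theorem exists_eval_eq (w : RatPL n) (x : EuclideanSpace ℝ (Fin n)) :
    ∃ t, w.eval x = ∑ j, (w.a t j : ℝ) * x j + w.c t := by
  obtain ⟨t, -, h⟩ := Finset.exists_mem_eq_sup' Finset.univ_nonempty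
    (fun t : Fin (w.m + 1) => ∑ j, (w.a t j : ℝ) * x j + (w.c t : ℝ))
  exact ⟨t, h⟩

theorem pieceSlack_cast {k r : ℕ} (hk : 0 < k) (hr : 0 < r) (t : Fin (w.m + 1)) (I : Fin n → ℤ)
    (i : ℤ) : ((pieceSlack w R r t (k, I, i) : ℚ) : ℝ) = k * r *
      (R - (∑ j, (w.a t j : ℝ) * scaledPoint k r I j + w.c t)) - i := by
  have hK : (k * r : ℝ) ≠ 0 := by positivity
  rw [pieceSlack_apply, sum_mul_scaledPoint]
  push_cast
  field_simp
  ring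

theorem pieceSlack_pos (h : IsDegeneration ℓ w R r) {k : ℕ} (hk : 0 < k) {I : Fin n → ℤ}
    (hI : scaledPoint k r I ∈ polytope ℓ) (t : Fin (w.m + 1)) :
    0 < pieceSlack w R r t (k, I, 0) := by
  have hr := h.pos_r
  have hK : (0 : ℝ) < k * r := by positivity
  rw [← Rat.cast_lt (K := ℝ), pieceSlack_cast hk hr]
  push_cast
  rw [sub_zero]
  refine mul_pos hK ?_
  linarith [h.lt_R _ hI, le_eval w t (scaledPoint k r I)]

/-- The linear form `⟨a t, x⟩ + τ`, with `τ` the height coordinate, has maximum `r (R - c t)` on `r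
Q`, attained over `r x` because the piece is active at `x`. On a convex hull of lattice points the
maximum is attained at one of these points, and there the form is an integer since the slopes are.
-/
theorem exists_int_of_active (h : IsDegeneration ℓ w R r) {x : EuclideanSpace ℝ (Fin n)}
    (hx : x ∈ polytope ℓ) {t : Fin (w.m + 1)}
    (ht : w.eval x = ∑ j, (w.a t j : ℝ) * x j + w.c t) :
    ∃ z : ℤ, (r : ℚ) * (R - w.c t) = z := by
  obtain ⟨V, hV⟩ := h.lattice
  have hr : (0 : ℝ) < r := by exact_mod_cast h.pos_r
  let L : EuclideanSpace ℝ (Fin n) × ℝ → ℝ := fun p => ∑ j, (w.a t j : ℝ) * p.1 j + p.2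
  have hLle : ∀ p ∈ (r : ℝ) • degPolytope ℓ w R, L p ≤ r * (R - w.c t) := by
    rintro _ ⟨p, hp, rfl⟩
    have h1 := hp.2.2
    have h2 := le_eval w t p.1
    have h3 : L ((r : ℝ) • p) = r * (∑ j, (w.a t j : ℝ) * p.1 j + p.2) := by
      simp only [L, Prod.smul_fst, Prod.smul_snd, PiLp.smul_apply, smul_eq_mul, mul_add,
        Finset.mul_sum]
      congr 1
      exact Finset.sum_congr rfl fun j _ => by ring
    change L ((r : ℝ) • p) ≤ _
    rw [h3]
    exact mul_le_mul_of_nonneg_left (by linarith) hr.le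
  have hmem : (r : ℝ) • (x, (R : ℝ) - w.eval x) ∈ (r : ℝ) • degPolytope ℓ w R :=
    Set.smul_mem_smul_set ⟨hx, by linarith [h.lt_R x hx], le_rfl⟩
  have hLeq : L ((r : ℝ) • (x, (R : ℝ) - w.eval x)) = r * (R - w.c t) := by
    have : ∑ j, (w.a t j : ℝ) * (r * x j) = r * ∑ j, (w.a t j : ℝ) * x j := by
      rw [Finset.mul_sum]
      exact Finset.sum_congr rfl fun j _ => by ring
    simp only [L, Prod.smul_fst, Prod.smul_snd, PiLp.smul_apply, smul_eq_mul, this, ht]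
    ring
  have hex : ∃ v ∈ V, r * (R - w.c t) ≤ L (latticePoint v) := by
    by_contra! hcon
    have hsub : convexHull ℝ (latticePoint '' (V : Set ((Fin n → ℤ) × ℤ)))
        ⊆ {p | L p < r * (R - w.c t)} := by
      refine convexHull_min ?_ ?_
      · rintro _ ⟨v, hv, rfl⟩
        exact hcon v hv
      · refine convex_halfSpace_lt ⟨fun p q => ?_, fun c p => ?_⟩ _
        · simp only [L, Prod.fst_add, Prod.snd_add, PiLp.add_apply, mul_add,
            Finset.sum_add_distrib]
          ring
        · simp only [L, Prod.smul_fst, Prod.smul_snd, PiLp.smul_apply, smul_eq_mul, mul_add,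
            Finset.mul_sum]
          congr 1
          exact Finset.sum_congr rfl fun j _ => by ring
    have := hsub (hV ▸ hmem)
    exact absurd hLeq (ne_of_lt this)
  obtain ⟨v, hv, hvL⟩ := hex
  have hvQ : latticePoint v ∈ (r : ℝ) • degPolytope ℓ w R := by
    rw [hV]
    exact subset_convexHull ℝ _ ⟨v, hv, rfl⟩
  have hveq : L (latticePoint v) = r * (R - w.c t) := le_antisymm (hLle _ hvQ) hvL
  choose a ha using h.slopes t
  refine ⟨∑ j, a j * v.1 j + v.2, ?_⟩
  have : (((r : ℚ) * (R - w.c t) : ℚ) : ℝ) = ((∑ j, a j * v.1 j + v.2 : ℤ) : ℝ) := by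
    push_cast
    rw [← hveq]
    simp [L, latticePoint, ha]
  exact_mod_cast this

/-- The piece of least slack is the one active at `I / (k r)`, so its constant is integral after
scaling by `r`. Inactive pieces may have fractional slack. -/
theorem exists_isTop_piece (h : IsDegeneration ℓ w R r) {k : ℕ} {I : Fin n → ℤ} {i : ℤ}
    (hI : ∀ s, 0 ≤ facetSlack ℓ r s (k, I, i)) :
    ∃ t, (∀ t', pieceSlack w R r t (k, I, i) ≤ pieceSlack w R r t' (k, I, i)) ∧
      ∃ z : ℤ, pieceSlack w R r t (k, I, i) = z := by
  obtain ⟨t, -, ht⟩ := Finset.exists_min_image Finset.univ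
    (fun t => pieceSlack w R r t (k, I, i)) Finset.univ_nonempty
  have hr := h.pos_r
  refine ⟨t, fun t' => ht t' (Finset.mem_univ _), ?_⟩
  choose a ha using h.slopes t
  have hz : ∃ z : ℤ, (k : ℚ) * (r * (R - w.c t)) = z := by
    rcases Nat.eq_zero_or_pos k with rfl | hk
    · exact ⟨0, by simp⟩
    have hx := (scaledPoint_mem_polytope (i := i) hk hr).2 hI
    have hact : w.eval (scaledPoint k r I)
        = ∑ j, (w.a t j : ℝ) * scaledPoint k r I j + w.c t := by
      refine le_antisymm ?_ (le_eval w t _)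
      obtain ⟨t', ht'⟩ := exists_eval_eq w (scaledPoint k r I)
      have h1 := ht t' (Finset.mem_univ _)
      rw [← Rat.cast_le (K := ℝ), pieceSlack_cast hk hr, pieceSlack_cast hk hr] at h1
      have hK : (0 : ℝ) < k * r := by positivity
      have h2 := le_of_mul_le_mul_left (sub_le_sub_iff_right _ |>.1 h1) hK
      rw [ht']
      linarith
    obtain ⟨z, hz⟩ := exists_int_of_active h hx hact
    exact ⟨k * z, by rw [hz]; push_cast; ring⟩
  obtain ⟨z, hz⟩ := hz
  refine ⟨z - ∑ j, a j * I j - i, ?_⟩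
  rw [pieceSlack_apply]
  simp only [ha]
  push_cast
  rw [← hz]
  ring

/-- Raising the height by one lowers every slack by one. The least slack is a nonnegative integer,
so it is either zero or leaves room for this step. -/
theorem isTop_iff (h : IsDegeneration ℓ w R r) (p : coneMonoid ℓ w R r) :
    IsTop p ↔ (p.1.1, p.1.2.1, p.1.2.2 + 1) ∉ coneMonoid ℓ w R r := by
  have hstep : ∀ t, pieceSlack w R r t (p.1.1, p.1.2.1, p.1.2.2 + 1)
      = pieceSlack w R r t p.1 - 1 := by
    intro t
    rw [pieceSlack_apply, pieceSlack_apply]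
    push_cast
    ring
  constructor
  · rintro ⟨t, ht⟩ hmem
    have := (mem_coneMonoid.1 hmem).2.2 t
    rw [hstep, ht] at this
    linarith
  · intro hmem
    have hp := mem_coneMonoid.1 p.2
    obtain ⟨t, ht, z, hz⟩ := exists_isTop_piece h (k := p.1.1) (I := p.1.2.1) (i := p.1.2.2) hp.1
    change pieceSlack w R r t p.1 = z at hz
    refine ⟨t, ?_⟩
    by_contra hne
    refine hmem (mem_coneMonoid.2 ⟨hp.1, ?_, fun t' => ?_⟩)
    · exact add_nonneg hp.2.1 zero_le_one
    · rw [hstep, sub_nonneg]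
      refine le_trans ?_ (ht t')
      have h0 := hp.2.2 t
      change 1 ≤ pieceSlack w R r t p.1
      rw [hz] at h0 hne ⊢
      have : 0 < z := lt_of_le_of_ne (by exact_mod_cast h0) fun h' => hne (by rw [← h']; simp)
      exact_mod_cast this

/-- The lattice points of `k r P` are the projections of the elements of the graph of `R - w`. -/
theorem exists_isTop (h : IsDegeneration ℓ w R r) {k : ℕ} (hk : 0 < k) {I : Fin n → ℤ}
    (hI : scaledPoint k r I ∈ polytope ℓ) :
    ∃ p : coneMonoid ℓ w R r, IsTop p ∧ p.1.1 = k ∧ p.1.2.1 = I := by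
  have hf := (scaledPoint_mem_polytope (i := 0) hk h.pos_r).1 hI
  obtain ⟨t, ht, z, hz⟩ := exists_isTop_piece h hf
  have hstep : ∀ t, pieceSlack w R r t (k, I, z) = pieceSlack w R r t (k, I, 0) - z := by
    intro t
    rw [pieceSlack_apply, pieceSlack_apply]
    push_cast
    ring
  refine ⟨⟨(k, I, z), mem_coneMonoid.2 ⟨hf, ?_, fun t' => ?_⟩⟩, ⟨t, ?_⟩, rfl, rfl⟩
  · have := pieceSlack_pos h hk hI t
    rw [hz] at this
    exact_mod_cast this.le
  · rw [hstep, sub_nonneg, ← hz]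
    exact ht t'
  · rw [hstep, hz, sub_self]

theorem IsTop.height_eq (h : IsDegeneration ℓ w R r) {p : coneMonoid ℓ w R r} (hp : IsTop p)
    (hk : 0 < p.1.1) :
    (p.1.2.2 : ℝ) = p.1.1 * r * (R - w.eval (scaledPoint p.1.1 r p.1.2.1)) := by
  have hr := h.pos_r
  have hK : (0 : ℝ) < p.1.1 * r := by positivity
  have e : ∀ t, ((pieceSlack w R r t p.1 : ℚ) : ℝ) = _ :=
    fun t => pieceSlack_cast (R := R) hk hr t p.1.2.1 p.1.2.2
  obtain ⟨t, ht⟩ := hp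
  have e1 := e t
  rw [ht, Rat.cast_zero] at e1
  obtain ⟨t', ht'⟩ := exists_eval_eq w (scaledPoint p.1.1 r p.1.2.1)
  have e2 := e t'
  rw [← ht'] at e2
  have h2 : (0 : ℝ) ≤ (pieceSlack w R r t' p.1 : ℚ) := by exact_mod_cast pieceSlack_nonneg t' p
  have h3 := mul_le_mul_of_nonneg_left (le_eval w t (scaledPoint p.1.1 r p.1.2.1)) hK.le
  linarith

theorem isTop_ext (h : IsDegeneration ℓ w R r) {p q : coneMonoid ℓ w R r} (hp : IsTop p)
    (hq : IsTop q) (hk : 0 < p.1.1) (h1 : p.1.1 = q.1.1) (h2 : p.1.2.1 = q.1.2.1) : p = q := by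
  have e1 := hp.height_eq h hk
  have e2 := hq.height_eq h (h1 ▸ hk)
  rw [← h1, ← h2, ← e1] at e2
  exact Subtype.ext (Prod.ext h1 (Prod.ext h2 (by exact_mod_cast e2.symm)))

/-- The ray `p + x δ` leaves the cone `φ ≥ 0` at the least ratio `φ a p / (-φ a δ)`. This time is
rational, so a multiple of the exit point is a combination of `p` and `δ` with natural coefficients.
-/
theorem exists_exit {ι G : Type*} [Finite ι] [AddCommMonoid G] (φ : ι → G →+ ℚ) {p δ : G}
    (hp : ∀ a, 0 ≤ φ a p) (hpδ : ∀ a, φ a p = 0 → 0 ≤ φ a δ) (hδ : ∃ a, φ a δ < 0) :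
    ∃ α β : ℕ, 0 < α ∧ 0 < β ∧ (∀ a, 0 ≤ φ a (β • p + α • δ)) ∧
      ∃ a, φ a δ < 0 ∧ φ a (β • p + α • δ) = 0 := by
  have := Fintype.ofFinite ι
  classical
  obtain ⟨a, ha, hmin⟩ := Finset.exists_min_image (Finset.univ.filter fun a => φ a δ < 0)
    (fun a => φ a p / (-φ a δ)) (by
      obtain ⟨a, ha⟩ := hδ
      exact ⟨a, by simpa using ha⟩)
  simp only [Finset.mem_filter, Finset.mem_univ, true_and] at ha hmin
  set x : ℚ := φ a p / (-φ a δ) with hx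
  have hxpos : 0 < x := div_pos
    (lt_of_le_of_ne (hp a) fun h => absurd (hpδ a h.symm) (not_le.2 ha)) (neg_pos.2 ha)
  have hβ : (0 : ℚ) < x.den := by exact_mod_cast x.den_pos
  have hnum : ((x.num.toNat : ℕ) : ℚ) = x * x.den := by
    rw [Rat.mul_den_eq_num]
    exact_mod_cast Int.toNat_of_nonneg (Rat.num_pos.2 hxpos).le
  have e : ∀ b, φ b (x.den • p + x.num.toNat • δ) = x.den * (φ b p + x * φ b δ) := by
    intro b
    rw [map_add, map_nsmul, map_nsmul, nsmul_eq_mul, nsmul_eq_mul, hnum]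
    ring
  -- Numerator and denominator of the exit time.
  refine ⟨x.num.toNat, x.den, ?_, x.den_pos, fun b => ?_, a, ha, ?_⟩
  · have := Rat.num_pos.2 hxpos
    omega
  · rw [e]
    refine mul_nonneg hβ.le ?_
    by_cases hb : φ b δ < 0
    · have := hmin b hb
      rw [le_div_iff₀ (neg_pos.2 hb)] at this
      linarith
    · exact add_nonneg (hp b) (mul_nonneg hxpos.le (not_lt.1 hb))
  · rw [e, hx]
    have := ha.ne
    field_simp
    ring

end Cone

/-! ### The central fibre: its points, and `H⁰(M₀, L ^ k)` -/

section Fibre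

variable {n d : ℕ} {ℓ : Fin d → Fin n → ℤ} {w : RatPL n} {R r : ℕ}

/-- A monomial ideal is the span of its monomials. The set of monoid elements that can be raised by
one is stable under addition of monoid elements, and its complement is the roof. -/
theorem mem_centralIdeal (h : IsDegeneration ℓ w R r) {z : CoordRing ℓ w R r} :
    z ∈ centralIdeal ℓ w R r ↔ ∀ p, IsTop p → z.coeff p = 0 := by
  have e : centralIdeal ℓ w R r = Ideal.span (AddMonoidAlgebra.of' ℂ (coneMonoid ℓ w R r) ''
      {p | (p.1.1, p.1.2.1, p.1.2.2 + 1) ∈ coneMonoid ℓ w R r}) := by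
    rw [centralIdeal]
    congr 1
    ext f
    constructor
    · rintro ⟨p, hp, rfl⟩
      exact ⟨p, hp, rfl⟩
    · rintro ⟨p, hp, rfl⟩
      exact ⟨p, hp, rfl⟩
  rw [e, AddMonoidAlgebra.mem_ideal_span_of'_image]
  constructor
  · intro H p hp
    by_contra hne
    obtain ⟨m, hm, c, rfl⟩ := H p (Finsupp.mem_support_iff.2 hne)
    refine (isTop_iff h _).1 hp ?_
    have := add_mem c.2 hm
    rwa [Prod.mk_add_mk, Prod.mk_add_mk, ← add_assoc] at this
  · intro H p hp
    refine ⟨p, ?_, 0, (zero_add p).symm⟩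
    by_contra hmem
    exact (Finsupp.mem_support_iff.1 hp) (H p ((isTop_iff h p).2 hmem))

theorem isHomogeneous_centralIdeal :
    (centralIdeal ℓ w R r).IsHomogeneous (grading ℓ w R r) := by
  refine Ideal.homogeneous_span _ _ ?_
  rintro _ ⟨p, -, rfl⟩
  exact ⟨_, AddMonoidAlgebra.single_mem_gradeBy _ _ _⟩

/-- Ensures that the semigroup algebra has no zero divisors, so that kernels of its endomorphisms
`faceHom t` are prime. -/
instance : UniqueSums (coneMonoid ℓ w R r) :=
  UniqueSums.of_injective_addHom
    ((coneMonoid ℓ w R r).subtype : coneMonoid ℓ w R r →ₙ+ ℕ × (Fin n → ℤ) × ℤ)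
    Subtype.val_injective inferInstance

open Classical in
/-- The projection of the coordinate ring to the algebra of the face of one linear piece. -/
def faceHom (t : Fin (w.m + 1)) : CoordRing ℓ w R r →ₐ[ℂ] CoordRing ℓ w R r :=
  AddMonoidAlgebra.lift ℂ (CoordRing ℓ w R r) (coneMonoid ℓ w R r)
    { toFun := fun p => if pieceSlack w R r t p.toAdd.1 = 0 then
        AddMonoidAlgebra.single p.toAdd 1 else 0
      map_one' := by simp [AddMonoidAlgebra.one_def]
      map_mul' := by
        intro p q
        rw [toAdd_mul]
        simp only [pieceSlack_add_eq_zero]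
        by_cases hp : pieceSlack w R r t p.toAdd.1 = 0 <;>
        by_cases hq : pieceSlack w R r t q.toAdd.1 = 0 <;>
        simp [hp, hq, AddMonoidAlgebra.single_mul_single] }

open Classical in
theorem coeff_faceHom (t : Fin (w.m + 1)) (z : CoordRing ℓ w R r) (p : coneMonoid ℓ w R r) :
    (faceHom t z).coeff p = if pieceSlack w R r t p.1 = 0 then z.coeff p else 0 := by
  induction z using AddMonoidAlgebra.induction_linear with
  | zero => simp
  | add y z hy hz =>
    rw [map_add, AddMonoidAlgebra.coeff_add, AddMonoidAlgebra.coeff_add, Finsupp.add_apply,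
      Finsupp.add_apply, hy, hz]
    split_ifs
    · rfl
    · exact add_zero 0
  | single q c =>
    have e : faceHom t (AddMonoidAlgebra.single q c)
        = if pieceSlack w R r t q.1 = 0 then AddMonoidAlgebra.single q c else 0 := by
      rw [faceHom, AddMonoidAlgebra.lift_single]
      by_cases hq : pieceSlack w R r t q.1 = 0 <;> simp [hq]
    rw [e]
    by_cases hqp : q = p
    · subst hqp
      split_ifs <;> rfl
    · have : (AddMonoidAlgebra.single q c).coeff p = 0 := by
        rw [AddMonoidAlgebra.coeff_single, Finsupp.single_eq_of_ne (Ne.symm hqp)]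
      rw [this, ite_self]
      split_ifs
      · exact this
      · rfl

theorem faceHom_eq_zero_iff {t : Fin (w.m + 1)} {z : CoordRing ℓ w R r} :
    faceHom t z = 0 ↔ ∀ p : coneMonoid ℓ w R r, pieceSlack w R r t p.1 = 0 → z.coeff p = 0 := by
  classical
  constructor
  · intro H p hp
    have := coeff_faceHom t z p
    rw [H, if_pos hp] at this
    exact this.symm
  · intro H
    ext p
    rw [coeff_faceHom]
    split_ifs with hp
    · exact H p hp
    · rfl

theorem coeff_decompose (z : CoordRing ℓ w R r) (i : ℕ) (p : coneMonoid ℓ w R r) :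
    (DirectSum.decompose (grading ℓ w R r) z i : CoordRing ℓ w R r).coeff p
      = if p.1.1 = i then z.coeff p else 0 := by
  classical
  have hz : z = ∑ j ∈ (DirectSum.decompose (grading ℓ w R r) z).support,
      (DirectSum.decompose (grading ℓ w R r) z j : CoordRing ℓ w R r) :=
    (DirectSum.sum_support_decompose (grading ℓ w R r) z).symm
  have key : ∀ j, p.1.1 ≠ j →
      (DirectSum.decompose (grading ℓ w R r) z j : CoordRing ℓ w R r).coeff p = 0 := by
    intro j hj
    by_contra hne
    exact hj ((AddMonoidAlgebra.mem_gradeBy_iff _ _ _ _).1 (SetLike.coe_mem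
      (DirectSum.decompose (grading ℓ w R r) z j)) (Finsupp.mem_support_iff.2 hne))
  split_ifs with hi
  · conv_rhs => rw [hz, AddMonoidAlgebra.coeff_sum, Finsupp.finsetSum_apply]
    by_cases hs : i ∈ (DirectSum.decompose (grading ℓ w R r) z).support
    · rw [Finset.sum_eq_single_of_mem i hs]
      exact fun j _ hj => key j fun h => hj (h ▸ hi)
    · rw [Finset.sum_eq_zero fun j hj => key j fun h => hs (by rw [← hi, h]; exact hj),
        DFinsupp.notMem_support_iff.1 hs]
      rfl
  · exact key i hi

/-- The homogeneous ideal of the face of one linear piece. -/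
def faceIdeal (t : Fin (w.m + 1)) : HomogeneousIdeal (grading ℓ w R r) :=
  ⟨RingHom.ker (faceHom t : CoordRing ℓ w R r →ₐ[ℂ] CoordRing ℓ w R r), by
    intro i z hz
    rw [RingHom.mem_ker, faceHom_eq_zero_iff] at hz ⊢
    intro p hp
    rw [coeff_decompose]
    split_ifs
    · exact hz p hp
    · rfl⟩

/-- If a roof monomial `χ^p` of positive degree occurs in `z`, take a piece `t` whose face contains
`p`. Its face ideal is prime, contains the ideal of `M₀` and misses `χ^p`, so it is a point of `M₀`;
the coefficient of `z` at `p` shows that `z` does not vanish there. -/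
theorem isSaturatedRadical_centralIdeal (h : IsDegeneration ℓ w R r) :
    IsSaturatedRadical (grading ℓ w R r) (centralIdeal ℓ w R r) := by
  intro e he z hze hz
  rw [mem_centralIdeal h]
  rintro p ⟨t, ht⟩
  by_contra hne
  have hpe : p.1.1 = e :=
    (AddMonoidAlgebra.mem_gradeBy_iff _ _ _ _).1 hze (Finsupp.mem_support_iff.2 hne)
  have hrel : ¬ HomogeneousIdeal.irrelevant (grading ℓ w R r) ≤ faceIdeal t := by
    intro hle
    have h1 : AddMonoidAlgebra.single p (1 : ℂ) ∈ grading ℓ w R r e := by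
      rw [← hpe]
      exact AddMonoidAlgebra.single_mem_gradeBy _ _ _
    have h2 := hle (HomogeneousIdeal.mem_irrelevant_of_mem _ he h1)
    have h3 : faceHom t (AddMonoidAlgebra.single p (1 : ℂ)) = 0 := h2
    have h4 := faceHom_eq_zero_iff.1 h3 p ht
    simp at h4
  have hprime : (faceIdeal (ℓ := ℓ) (w := w) (R := R) (r := r) t).toIdeal.IsPrime :=
    RingHom.ker_isPrime _
  have hJ : centralIdeal ℓ w R r ≤ (faceIdeal t).toIdeal := by
    intro y hy
    refine RingHom.mem_ker.2 (faceHom_eq_zero_iff.2 fun q hq => ?_)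
    exact (mem_centralIdeal h).1 hy q ⟨t, hq⟩
  have hzp : z ∈ (faceIdeal (ℓ := ℓ) (w := w) (R := R) (r := r) t).toIdeal :=
    hz ⟨⟨faceIdeal t, hprime, hrel⟩, hJ⟩
  exact hne (faceHom_eq_zero_iff.1 (RingHom.mem_ker.1 hzp) p ht)

/-- `F = χ ^ p s`, and modulo the ideal of `M₀` only monomials in common cells with `p` occur. -/
structure IsNumerator (k : ℕ)
    (s : ∀ x : ClosedSub (grading ℓ w R r) (centralIdeal ℓ w R r), Stalk x)
    (p : coneMonoid ℓ w R r) (F : CoordRing ℓ w R r) : Prop where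
  mem : F ∈ grading ℓ w R r (p.1.1 + k)
  mul_eq : ∀ y, germ y (AddMonoidAlgebra.single p (1 : ℂ)) * s y = germ y F
  compat : ∀ q : coneMonoid ℓ w R r, IsTop q → F.coeff q ≠ 0 →
    ∃ t, pieceSlack w R r t p.1 = 0 ∧ pieceSlack w R r t q.1 = 0

theorem exists_isNumerator (h : IsDegeneration ℓ w R r) {k : ℕ} (hk : 0 < k)
    {s : ∀ x : ClosedSub (grading ℓ w R r) (centralIdeal ℓ w R r), Stalk x} (hs : IsSection k s)
    (p : coneMonoid ℓ w R r) (hp : 0 < p.1.1) :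
    ∃ (N : ℕ) (F : CoordRing ℓ w R r), 0 < N ∧ IsNumerator k s (N • p) F := by
  obtain ⟨M, F, hM, hF, hmul⟩ := exists_pow_mul_eq_germ (isSaturatedRadical_centralIdeal h)
    isHomogeneous_centralIdeal hk hs hp
    (AddMonoidAlgebra.single_mem_gradeBy (degHom ℓ w R r) p (1 : ℂ))
  rw [AddMonoidAlgebra.single_pow, one_pow] at hmul
  have hdeg : (M • p).1.1 = M * p.1.1 := by
    rw [AddSubmonoidClass.coe_nsmul]
    rfl
  have hdeg' : ((M + M) • p).1.1 = (M * p.1.1) + (M * p.1.1) := by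
    rw [AddSubmonoidClass.coe_nsmul, ← add_mul]
    rfl
  -- The power is doubled so that the numerator itself is divisible by `χ^(M p)`. A roof monomial of
  -- it then has the form `M p + b`, and the piece containing this sum contains `p`, which is the
  -- required compatibility.
  refine ⟨M + M, AddMonoidAlgebra.single (M • p) 1 * F, by omega, ?_, fun y => ?_, ?_⟩
  · rw [hdeg', add_assoc, ← hdeg]
    refine SetLike.mul_mem_graded (AddMonoidAlgebra.single_mem_gradeBy (degHom ℓ w R r) _ _) ?_
    rw [hdeg]
    exact hF
  · rw [add_smul, ← mul_one (1 : ℂ), ← AddMonoidAlgebra.single_mul_single, map_mul, mul_assoc,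
      mul_one, hmul, map_mul]
  · rintro q ⟨t, ht⟩ hne
    have hex : ∃ b, M • p + b = q := by
      by_contra! hcon
      exact hne (AddMonoidAlgebra.coeff_single_mul_of_forall_add_ne _ _ hcon)
    obtain ⟨b, rfl⟩ := hex
    have h1 := (pieceSlack_add_eq_zero.1 ht).1
    rw [pieceSlack_nsmul_eq_zero hM] at h1
    exact ⟨t, (pieceSlack_nsmul_eq_zero (by omega)).2 h1, ht⟩

/-- Cross-multiplication: both products represent `χ^(p + q) s`, have the same degree, and so differ
by an element of the ideal of `M₀`. -/
theorem IsNumerator.coeff_eq (h : IsDegeneration ℓ w R r) {k : ℕ} (hk : 0 < k)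
    {s : ∀ x : ClosedSub (grading ℓ w R r) (centralIdeal ℓ w R r), Stalk x}
    {p q : coneMonoid ℓ w R r} {F G : CoordRing ℓ w R r} (hF : IsNumerator k s p F)
    (hG : IsNumerator k s q G) {σ : coneMonoid ℓ w R r} (hσ : IsTop σ) :
    (AddMonoidAlgebra.single q (1 : ℂ) * F).coeff σ
      = (AddMonoidAlgebra.single p (1 : ℂ) * G).coeff σ := by
  have h1 : AddMonoidAlgebra.single q (1 : ℂ) * F ∈ grading ℓ w R r (q.1.1 + (p.1.1 + k)) :=
    SetLike.mul_mem_graded (AddMonoidAlgebra.single_mem_gradeBy (degHom ℓ w R r) _ _) hF.mem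
  have h2 : AddMonoidAlgebra.single p (1 : ℂ) * G ∈ grading ℓ w R r (q.1.1 + (p.1.1 + k)) := by
    rw [add_left_comm]
    exact SetLike.mul_mem_graded (AddMonoidAlgebra.single_mem_gradeBy (degHom ℓ w R r) _ _) hG.mem
  have h3 := mem_of_forall_germ_eq (isSaturatedRadical_centralIdeal h) (by omega) h1 h2 fun y => by
    rw [map_mul, map_mul, ← hF.mul_eq, ← hG.mul_eq, mul_left_comm]
  have h4 := (mem_centralIdeal h).1 h3 σ hσ
  rwa [AddMonoidAlgebra.coeff_sub, Finsupp.sub_apply, sub_eq_zero] at h4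

/-- A section has no poles. If `δ = τ - p` violated an inequality, walk from `p` in the direction
`δ` to the first wall `a` with `φ a δ < 0`, and take a numerator `G` of `s` for a multiple `N q₀` of
the exit point. The coefficient at `N q₀ + τ` is that of `F` at `τ` in one cross product. In the
other it vanishes: dividing by `χ^p` leaves `N q₀ + δ`, which has slack `φ a δ < 0` and lies outside
the cone. -/
theorem IsNumerator.exists_sub (h : IsDegeneration ℓ w R r) {k : ℕ} (hk : 0 < k)
    {s : ∀ x : ClosedSub (grading ℓ w R r) (centralIdeal ℓ w R r), Stalk x} (hs : IsSection k s)
    {p : coneMonoid ℓ w R r} (hp : 0 < p.1.1) {F : CoordRing ℓ w R r} (hF : IsNumerator k s p F)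
    {τ : coneMonoid ℓ w R r} (hτ : IsTop τ) (hne : F.coeff τ ≠ 0) :
    ∃ δ : coneMonoid ℓ w R r, δ.1.1 = k ∧ δ + p = τ := by
  obtain ⟨t, htp, htτ⟩ := hF.compat τ hτ hne
  have hdeg : τ.1.1 = p.1.1 + k :=
    (AddMonoidAlgebra.mem_gradeBy_iff _ _ _ _).1 hF.mem (Finsupp.mem_support_iff.2 hne)
  let δ : ℕ × (Fin n → ℤ) × ℤ := (k, τ.1.2.1 - p.1.2.1, τ.1.2.2 - p.1.2.2)
  have hδ : δ + p.1 = τ.1 := by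
    refine Prod.ext ?_ (Prod.ext ?_ ?_)
    · change k + p.1.1 = τ.1.1
      omega
    · exact sub_add_cancel _ _
    · exact sub_add_cancel _ _
  have htδ : pieceSlack w R r t δ = 0 := by
    have := congrArg (pieceSlack w R r t) hδ
    rw [map_add, htp, htτ, add_zero] at this
    exact this
  let φ : Fin d ⊕ Fin (w.m + 1) → ℕ × (Fin n → ℤ) × ℤ →+ ℚ :=
    Sum.elim (facetSlack ℓ r) (pieceSlack w R r)
  have hφ : ∀ c : coneMonoid ℓ w R r, ∀ a, 0 ≤ φ a c.1 := by
    rintro c (s | t)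
    · exact facetSlack_nonneg s c
    · exact pieceSlack_nonneg t c
  -- The family `φ` omits the inequality of the bottom face `t = 0`. On the piece `t` in positive
  -- degree it is automatic, because `w < R` on `P` keeps the roof above the bottom.
  have hmem : ∀ q : ℕ × (Fin n → ℤ) × ℤ, 0 < q.1 → (∀ a, 0 ≤ φ a q) →
      pieceSlack w R r t q = 0 → q ∈ coneMonoid ℓ w R r := by
    intro q hq hpos hqt
    refine mem_coneMonoid.2 ⟨fun s => hpos (Sum.inl s), ?_, fun t => hpos (Sum.inr t)⟩
    have h1 := pieceSlack_pos h hq ((scaledPoint_mem_polytope (i := q.2.2) hq h.pos_r).2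
      fun s => hpos (Sum.inl s)) t
    have h2 : pieceSlack w R r t (q.1, q.2.1, 0) = pieceSlack w R r t q + q.2.2 := by
      rw [pieceSlack_apply, pieceSlack_apply]
      push_cast
      ring
    rw [h2, hqt, zero_add] at h1
    exact_mod_cast h1.le
  by_cases hneg : ∃ a, φ a δ < 0
  · exfalso
    -- The walk does not leave the cone at once: on a wall through `p`, the slack of `δ` is that of
    -- `τ`.
    have hzero : ∀ a, φ a p.1 = 0 → 0 ≤ φ a δ := by
      intro a ha
      have := congrArg (φ a) hδ
      rw [map_add, ha, add_zero] at this
      rw [this]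
      exact hφ τ a
    obtain ⟨α, β, hα, hβ, hpos, a, hneg, ha⟩ := exists_exit φ (hφ p) hzero hneg
    have hqdeg : 0 < (β • p.1 + α • δ).1 := Nat.add_pos_left (Nat.mul_pos hβ hp) _
    have hqt : pieceSlack w R r t (β • p.1 + α • δ) = 0 := by
      rw [map_add, map_nsmul, map_nsmul, htp, htδ, smul_zero, smul_zero, add_zero]
    let q₀ : coneMonoid ℓ w R r := ⟨β • p.1 + α • δ, hmem _ hqdeg hpos hqt⟩
    obtain ⟨N, G, hN, hG⟩ := exists_isNumerator h hk hs q₀ hqdeg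
    have hqa : φ a (N • q₀).1 = 0 := by
      rw [AddSubmonoidClass.coe_nsmul, map_nsmul, ha, smul_zero]
    have hqt' : pieceSlack w R r t (N • q₀).1 = 0 := (pieceSlack_nsmul_eq_zero hN).2 hqt
    have hσ : IsTop (N • q₀ + τ) := ⟨t, pieceSlack_add_eq_zero.2 ⟨hqt', htτ⟩⟩
    have e := hF.coeff_eq h hk hG hσ
    rw [AddMonoidAlgebra.coeff_single_mul_add, one_mul,
      AddMonoidAlgebra.coeff_single_mul_of_forall_add_ne] at e
    · exact hne e
    · intro b hb
      have h1 : φ a (p + b).1 = φ a (N • q₀ + τ).1 := by rw [hb]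
      rw [AddSubmonoid.coe_add, AddSubmonoid.coe_add, map_add, map_add, hqa, ← hδ, map_add,
        zero_add, add_comm, add_right_cancel_iff] at h1
      have := hφ b a
      rw [h1] at this
      linarith
  · push Not at hneg
    exact ⟨⟨δ, hmem δ hk hneg htδ⟩, rfl, Subtype.ext hδ⟩

theorem finite_isTop_deg (h : IsDegeneration ℓ w R r) (hP : Bornology.IsBounded (polytope ℓ))
    {k : ℕ} (hk : 0 < k) : {p : coneMonoid ℓ w R r | IsTop p ∧ p.1.1 = k}.Finite := by
  have hr := h.pos_r
  have hK : (0 : ℝ) < k * r := by positivity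
  obtain ⟨M, hM⟩ := hP.exists_norm_le
  have hfin : {I : Fin n → ℤ | scaledPoint k r I ∈ polytope ℓ}.Finite := by
    refine (Set.Finite.pi' fun _ : Fin n => Set.finite_Icc (-⌈M * (k * r)⌉) ⌈M * (k * r)⌉).subset ?_
    intro I hI j
    have h1 := (PiLp.norm_apply_le (scaledPoint k r I) j).trans (hM _ hI)
    rw [scaledPoint, PiLp.toLp_apply, Real.norm_eq_abs, abs_div, abs_of_pos hK,
      div_le_iff₀ hK] at h1
    have h2 := abs_le.1 (h1.trans (Int.le_ceil _))
    exact ⟨by exact_mod_cast h2.1, by exact_mod_cast h2.2⟩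
  refine Set.Finite.of_finite_image (hfin.subset ?_) (f := fun p => p.1.2.1) ?_
  · rintro _ ⟨p, ⟨-, rfl⟩, rfl⟩
    exact (scaledPoint_mem_polytope hk hr).2 (mem_coneMonoid.1 p.2).1
  · rintro p ⟨hp, hpk⟩ q ⟨hq, hqk⟩ hpq
    exact isTop_ext h hp hq (hpk ▸ hk) (hpk.trans hqk.symm) hpq

/-- Every section of `L ^ k` on the central fibre comes from the coordinate ring. -/
theorem exists_eq_germ (h : IsDegeneration ℓ w R r) (hP : Bornology.IsBounded (polytope ℓ))
    {k : ℕ} (hk : 0 < k)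
    {s : ∀ x : ClosedSub (grading ℓ w R r) (centralIdeal ℓ w R r), Stalk x} (hs : IsSection k s) :
    ∃ f : {p : coneMonoid ℓ w R r // IsTop p ∧ p.1.1 = k} →₀ ℂ,
      s = fun x => germ x (.ofCoeff (f.mapDomain Subtype.val)) := by
  classical
  have : Finite {p : coneMonoid ℓ w R r // IsTop p ∧ p.1.1 = k} := finite_isTop_deg h hP hk
  have hN : ∀ p : {p : coneMonoid ℓ w R r // IsTop p ∧ p.1.1 = k},
      ∃ (N : ℕ) (F : CoordRing ℓ w R r), 0 < N ∧ IsNumerator k s (N • p.1) F := fun p =>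
    exists_isNumerator h hk hs p.1 (by rw [p.2.2]; exact hk)
  choose N F hN hF using hN
  -- If `s` is a combination of monomials, its coefficient at `χ^p` can be read off at `p + N p` in
  -- the numerator of `χ^(N p) s`. This defines the candidate `g`.
  let f : {p : coneMonoid ℓ w R r // IsTop p ∧ p.1.1 = k} →₀ ℂ :=
    Finsupp.equivFunOnFinite.symm fun p => (F p).coeff (p.1 + N p • p.1)
  let g : CoordRing ℓ w R r := .ofCoeff (f.mapDomain Subtype.val)
  have hg : ∀ p : {p : coneMonoid ℓ w R r // IsTop p ∧ p.1.1 = k},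
      g.coeff p.1 = (F p).coeff (p.1 + N p • p.1) := by
    intro p
    change (f.mapDomain Subtype.val) p.1 = _
    rw [Finsupp.mapDomain_apply Subtype.val_injective]
    rfl
  have hg' : ∀ p : coneMonoid ℓ w R r, ¬(IsTop p ∧ p.1.1 = k) → g.coeff p = 0 := by
    intro p hp
    refine Finsupp.mapDomain_of_notMem_range _ _ fun hmem => hp ?_
    obtain ⟨q, rfl⟩ := hmem
    exact q.2
  have hgk : g ∈ grading ℓ w R r k := by
    rw [AddMonoidAlgebra.mem_gradeBy_iff]
    intro p hp
    by_contra hpk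
    exact Finsupp.mem_support_iff.1 hp (hg' p fun hh => hpk hh.2)
  -- Every numerator of `s` is `χ^p g` modulo the ideal of `M₀`. By `IsNumerator.exists_sub` only
  -- roof points `p + δ` with `δ` of degree `k` matter. There `hcoef` compares `G` with the
  -- numerator chosen at `δ`, using that `p` and `δ` lie on a common piece.
  have key : ∀ (p : coneMonoid ℓ w R r) (G : CoordRing ℓ w R r), 0 < p.1.1 →
      IsNumerator k s p G → G - AddMonoidAlgebra.single p 1 * g ∈ centralIdeal ℓ w R r := by
    intro p G hp hG
    rw [mem_centralIdeal h]
    intro τ hτ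
    rw [AddMonoidAlgebra.coeff_sub, Finsupp.sub_apply, sub_eq_zero]
    have hcoef : ∀ δ : coneMonoid ℓ w R r, δ.1.1 = k → p + δ = τ → G.coeff τ = g.coeff δ := by
      rintro δ hδ rfl
      obtain ⟨t, ht⟩ := hτ
      have ht' := pieceSlack_add_eq_zero.1 ht
      have hδ' : IsTop δ ∧ δ.1.1 = k := ⟨⟨t, ht'.2⟩, hδ⟩
      rw [hg ⟨δ, hδ'⟩]
      have hσ : IsTop (N ⟨δ, hδ'⟩ • δ + (p + δ)) :=
        ⟨t, pieceSlack_add_eq_zero.2 ⟨(pieceSlack_nsmul_eq_zero (hN _)).2 ht'.2, ht⟩⟩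
      have e := hG.coeff_eq h hk (hF ⟨δ, hδ'⟩) hσ
      rw [AddMonoidAlgebra.coeff_single_mul_add, one_mul, add_left_comm,
        AddMonoidAlgebra.coeff_single_mul_add, one_mul] at e
      rw [e, add_comm]
    by_cases hne : G.coeff τ = 0
    · rw [hne]
      by_cases hex : ∃ b, p + b = τ
      · obtain ⟨b, hb⟩ := hex
        by_cases hbk : b.1.1 = k
        · rw [← hb, AddMonoidAlgebra.coeff_single_mul_add, one_mul, ← hcoef b hbk hb, hne]
        · rw [← hb, AddMonoidAlgebra.coeff_single_mul_add, one_mul, hg' b fun hh => hbk hh.2]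
      · push Not at hex
        rw [AddMonoidAlgebra.coeff_single_mul_of_forall_add_ne _ _ hex]
    · obtain ⟨δ, hδ, hδp⟩ := hG.exists_sub h hk hs hp hτ hne
      rw [add_comm] at hδp
      rw [hcoef δ hδ hδp, ← hδp, AddMonoidAlgebra.coeff_single_mul_add, one_mul]
  refine ⟨f, funext fun y => ?_⟩
  -- A point of `Proj` does not contain the irrelevant ideal, hence misses a monomial of positive
  -- degree. A power of it is a unit in the stalk and can be cancelled from the numerator identity.
  have hex : ∃ p : coneMonoid ℓ w R r, 0 < p.1.1 ∧
      AddMonoidAlgebra.single p (1 : ℂ) ∉ y.1.asHomogeneousIdeal.toIdeal := by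
    by_contra! hcon
    refine y.1.not_irrelevant_le ?_
    rw [HomogeneousIdeal.irrelevant_le]
    intro i hi a ha
    change a ∈ y.1.asHomogeneousIdeal.toIdeal
    rw [← AddMonoidAlgebra.sum_coeff_single a, Finsupp.sum]
    refine sum_mem fun p hp => ?_
    have hpi : p.1.1 = i := (AddMonoidAlgebra.mem_gradeBy_iff _ _ _ _).1 ha hp
    have := Ideal.mul_mem_left _ (algebraMap ℂ _ (a.coeff p)) (hcon p (hpi ▸ hi))
    rwa [← Algebra.smul_def, AddMonoidAlgebra.smul_single, smul_eq_mul, mul_one] at this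
  obtain ⟨p, hp, hpy⟩ := hex
  obtain ⟨M, G, hM, hG⟩ := exists_isNumerator h hk hs p hp
  have hMp : 0 < (M • p).1.1 := by
    rw [AddSubmonoidClass.coe_nsmul]
    exact Nat.mul_pos hM hp
  have hu : IsUnit (germ y (AddMonoidAlgebra.single (M • p) (1 : ℂ))) := by
    refine isUnit_germ y fun hmem => hpy ?_
    rw [← one_pow M, ← AddMonoidAlgebra.single_pow] at hmem
    exact y.1.isPrime.mem_of_pow_mem _ hmem
  refine hu.mul_left_cancel ?_
  rw [hG.mul_eq, ← map_mul, ← sub_eq_zero, ← map_sub]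
  exact germ_eq_zero_of_mem y (key _ _ hMp hG)

end Fibre

/-! ### The torus action on the monomial basis -/

section Eigen

variable {n d : ℕ} {ℓ : Fin d → Fin n → ℤ} {w : RatPL n} {R r : ℕ}

variable (ℓ w R r) in
/-- The monomials of degree `k` that do not vanish on the central fibre. -/
abbrev TopPoint (k : ℕ) : Type := {p : coneMonoid ℓ w R r // IsTop p ∧ p.1.1 = k}

variable (ℓ w R r) in
/-- The section of `L ^ k` on the central fibre with the given coefficients. -/
def sectionOf (k : ℕ) : (TopPoint ℓ w R r k →₀ ℂ) →ₗ[ℂ]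
    ∀ x : ClosedSub (grading ℓ w R r) (centralIdeal ℓ w R r), Stalk x where
  toFun f x := germ x (.ofCoeff (f.mapDomain Subtype.val))
  map_add' f g := by
    funext x
    rw [Finsupp.mapDomain_add, AddMonoidAlgebra.ofCoeff_add, map_add]
    rfl
  map_smul' z f := by
    funext x
    rw [Finsupp.mapDomain_smul, AddMonoidAlgebra.ofCoeff_smul, ← smul_germ]
    rfl

theorem sectionOf_apply (k : ℕ) (f : TopPoint ℓ w R r k →₀ ℂ) :
    sectionOf ℓ w R r k f = fun x => germ x (.ofCoeff (f.mapDomain Subtype.val)) := rfl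

theorem ofCoeff_mapDomain_mem {k : ℕ} (f : TopPoint ℓ w R r k →₀ ℂ) :
    (.ofCoeff (f.mapDomain Subtype.val) : CoordRing ℓ w R r) ∈ grading ℓ w R r k := by
  classical
  rw [AddMonoidAlgebra.mem_gradeBy_iff]
  intro p hp
  obtain ⟨q, -, rfl⟩ := Finset.mem_image.1 (Finsupp.mapDomain_support hp)
  exact q.2.2

theorem sectionOf_injective (h : IsDegeneration ℓ w R r) {k : ℕ} (hk : 0 < k) :
    Function.Injective (sectionOf ℓ w R r k) := by
  rw [← LinearMap.ker_eq_bot, LinearMap.ker_eq_bot']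
  intro f hf
  have h1 := mem_of_forall_germ_eq (isSaturatedRadical_centralIdeal h) hk
    (ofCoeff_mapDomain_mem f) (zero_mem _) fun x => by
      rw [map_zero]
      exact congrFun hf x
  rw [sub_zero, mem_centralIdeal h] at h1
  ext p
  have h2 := h1 p.1 p.2.1
  change (f.mapDomain Subtype.val) p.1 = 0 at h2
  rwa [Finsupp.mapDomain_apply Subtype.val_injective] at h2

theorem range_sectionOf (h : IsDegeneration ℓ w R r) (hP : Bornology.IsBounded (polytope ℓ))
    {k : ℕ} (hk : 0 < k) : LinearMap.range (sectionOf ℓ w R r k) = centralSections ℓ w R r k := by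
  ext s
  constructor
  · rintro ⟨f, rfl⟩
    exact isSection_germ (ofCoeff_mapDomain_mem f)
  · intro hs
    obtain ⟨f, rfl⟩ := exists_eq_germ h hP hk hs
    exact ⟨f, rfl⟩

theorem torusAut_act_sectionOf (g : coneMonoid ℓ w R r →+ ℝ) {k : ℕ} [Finite (TopPoint ℓ w R r k)]
    (f : TopPoint ℓ w R r k →₀ ℂ) :
    (torusAut g).act (sectionOf ℓ w R r k f) = sectionOf ℓ w R r k
      (Finsupp.equivFunOnFinite.symm fun p => f p * ((Real.exp (g p.1) : ℝ) : ℂ)) := by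
  classical
  rw [sectionOf_apply, FibreAut.act_germ, sectionOf_apply]
  have : ∀ f : TopPoint ℓ w R r k →₀ ℂ,
      torusHom g (.ofCoeff (f.mapDomain Subtype.val)) = .ofCoeff ((Finsupp.equivFunOnFinite.symm
        fun p => f p * ((Real.exp (g p.1) : ℝ) : ℂ)).mapDomain Subtype.val) := by
    intro f
    induction f using Finsupp.induction_linear with
    | zero =>
      simp only [Finsupp.mapDomain_zero, AddMonoidAlgebra.ofCoeff_zero, map_zero, Finsupp.zero_apply,
        zero_mul]
      rw [show (Finsupp.equivFunOnFinite.symm fun _ : TopPoint ℓ w R r k => (0 : ℂ)) = 0 by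
        ext; rfl]
      simp
    | add f f' hf hf' =>
      rw [Finsupp.mapDomain_add, AddMonoidAlgebra.ofCoeff_add, map_add, hf, hf',
        ← AddMonoidAlgebra.ofCoeff_add, ← Finsupp.mapDomain_add]
      congr 2
      ext p
      simp [add_mul]
    | single p z =>
      rw [Finsupp.mapDomain_single, AddMonoidAlgebra.ofCoeff_single, torusHom_single,
        ← AddMonoidAlgebra.ofCoeff_single, ← Finsupp.mapDomain_single]
      congr 2
      ext q
      by_cases hq : p = q
      · subst hq
        simp
      · simp [Finsupp.single_eq_of_ne (Ne.symm hq)]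
  funext x
  exact congrArg (germ x) (this f)

/-- The action is diagonal in the monomial basis, and the real exponential is injective. So the real
weight is determined by the eigenvalue, and distinct pairs `(x, v)` index distinct pairs of
eigenvalues. -/
theorem sectionOf_mem_eigenspace (h : IsDegeneration ℓ w R r) (g : coneMonoid ℓ w R r →+ ℝ) {k : ℕ}
    (hk : 0 < k) [Finite (TopPoint ℓ w R r k)] (f : TopPoint ℓ w R r k →₀ ℂ) (x : ℝ) :
    sectionOf ℓ w R r k f ∈ Module.End.eigenspace (torusAut g).act ((Real.exp x : ℝ) : ℂ) ↔
      ∀ p, f p ≠ 0 → g p.1 = x := by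
  rw [Module.End.mem_eigenspace_iff, torusAut_act_sectionOf, ← map_smul,
    (sectionOf_injective h hk).eq_iff, Finsupp.ext_iff]
  refine forall_congr' fun p => ?_
  change f p * ((Real.exp (g p.1) : ℝ) : ℂ) = ((Real.exp x : ℝ) : ℂ) * f p ↔ _
  rw [mul_comm]
  by_cases hp : f p = 0
  · simp [hp]
  · simp only [mul_left_inj' hp, Complex.ofReal_inj, Real.exp_eq_exp, ne_eq, hp, not_false_eq_true,
      true_implies]

end Eigen

/-! ### `N_k`, `S₁` and `S₂` as sums over lattice points of `K P` -/

section Count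

variable {n d : ℕ} {ℓ : Fin d → Fin n → ℤ} {w : RatPL n} {R r : ℕ}

theorem finrank_supported {α : Type*} [Fintype α] (s : Set α) [DecidablePred (· ∈ s)] :
    Module.finrank ℂ (Finsupp.supported ℂ ℂ s) = (Finset.univ.filter (· ∈ s)).card := by
  rw [(Finsupp.supportedEquivFinsupp s).finrank_eq, Module.finrank_finsupp_self,
    Fintype.card_subtype]

theorem jointEigenspace_eq (h : IsDegeneration ℓ w R r)
    (hP : Bornology.IsBounded (polytope ℓ)) (θ : Fin n → ℝ) {k : ℕ} (hk : 0 < k) (x v : ℝ) :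
    jointEigenspace ℓ w R r θ k x v = (Finsupp.supported ℂ ℂ {p : TopPoint ℓ w R r k |
      (weightX ℓ w R r θ p.1, weightV ℓ w R r p.1) = (x, v)}).map (sectionOf ℓ w R r k) := by
  have : Finite (TopPoint ℓ w R r k) := finite_isTop_deg h hP hk
  ext s
  rw [jointEigenspace, ← range_sectionOf h hP hk]
  constructor
  · rintro ⟨⟨⟨f, rfl⟩, h1⟩, h2⟩
    refine ⟨f, ?_, rfl⟩
    intro p hp
    have hp' : f p ≠ 0 := Finsupp.mem_support_iff.1 hp
    exact Prod.ext ((sectionOf_mem_eigenspace h _ hk f x).1 h1 p hp')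
      ((sectionOf_mem_eigenspace h _ hk f v).1 h2 p hp')
  · rintro ⟨f, hf, rfl⟩
    have hf' : ∀ p, f p ≠ 0 → (weightX ℓ w R r θ p.1, weightV ℓ w R r p.1) = (x, v) :=
      fun p hp => hf (Finsupp.mem_support_iff.2 hp)
    exact ⟨⟨⟨f, rfl⟩, (sectionOf_mem_eigenspace h _ hk f x).2 fun p hp =>
      congrArg Prod.fst (hf' p hp)⟩, (sectionOf_mem_eigenspace h _ hk f v).2 fun p hp =>
      congrArg Prod.snd (hf' p hp)⟩

/-- A joint eigenspace is spanned by the roof monomials with the given pair of weights. Summing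
dimensions over pairs is thus summing over monomials, grouped by weights. -/
theorem finsum_finrank_jointEigenspace (h : IsDegeneration ℓ w R r)
    (hP : Bornology.IsBounded (polytope ℓ)) (θ : Fin n → ℝ) {k : ℕ} (hk : 0 < k)
    [Fintype (TopPoint ℓ w R r k)] (F : ℝ → ℝ → ℝ) :
    ∑ᶠ p : ℝ × ℝ, (Module.finrank ℂ (jointEigenspace ℓ w R r θ k p.1 p.2) : ℝ) * F p.1 p.2
      = ∑ p : TopPoint ℓ w R r k, F (weightX ℓ w R r θ p.1) (weightV ℓ w R r p.1) := by
  classical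
  let g : TopPoint ℓ w R r k → ℝ × ℝ := fun p => (weightX ℓ w R r θ p.1, weightV ℓ w R r p.1)
  have hrank : ∀ p : ℝ × ℝ, Module.finrank ℂ (jointEigenspace ℓ w R r θ k p.1 p.2)
      = (Finset.univ.filter fun q => g q = p).card := by
    intro p
    rw [jointEigenspace_eq h hP θ hk,
      (Submodule.equivMapOfInjective _ (sectionOf_injective h hk) _).symm.finrank_eq,
      finrank_supported]
    rfl
  rw [finsum_eq_sum_of_support_subset (s := Finset.univ.image g)]
  · rw [Finset.sum_comp (fun p : ℝ × ℝ => F p.1 p.2) g]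
    refine Finset.sum_congr rfl fun p _ => ?_
    rw [hrank, nsmul_eq_mul]
  · intro p hp
    rw [Function.mem_support, hrank] at hp
    have : (Finset.univ.filter fun q => g q = p).Nonempty := by
      rw [← Finset.card_pos, Nat.pos_iff_ne_zero]
      intro h0
      simp [h0] at hp
    obtain ⟨q, hq⟩ := this
    simp only [Finset.mem_filter, Finset.mem_univ, true_and] at hq
    simp [← hq]

/-- Projection along the height is a bijection from the roof points of degree `k` to the lattice
points of `k r P`, with the height recovered from the roof function. -/
theorem sum_topPoint (h : IsDegeneration ℓ w R r) {k : ℕ} (hk : 0 < k)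
    [Fintype (TopPoint ℓ w R r k)] {S : Finset (Fin n → ℤ)}
    (hS : ∀ I, I ∈ S ↔ scaledPoint k r I ∈ polytope ℓ) (F : (Fin n → ℤ) → ℝ → ℝ) :
    ∑ p : TopPoint ℓ w R r k, F p.1.1.2.1 (p.1.1.2.2 : ℝ)
      = ∑ I ∈ S, F I (k * r * (R - w.eval (scaledPoint k r I))) := by
  refine Finset.sum_bij (fun p _ => p.1.1.2.1) ?_ ?_ ?_ ?_
  · rintro ⟨p, hp, hpk⟩ -
    subst hpk
    exact (hS _).2 ((scaledPoint_mem_polytope hk h.pos_r).2 (mem_coneMonoid.1 p.2).1)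
  · rintro ⟨p, hp, hpk⟩ - ⟨q, hq, hqk⟩ - hpq
    exact Subtype.ext (isTop_ext h hp hq (hpk ▸ hk) (hpk.trans hqk.symm) hpq)
  · intro I hI
    obtain ⟨p, hp, hpk, hpI⟩ := exists_isTop h hk ((hS I).1 hI)
    exact ⟨⟨p, hp, hpk⟩, Finset.mem_univ _, hpI⟩
  · rintro ⟨p, hp, hpk⟩ -
    have := hp.height_eq h (hpk ▸ hk)
    rw [hpk] at this
    rw [this]

theorem dimSections_eq (h : IsDegeneration ℓ w R r) (hP : Bornology.IsBounded (polytope ℓ))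
    {k : ℕ} (hk : 0 < k) {S : Finset (Fin n → ℤ)}
    (hS : ∀ I, I ∈ S ↔ scaledPoint k r I ∈ polytope ℓ) : dimSections ℓ w R r k = S.card := by
  have : Finite (TopPoint ℓ w R r k) := finite_isTop_deg h hP hk
  have := Fintype.ofFinite (TopPoint ℓ w R r k)
  have e := sum_topPoint h hk hS fun _ _ => 1
  rw [dimSections, ← range_sectionOf h hP hk,
    LinearMap.finrank_range_of_inj (sectionOf_injective h hk), Module.finrank_finsupp_self]
  simpa using e

theorem sumS1_eq (h : IsDegeneration ℓ w R r) (hP : Bornology.IsBounded (polytope ℓ))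
    (θ : Fin n → ℝ) {k : ℕ} (hk : 0 < k) {S : Finset (Fin n → ℤ)}
    (hS : ∀ I, I ∈ S ↔ scaledPoint k r I ∈ polytope ℓ) :
    sumS1 ℓ w R r θ k = k * r * ∑ I ∈ S, Real.exp (thetaFun θ (scaledPoint k r I)) *
      (R - w.eval (scaledPoint k r I)) := by
  have : Finite (TopPoint ℓ w R r k) := finite_isTop_deg h hP hk
  have := Fintype.ofFinite (TopPoint ℓ w R r k)
  have e := sum_topPoint h hk hS fun I v => Real.exp ((∑ j, θ j * (I j : ℝ)) / (k * r)) * v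
  rw [sumS1, finsum_finrank_jointEigenspace h hP θ hk fun x v => Real.exp (x / (k * r)) * v,
    Finset.mul_sum]
  refine Eq.trans e (Finset.sum_congr rfl fun I _ => ?_)
  rw [thetaFun, sum_mul_scaledPoint]
  ring

theorem sumS2_eq (h : IsDegeneration ℓ w R r) (hP : Bornology.IsBounded (polytope ℓ))
    (θ : Fin n → ℝ) {k : ℕ} (hk : 0 < k) {S : Finset (Fin n → ℤ)}
    (hS : ∀ I, I ∈ S ↔ scaledPoint k r I ∈ polytope ℓ) :
    sumS2 ℓ w R r θ k = 1 / 2 * ∑ I ∈ S, Real.exp (thetaFun θ (scaledPoint k r I)) *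
      thetaFun θ (scaledPoint k r I) * (R - w.eval (scaledPoint k r I)) := by
  have : Finite (TopPoint ℓ w R r k) := finite_isTop_deg h hP hk
  have := Fintype.ofFinite (TopPoint ℓ w R r k)
  have hr := h.pos_r
  have hK : (k * r : ℝ) ≠ 0 := by positivity
  have e := sum_topPoint h hk hS fun I v => Real.exp ((∑ j, θ j * (I j : ℝ)) / (k * r)) *
    ((∑ j, θ j * (I j : ℝ)) / (k * r)) * (v / (k * r))
  rw [sumS2, finsum_finrank_jointEigenspace h hP θ hk
    fun x v => Real.exp (x / (k * r)) * (x / (k * r)) * (v / (k * r))]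
  congr 1
  refine Eq.trans e (Finset.sum_congr rfl fun I _ => ?_)
  rw [thetaFun, sum_mul_scaledPoint, mul_div_cancel_left₀ _ hK]

end Count

/-! ### Counting lattice points near hyperplanes and near pairs of facets -/

section LatticeCount

variable {n d : ℕ}

/-- The lattice points in the cube of radius `M`. -/
def latticeBox (n M : ℕ) : Finset (Fin n → ℤ) :=
  Fintype.piFinset fun _ => Finset.Icc (-(M : ℤ)) M

theorem mem_latticeBox {M : ℕ} {I : Fin n → ℤ} : I ∈ latticeBox n M ↔ ∀ j, |I j| ≤ M := by
  simp [latticeBox, abs_le]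

/-- The coordinates outside `T` take at most `2 M + 1` values each, and `q` replaces the coordinates
in `T`. Used with `T` of size zero, one and two. -/
theorem card_le_of_fibre_injOn {α : Type*} {M : ℕ} {S : Finset (Fin n → ℤ)}
    (hS : S ⊆ latticeBox n M) (T : Finset (Fin n)) (q : (Fin n → ℤ) → α) (Q : Finset α)
    (hq : ∀ I ∈ S, q I ∈ Q)
    (hinj : ∀ I ∈ S, ∀ I' ∈ S, (∀ j ∉ T, I j = I' j) → q I = q I' → I = I') :
    S.card ≤ (2 * M + 1) ^ (n - T.card) * Q.card := by
  classical
  have h1 : S.card ≤ ((Fintype.piFinset fun j : Fin n =>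
      if j ∈ T then {0} else Finset.Icc (-(M : ℤ)) M) ×ˢ Q).card := by
    refine Finset.card_le_card_of_injOn (fun I => (fun j => if j ∈ T then 0 else I j, q I)) ?_ ?_
    · intro I hI
      refine Finset.mem_coe.2 (Finset.mem_product.2 ⟨Fintype.mem_piFinset.2 fun j => ?_, hq I hI⟩)
      by_cases hj : j ∈ T
      · simp [hj]
      · have := abs_le.1 (mem_latticeBox.1 (hS hI) j)
        simpa [hj] using this
    · intro I hI I' hI' h
      simp only [Prod.mk.injEq] at h
      refine hinj I hI I' hI' (fun j hj => ?_) h.2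
      simpa [hj] using congrFun h.1 j
  refine h1.trans (le_of_eq ?_)
  rw [Finset.card_product, Fintype.card_piFinset]
  congr 1
  have : ∀ j : Fin n, (if j ∈ T then {0} else Finset.Icc (-(M : ℤ)) M).card
      = if j ∈ T then 1 else 2 * M + 1 := by
    intro j
    split_ifs
    · rfl
    · rw [Int.card_Icc]
      omega
  rw [Finset.prod_congr rfl fun j _ => this j, Finset.prod_ite, Finset.prod_const_one, one_mul,
    Finset.prod_const]
  congr 1
  rw [← Finset.compl_filter, Finset.card_compl, Fintype.card_fin]
  congr 2
  ext j
  simp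

theorem eq_of_dotProduct_eq {a I I' : Fin n → ℤ} {j₀ : Fin n} (ha : a j₀ ≠ 0)
    (h : ∀ j, j ≠ j₀ → I j = I' j) (hd : a ⬝ᵥ I = a ⬝ᵥ I') : I = I' := by
  have h1 : a ⬝ᵥ (I - I') = 0 := by rw [dotProduct_sub, hd, sub_self]
  rw [dotProduct, Finset.sum_eq_single j₀ (fun j _ hj => by simp [h j hj])
    (fun hj => absurd (Finset.mem_univ _) hj)] at h1
  have h2 := (mul_eq_zero.1 h1).resolve_left ha
  funext j
  by_cases hj : j = j₀
  · subst hj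
    exact sub_eq_zero.1 h2
  · exact h j hj

theorem eq_of_dotProduct_eq₂ {a b I I' : Fin n → ℤ} {i j : Fin n} (hij : i ≠ j)
    (hab : a i * b j - a j * b i ≠ 0) (h : ∀ m, m ≠ i → m ≠ j → I m = I' m)
    (ha : a ⬝ᵥ I = a ⬝ᵥ I') (hb : b ⬝ᵥ I = b ⬝ᵥ I') : I = I' := by
  have key : ∀ c : Fin n → ℤ, c ⬝ᵥ I = c ⬝ᵥ I' →
      c i * (I i - I' i) + c j * (I j - I' j) = 0 := by
    intro c hc
    have h1 : c ⬝ᵥ (I - I') = 0 := by rw [dotProduct_sub, hc, sub_self]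
    rw [dotProduct, ← Finset.sum_subset (Finset.subset_univ {i, j}) (fun m _ hm => by
      simp only [Finset.mem_insert, Finset.mem_singleton, not_or] at hm
      simp [h m hm.1 hm.2]), Finset.sum_pair hij] at h1
    exact h1
  have e1 := key a ha
  have e2 := key b hb
  have hi : (a i * b j - a j * b i) * (I i - I' i) = 0 := by linear_combination b j * e1 - a j * e2
  have hj : (a i * b j - a j * b i) * (I j - I' j) = 0 := by linear_combination a i * e2 - b i * e1
  funext m
  by_cases hmi : m = i
  · subst hmi
    exact sub_eq_zero.1 ((mul_eq_zero.1 hi).resolve_left hab)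
  by_cases hmj : m = j
  · subst hmj
    exact sub_eq_zero.1 ((mul_eq_zero.1 hj).resolve_left hab)
  exact h m hmi hmj

/-- All counts are stated with `K ^ n / K ^ m` over the reals, which avoids truncated exponents. -/
theorem pow_two_mul_add_one_le (ρ : ℕ) {K : ℕ} (hK : 0 < K) {m : ℕ} (hm : m ≤ n) :
    ((2 * (ρ * K) + 1 : ℕ) : ℝ) ^ (n - m) ≤ (2 * ρ + 1) ^ n * ((K : ℝ) ^ n / K ^ m) := by
  have hK1 : (1 : ℝ) ≤ K := by exact_mod_cast hK
  have h0 : (K : ℝ) ≠ 0 := by positivity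
  rw [div_eq_mul_inv, ← pow_sub₀ _ h0 hm]
  have h1 : ((2 * (ρ * K) + 1 : ℕ) : ℝ) ≤ (2 * ρ + 1) * K := by
    push_cast
    nlinarith
  calc ((2 * (ρ * K) + 1 : ℕ) : ℝ) ^ (n - m) ≤ ((2 * ρ + 1) * K) ^ (n - m) := by gcongr
    _ = (2 * ρ + 1) ^ (n - m) * K ^ (n - m) := mul_pow _ _ _
    _ ≤ _ := by
      gcongr
      · have : (0 : ℝ) ≤ ρ := Nat.cast_nonneg ρ
        linarith
      · omega

/-- The number of lattice points near a hyperplane is `O(K ^ (n - 1))`. -/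
theorem card_near_hyperplane_le {a : Fin n → ℤ} (ha : a ≠ 0) (ρ c : ℕ) {K : ℕ} (hK : 0 < K)
    (b : ℝ) {S : Finset (Fin n → ℤ)} (hS : S ⊆ latticeBox n (ρ * K))
    (h : ∀ I ∈ S, |((a ⬝ᵥ I : ℤ) : ℝ) + b| ≤ c) :
    (S.card : ℝ) ≤ (2 * ρ + 1) ^ n * (2 * c + 1) * ((K : ℝ) ^ n / K) := by
  obtain ⟨j₀, hj₀⟩ := Function.ne_iff.1 ha
  -- Since `a j₀ ≠ 0`, the value `a ⬝ᵥ I` and the other coordinates determine `I`; the value ranges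
  -- over an interval of length `2 c`.
  have h1 := card_le_of_fibre_injOn hS {j₀} (fun I => a ⬝ᵥ I)
    (Finset.Icc ⌈-c - b⌉ ⌊c - b⌋) (fun I hI => by
      have := abs_le.1 (h I hI)
      rw [Finset.mem_Icc, Int.ceil_le, Int.le_floor]
      constructor <;> linarith) (fun I _ I' _ hoff hq =>
        eq_of_dotProduct_eq hj₀ (fun j hj => hoff j (by simpa using hj)) hq)
  have hn : 1 ≤ n := Nat.one_le_iff_ne_zero.2 fun h0 => by subst h0; exact j₀.elim0
  have h2 : ((Finset.Icc ⌈-c - b⌉ ⌊c - b⌋).card : ℝ) ≤ 2 * c + 1 := by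
    rw [Int.card_Icc]
    have h3 : ((⌊c - b⌋ + 1 - ⌈-c - b⌉ : ℤ) : ℝ) ≤ 2 * c + 1 := by
      push_cast
      linarith [Int.floor_le ((c : ℝ) - b), Int.le_ceil (-(c : ℝ) - b)]
    have h4 : (0 : ℝ) ≤ 2 * c + 1 := by positivity
    rcases le_total 0 (⌊c - b⌋ + 1 - ⌈-c - b⌉) with h5 | h5
    · have : (((⌊c - b⌋ + 1 - ⌈-c - b⌉).toNat : ℤ) : ℝ) ≤ 2 * c + 1 := by
        rwa [Int.toNat_of_nonneg h5]
      exact_mod_cast this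
    · rw [Int.toNat_of_nonpos h5]
      simpa using h4
  have h6 : (S.card : ℝ) ≤ ((2 * (ρ * K) + 1 : ℕ) : ℝ) ^ (n - 1)
      * (Finset.Icc ⌈-c - b⌉ ⌊c - b⌋).card := by
    rw [Finset.card_singleton] at h1
    exact_mod_cast h1
  have h7 := pow_two_mul_add_one_le ρ hK hn
  rw [pow_one] at h7
  calc (S.card : ℝ) ≤ _ := h6
    _ ≤ ((2 * ρ + 1) ^ n * ((K : ℝ) ^ n / K)) * (2 * c + 1) := by gcongr
    _ = _ := by ring

/-- What the combinatorics of lattice points near the boundary uses of a smooth Fano polytope. -/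
structure FacetNormals (ℓ : Fin d → Fin n → ℤ) : Prop where
  bounded : ∃ ρ : ℕ, ∀ m : ℝ, 0 < m → ∀ x : Fin n → ℝ,
    (∀ s, ∑ j, (ℓ s j : ℝ) * x j ≤ m) → ∀ j, |x j| ≤ ρ * m
  exists_dual : ∀ s, ∃ e, ℓ s ⬝ᵥ e = 1
  injective : Function.Injective ℓ

/-- The lattice distance of `I` from the facet `s` of `K P`. -/
def slack (ℓ : Fin d → Fin n → ℤ) (K : ℕ) (s : Fin d) (I : Fin n → ℤ) : ℤ := K - ℓ s ⬝ᵥ I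

/-- The lattice points at distance at most `c` from two facets of `K P`. -/
def ridgePoints (ℓ : Fin d → Fin n → ℤ) (ρ c K : ℕ) : Finset (Fin n → ℤ) :=
  (latticeBox n (ρ * K)).filter fun I =>
    ∃ s s', s ≠ s' ∧ |slack ℓ K s I| ≤ c ∧ |slack ℓ K s' I| ≤ c

variable {ℓ : Fin d → Fin n → ℤ}

theorem FacetNormals.ne_zero (h : FacetNormals ℓ) (s : Fin d) : ℓ s ≠ 0 := by
  intro h0
  obtain ⟨e, he⟩ := h.exists_dual s
  rw [h0, zero_dotProduct] at he
  exact zero_ne_one he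

/-- If all two-by-two minors vanish, the normals are proportional. Both are primitive, so the factor
is an invertible integer, and `1` is excluded because distinct facets have distinct normals. -/
theorem FacetNormals.minor_ne_zero_or (h : FacetNormals ℓ) {s s' : Fin d} (hs : s ≠ s') :
    (∃ i j, i ≠ j ∧ ℓ s i * ℓ s' j - ℓ s j * ℓ s' i ≠ 0) ∨ ℓ s' = -ℓ s := by
  by_contra! hcon
  obtain ⟨hmin, hneg⟩ := hcon
  have hmin' : ∀ i j, ℓ s i * ℓ s' j = ℓ s j * ℓ s' i := by
    intro i j
    by_cases hij : i = j
    · rw [hij]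
    · exact sub_eq_zero.1 (hmin i j hij)
  obtain ⟨e, he⟩ := h.exists_dual s
  obtain ⟨e', he'⟩ := h.exists_dual s'
  have key : ℓ s' = (ℓ s' ⬝ᵥ e) • ℓ s := by
    funext j
    have : ℓ s' j * (ℓ s ⬝ᵥ e) = ℓ s j * (ℓ s' ⬝ᵥ e) := by
      rw [dotProduct, dotProduct, Finset.mul_sum, Finset.mul_sum]
      refine Finset.sum_congr rfl fun i _ => ?_
      linear_combination e i * hmin' i j
    rw [he, mul_one] at this
    rw [Pi.smul_apply, smul_eq_mul, this, mul_comm]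
  have h1 : (ℓ s' ⬝ᵥ e) * (ℓ s ⬝ᵥ e') = 1 := by
    rw [← he']
    conv_rhs => rw [key]
    rw [smul_dotProduct, smul_eq_mul]
  rcases Int.eq_one_or_neg_one_of_mul_eq_one h1 with h2 | h2
  · rw [h2, one_smul] at key
    exact hs (h.injective key.symm)
  · rw [h2, neg_one_smul] at key
    exact hneg key

/-- Independent normals impose two independent conditions on `I`. For opposite normals the two
slacks add up to `2 K`, so there are no points at all once `K > c`. -/
theorem FacetNormals.card_ridgePoints_le (h : FacetNormals ℓ) (ρ c : ℕ) :
    ∃ C : ℝ, 0 ≤ C ∧ ∀ K : ℕ, 0 < K →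
      ((ridgePoints ℓ ρ c K).card : ℝ) ≤ C * ((K : ℝ) ^ n / K ^ 2) := by
  classical
  -- The first square counts pairs of slacks for independent normals. The second covers opposite
  -- normals with `K ≤ c`, where the whole box is counted and `K ^ 2 ≤ c ^ 2`.
  set C₀ : ℝ := (2 * ρ + 1) ^ n * ((2 * c + 1) ^ 2 + c ^ 2)
  have hC₀ : 0 ≤ C₀ := by positivity
  refine ⟨d * d * C₀, by positivity, fun K hK => ?_⟩
  have hK0 : (0 : ℝ) < K := by exact_mod_cast hK
  have hpair : ∀ s s' : Fin d, s ≠ s' → (((latticeBox n (ρ * K)).filter fun I =>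
      |slack ℓ K s I| ≤ c ∧ |slack ℓ K s' I| ≤ c).card : ℝ) ≤ C₀ * ((K : ℝ) ^ n / K ^ 2) := by
    intro s s' hs
    rcases h.minor_ne_zero_or hs with ⟨i, j, hij, hm⟩ | hneg
    · have h1 := card_le_of_fibre_injOn (Finset.filter_subset (fun I =>
        |slack ℓ K s I| ≤ c ∧ |slack ℓ K s' I| ≤ c) (latticeBox n (ρ * K))) {i, j}
        (fun I => (slack ℓ K s I, slack ℓ K s' I))
        (Finset.Icc (-(c : ℤ)) c ×ˢ Finset.Icc (-(c : ℤ)) c)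
        (fun I hI => by
          simp only [Finset.mem_filter, abs_le] at hI
          simpa using hI.2)
        (fun I _ I' _ hoff hq => by
          simp only [Prod.mk.injEq, slack, sub_right_inj] at hq
          exact eq_of_dotProduct_eq₂ hij hm (fun m h1 h2 => hoff m (by simp [h1, h2])) hq.1 hq.2)
      have hn : 2 ≤ n := by
        have := Finset.card_le_univ {i, j}
        rwa [Finset.card_pair hij, Fintype.card_fin] at this
      rw [Finset.card_pair hij, Finset.card_product, Int.card_Icc] at h1
      have h2 : ((c : ℤ) + 1 - -(c : ℤ)).toNat = 2 * c + 1 := by omega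
      rw [h2] at h1
      have h3 := pow_two_mul_add_one_le ρ hK hn
      have h4 : (((latticeBox n (ρ * K)).filter fun I =>
          |slack ℓ K s I| ≤ c ∧ |slack ℓ K s' I| ≤ c).card : ℝ)
          ≤ ((2 * (ρ * K) + 1 : ℕ) : ℝ) ^ (n - 2) * ((2 * c + 1) * (2 * c + 1)) := by
        exact_mod_cast h1
      refine h4.trans ?_
      calc ((2 * (ρ * K) + 1 : ℕ) : ℝ) ^ (n - 2) * ((2 * c + 1) * (2 * c + 1))
          ≤ ((2 * ρ + 1) ^ n * ((K : ℝ) ^ n / K ^ 2)) * ((2 * c + 1) * (2 * c + 1)) := by gcongr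
        _ = ((2 * ρ + 1) ^ n * (2 * c + 1) ^ 2) * ((K : ℝ) ^ n / K ^ 2) := by ring
        _ ≤ C₀ * ((K : ℝ) ^ n / K ^ 2) := mul_le_mul_of_nonneg_right
            (mul_le_mul_of_nonneg_left (le_add_of_nonneg_right (sq_nonneg (c : ℝ)))
              (by positivity)) (by positivity)
    · by_cases hKc : K ≤ c
      · have h1 : (((latticeBox n (ρ * K)).filter fun I =>
            |slack ℓ K s I| ≤ c ∧ |slack ℓ K s' I| ≤ c).card : ℝ)
            ≤ ((2 * (ρ * K) + 1 : ℕ) : ℝ) ^ (n - 0) := by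
          have := card_le_of_fibre_injOn (Finset.filter_subset (fun I =>
            |slack ℓ K s I| ≤ c ∧ |slack ℓ K s' I| ≤ c) (latticeBox n (ρ * K))) ∅
            (fun _ => ()) {()} (fun _ _ => Finset.mem_singleton_self _)
            (fun I _ I' _ hoff _ => funext fun j => hoff j (Finset.notMem_empty j))
          simp only [Finset.card_empty, Finset.card_singleton, mul_one] at this
          exact_mod_cast this
        refine h1.trans ((pow_two_mul_add_one_le ρ hK (Nat.zero_le n)).trans ?_)
        rw [pow_zero, div_one]
        have hcK : (K : ℝ) ^ 2 ≤ (2 * c + 1) ^ 2 + c ^ 2 := by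
          have : (K : ℝ) ≤ c := by exact_mod_cast hKc
          nlinarith
        calc (2 * (ρ : ℝ) + 1) ^ n * (K : ℝ) ^ n
            = (2 * ρ + 1) ^ n * K ^ 2 * ((K : ℝ) ^ n / K ^ 2) := by field_simp
          _ ≤ C₀ * ((K : ℝ) ^ n / K ^ 2) := mul_le_mul_of_nonneg_right
            (mul_le_mul_of_nonneg_left hcK (by positivity)) (by positivity)
      · rw [Finset.filter_false_of_mem]
        · rw [Finset.card_empty, Nat.cast_zero]
          positivity
        · rintro I - ⟨h1, h2⟩
          have h3 : slack ℓ K s' I = 2 * K - slack ℓ K s I := by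
            rw [slack, slack, hneg, neg_dotProduct]
            ring
          rw [h3, abs_le] at h2
          rw [abs_le] at h1
          omega
  have hsub : ridgePoints ℓ ρ c K ⊆ (Finset.univ.filter fun p : Fin d × Fin d => p.1 ≠ p.2).biUnion
      fun p => (latticeBox n (ρ * K)).filter fun I =>
        |slack ℓ K p.1 I| ≤ c ∧ |slack ℓ K p.2 I| ≤ c := by
    intro I hI
    simp only [ridgePoints, Finset.mem_filter] at hI
    obtain ⟨hI, s, s', hs, h1⟩ := hI
    exact Finset.mem_biUnion.2 ⟨(s, s'), by simpa using hs, Finset.mem_filter.2 ⟨hI, h1⟩⟩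
  calc ((ridgePoints ℓ ρ c K).card : ℝ)
      ≤ ∑ p ∈ Finset.univ.filter fun p : Fin d × Fin d => p.1 ≠ p.2,
        (((latticeBox n (ρ * K)).filter fun I =>
          |slack ℓ K p.1 I| ≤ c ∧ |slack ℓ K p.2 I| ≤ c).card : ℝ) := by
        exact_mod_cast (Finset.card_le_card hsub).trans Finset.card_biUnion_le
    _ ≤ ∑ p ∈ Finset.univ.filter fun p : Fin d × Fin d => p.1 ≠ p.2, C₀ * ((K : ℝ) ^ n / K ^ 2) :=
        Finset.sum_le_sum fun p hp => hpair _ _ (by simpa using hp)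
    _ ≤ ∑ _p : Fin d × Fin d, C₀ * ((K : ℝ) ^ n / K ^ 2) :=
        Finset.sum_le_sum_of_subset_of_nonneg (Finset.subset_univ _) fun _ _ _ => by positivity
    _ = d * d * C₀ * ((K : ℝ) ^ n / K ^ 2) := by
        rw [Finset.sum_const, Finset.card_univ, Fintype.card_prod, Fintype.card_fin, nsmul_eq_mul]
        push_cast
        ring

end LatticeCount

/-! ### Collapsing sums near the boundary onto the facets -/

section Collapse

variable {n d : ℕ} {ℓ : Fin d → Fin n → ℤ}

/-- Translation by `v` matches `T` with `T'` outside `R`. Each unmatched point costs at most `M`,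
each matched pair at most `ε`. -/
theorem abs_sum_sub_sum_le_of_shift {Z : Type*} [AddCommGroup Z] [DecidableEq Z]
    (T T' R : Finset Z) (v : Z)
    (g : Z → ℝ) {M ε : ℝ} (hM : ∀ I ∈ T ∪ T', |g I| ≤ M) (hM0 : 0 ≤ M) (hε0 : 0 ≤ ε)
    (h1 : ∀ I ∈ T, I ∉ R → I + v ∈ T') (h2 : ∀ I ∈ T', I ∉ R → I - v ∈ T)
    (hε : ∀ I ∈ T, I + v ∈ T' → |g I - g (I + v)| ≤ ε) :
    |∑ I ∈ T, g I - ∑ I ∈ T', g I| ≤ 2 * M * R.card + ε * T.card := by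
  have hbij : ∑ I ∈ T'.filter (fun I => I - v ∈ T), g I
      = ∑ I ∈ T.filter (fun I => I + v ∈ T'), g (I + v) := by
    refine Finset.sum_nbij' (fun I => I - v) (fun I => I + v) ?_ ?_ ?_ ?_ ?_
    · intro I hI
      simp only [Finset.mem_filter] at hI ⊢
      simpa using hI.symm
    · intro I hI
      simp only [Finset.mem_filter] at hI ⊢
      simpa using hI.symm
    all_goals intro I hI; simp
  have e1 := Finset.sum_filter_add_sum_filter_not T (fun I => I + v ∈ T') g
  have e2 := Finset.sum_filter_add_sum_filter_not T' (fun I => I - v ∈ T) g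
  have b1 : |∑ I ∈ T.filter (fun I => ¬ I + v ∈ T'), g I| ≤ M * R.card := by
    calc |∑ I ∈ T.filter (fun I => ¬ I + v ∈ T'), g I|
        ≤ ∑ I ∈ T.filter (fun I => ¬ I + v ∈ T'), |g I| := Finset.abs_sum_le_sum_abs _ _
      _ ≤ ∑ I ∈ T.filter (fun I => ¬ I + v ∈ T'), M := Finset.sum_le_sum fun I hI =>
          hM I (Finset.mem_union_left _ (Finset.mem_filter.1 hI).1)
      _ = M * (T.filter (fun I => ¬ I + v ∈ T')).card := by
          rw [Finset.sum_const, nsmul_eq_mul, mul_comm]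
      _ ≤ M * R.card := by
          gcongr
          intro I hI
          by_contra hR
          exact (Finset.mem_filter.1 hI).2 (h1 I (Finset.mem_filter.1 hI).1 hR)
  have b2 : |∑ I ∈ T'.filter (fun I => ¬ I - v ∈ T), g I| ≤ M * R.card := by
    calc |∑ I ∈ T'.filter (fun I => ¬ I - v ∈ T), g I|
        ≤ ∑ I ∈ T'.filter (fun I => ¬ I - v ∈ T), |g I| := Finset.abs_sum_le_sum_abs _ _
      _ ≤ ∑ I ∈ T'.filter (fun I => ¬ I - v ∈ T), M := Finset.sum_le_sum fun I hI =>
          hM I (Finset.mem_union_right _ (Finset.mem_filter.1 hI).1)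
      _ = M * (T'.filter (fun I => ¬ I - v ∈ T)).card := by
          rw [Finset.sum_const, nsmul_eq_mul, mul_comm]
      _ ≤ M * R.card := by
          gcongr
          intro I hI
          by_contra hR
          exact (Finset.mem_filter.1 hI).2 (h2 I (Finset.mem_filter.1 hI).1 hR)
  have b3 : |∑ I ∈ T.filter (fun I => I + v ∈ T'), g I
      - ∑ I ∈ T.filter (fun I => I + v ∈ T'), g (I + v)| ≤ ε * T.card := by
    rw [← Finset.sum_sub_distrib]
    calc |∑ I ∈ T.filter (fun I => I + v ∈ T'), (g I - g (I + v))|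
        ≤ ∑ I ∈ T.filter (fun I => I + v ∈ T'), |g I - g (I + v)| := Finset.abs_sum_le_sum_abs _ _
      _ ≤ ∑ I ∈ T.filter (fun I => I + v ∈ T'), ε := Finset.sum_le_sum fun I hI =>
          hε I (Finset.mem_filter.1 hI).1 (Finset.mem_filter.1 hI).2
      _ = ε * (T.filter (fun I => I + v ∈ T')).card := by
          rw [Finset.sum_const, nsmul_eq_mul, mul_comm]
      _ ≤ ε * T.card := by
          gcongr
          exact Finset.filter_subset _ _
  rw [hbij] at e2
  rw [← e1, ← e2]
  rw [abs_le] at *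
  constructor <;> linarith [b1.1, b1.2, b2.1, b2.2, b3.1, b3.2]

/-- The lattice points on the facet `s` of `K P`. -/
def facetPoints (ℓ : Fin d → Fin n → ℤ) (ρ K : ℕ) (s : Fin d) : Finset (Fin n → ℤ) :=
  (latticeBox n (ρ * K)).filter fun I => slack ℓ K s I = 0 ∧ ∀ s', 0 ≤ slack ℓ K s' I

/-- The lattice points at distance `j` from the facet `s` and at distance more than `c` from the
others. -/
def layerPoints (ℓ : Fin d → Fin n → ℤ) (ρ c K : ℕ) (s : Fin d) (j : ℤ) :
    Finset (Fin n → ℤ) :=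
  (latticeBox n (ρ * K)).filter fun I => slack ℓ K s I = j ∧ ∀ s', s' ≠ s → c < slack ℓ K s' I

theorem slack_add (K : ℕ) (s : Fin d) (I v : Fin n → ℤ) :
    slack ℓ K s (I + v) = slack ℓ K s I - ℓ s ⬝ᵥ v := by
  rw [slack, slack, dotProduct_add]
  ring

/-- A cube of lattice points that contains `K P`, also after moving the facets by `c`. -/
def IsBoxRadius (ℓ : Fin d → Fin n → ℤ) (c ρ : ℕ) : Prop :=
  ∀ K : ℕ, 0 < K → ∀ I : Fin n → ℤ, (∀ s, -(c : ℤ) ≤ slack ℓ K s I) → I ∈ latticeBox n (ρ * K)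

/-- Bounds for a function on the lattice points of a cube that oscillates on the scale `K`. -/
structure IsSlowlyVarying (g : (Fin n → ℤ) → ℝ) (ρ K : ℕ) (M : ℝ) : Prop where
  bound : ∀ I ∈ latticeBox n (ρ * K), |g I| ≤ M
  lip : ∀ I ∈ latticeBox n (ρ * K), ∀ I' ∈ latticeBox n (ρ * K), ∀ N : ℕ,
    (∀ j, |I j - I' j| ≤ N) → |g I - g I'| ≤ N * M / K

theorem FacetNormals.exists_dual_bound (h : FacetNormals ℓ) :
    ∃ (e : Fin d → Fin n → ℤ) (D : ℕ), (∀ s, ℓ s ⬝ᵥ e s = 1) ∧ (∀ s s', |ℓ s' ⬝ᵥ e s| ≤ D) ∧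
      ∀ s j, |e s j| ≤ D := by
  choose e he using h.exists_dual
  refine ⟨e, ∑ s, ∑ s', (ℓ s' ⬝ᵥ e s).natAbs + ∑ s, ∑ j, (e s j).natAbs, he, fun s s' => ?_,
    fun s j => ?_⟩
  · have h1 : (ℓ s' ⬝ᵥ e s).natAbs ≤ ∑ s, ∑ s', (ℓ s' ⬝ᵥ e s).natAbs :=
      (Finset.single_le_sum (f := fun s' => (ℓ s' ⬝ᵥ e s).natAbs) (fun _ _ => Nat.zero_le _)
        (Finset.mem_univ s')).trans
      (Finset.single_le_sum (f := fun s => ∑ s', (ℓ s' ⬝ᵥ e s).natAbs) (fun _ _ => Nat.zero_le _)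
        (Finset.mem_univ s))
    rw [Int.abs_eq_natAbs]
    exact_mod_cast h1.trans (Nat.le_add_right _ _)
  · have h1 : (e s j).natAbs ≤ ∑ s, ∑ j, (e s j).natAbs :=
      (Finset.single_le_sum (f := fun j => (e s j).natAbs) (fun _ _ => Nat.zero_le _)
        (Finset.mem_univ j)).trans
      (Finset.single_le_sum (f := fun s => ∑ j, (e s j).natAbs) (fun _ _ => Nat.zero_le _)
        (Finset.mem_univ s))
    rw [Int.abs_eq_natAbs]
    exact_mod_cast h1.trans (Nat.le_add_left _ _)

theorem mul_abs_le_of_abs_le {j x : ℤ} {c D : ℕ} (hj : |j| ≤ c) (hx : |x| ≤ D) :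
    |j * x| ≤ c * D := by
  rw [abs_mul]
  exact mul_le_mul hj hx (abs_nonneg _) (Nat.cast_nonneg _)

theorem card_layerPoints_le (h : FacetNormals ℓ) (ρ c b : ℕ) {K : ℕ} (hK : 0 < K) (s : Fin d)
    {j : ℤ} (hj : |j| ≤ c) :
    ((layerPoints ℓ ρ b K s j).card : ℝ)
      ≤ (2 * ρ + 1) ^ n * (2 * c + 1) * ((K : ℝ) ^ n / K) := by
  refine card_near_hyperplane_le (h.ne_zero s) ρ c hK (-K) (Finset.filter_subset _ _) ?_
  intro I hI
  have h1 := (Finset.mem_filter.1 hI).2.1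
  have h2 : ((ℓ s ⬝ᵥ I : ℤ) : ℝ) + -K = ((-j : ℤ) : ℝ) := by
    rw [← h1, slack]
    push_cast
    ring
  rw [h2, ← Int.cast_abs, abs_neg]
  exact_mod_cast hj

/-- Sums over layers parallel to a facet are equal to the sum over the facet up to lower order. -/
theorem FacetNormals.abs_layer_sub_facet_le (h : FacetNormals ℓ) (c : ℕ) :
    ∃ c' : ℕ, c ≤ c' ∧ ∀ ρ, IsBoxRadius ℓ c ρ → ∃ C : ℝ, 0 ≤ C ∧ ∀ K : ℕ, 0 < K →
      ∀ (g : (Fin n → ℤ) → ℝ) (M : ℝ), 0 ≤ M → IsSlowlyVarying g ρ K M →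
      ∀ s (j : ℤ), |j| ≤ c → |∑ I ∈ layerPoints ℓ ρ c' K s j, g I - ∑ I ∈ facetPoints ℓ ρ K s, g I|
        ≤ C * M * ((K : ℝ) ^ n / K ^ 2) := by
  classical
  obtain ⟨e, D, he, heD, heD'⟩ := h.exists_dual_bound
  refine ⟨c + c * D, Nat.le_add_right _ _, fun ρ hρ => ?_⟩
  -- Translation by `j • e s` lowers the slack of `s` by `j` and changes every other slack by at
  -- most `c D`. A point for which it fails is thus within `c + 2 c D` of a second facet.
  obtain ⟨C₁, hC₁, hridge⟩ := h.card_ridgePoints_le ρ (c + c * D + c * D)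
  refine ⟨4 * C₁ + (c * D : ℕ) * ((2 * ρ + 1) ^ n * (2 * c + 1)), by positivity, ?_⟩
  intro K hK g M hM hg s j hj
  set R := ridgePoints ℓ ρ (c + c * D + c * D) K with hR
  have hRc : (R.card : ℝ) ≤ C₁ * ((K : ℝ) ^ n / K ^ 2) := hridge K hK
  have hK0 : (0 : ℝ) < K := by exact_mod_cast hK
  have hb : ∀ s' (I : Fin n → ℤ), |slack ℓ K s' (I + j • e s) - slack ℓ K s' I| ≤ (c * D : ℕ) := by
    intro s' I
    rw [slack_add, dotProduct_smul, smul_eq_mul, sub_sub_cancel_left, abs_neg]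
    exact_mod_cast mul_abs_le_of_abs_le hj (heD s s')
  have hmemR : ∀ I ∈ latticeBox n (ρ * K), ∀ s' ≠ s, |slack ℓ K s I| ≤ c →
      |slack ℓ K s' I| ≤ (c + c * D + c * D : ℕ) → I ∈ R := by
    intro I hI s' hs' h1 h2
    refine Finset.mem_filter.2 ⟨hI, s, s', hs'.symm, h1.trans ?_, h2⟩
    push_cast
    nlinarith [Nat.zero_le (c * D)]
  -- The layer at distance `j` is moved onto the layer at distance zero. The oscillation `O(1 / K)`
  -- over `O(K ^ (n - 1))` points is of the order allowed.
  have step1 : |∑ I ∈ layerPoints ℓ ρ (c + c * D) K s j, g I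
      - ∑ I ∈ layerPoints ℓ ρ (c + c * D) K s 0, g I|
      ≤ 2 * M * R.card + ((c * D : ℕ) * M / K) * (layerPoints ℓ ρ (c + c * D) K s j).card := by
    refine abs_sum_sub_sum_le_of_shift _ _ _ (j • e s) _ ?_ hM (by positivity) ?_ ?_ ?_
    · intro I hI
      refine hg.bound I ?_
      rcases Finset.mem_union.1 hI with h1 | h1
      · exact (Finset.mem_filter.1 h1).1
      · exact (Finset.mem_filter.1 h1).1
    · intro I hI hIR
      obtain ⟨hIb, h1, h2⟩ := Finset.mem_filter.1 hI
      have h3 : slack ℓ K s (I + j • e s) = 0 := by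
        rw [slack_add, dotProduct_smul, he, h1]
        simp
      have h4 : ∀ s' ≠ s, ((c + c * D : ℕ) : ℤ) < slack ℓ K s' (I + j • e s) := by
        intro s' hs'
        by_contra hcon
        refine hIR (hmemR I hIb s' hs' (by rw [h1]; exact hj) ?_)
        have h5 := abs_le.1 (hb s' I)
        have h6 := h2 s' hs'
        push_cast at *
        rw [abs_le]
        constructor <;> linarith [h5.1, h5.2]
      refine Finset.mem_filter.2 ⟨hρ K hK _ fun s' => ?_, h3, h4⟩
      by_cases hs' : s' = s
      · rw [hs', h3]
        omega
      · have := h4 s' hs'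
        push_cast at this
        have h7 : (0 : ℤ) ≤ c * D := by positivity
        linarith
    · intro I hI hIR
      obtain ⟨hIb, h1, h2⟩ := Finset.mem_filter.1 hI
      have hb' : ∀ s', |slack ℓ K s' I - slack ℓ K s' (I - j • e s)| ≤ (c * D : ℕ) := by
        intro s'
        have := hb s' (I - j • e s)
        rwa [sub_add_cancel] at this
      have h3 : slack ℓ K s (I - j • e s) = j := by
        rw [sub_eq_add_neg, slack_add, dotProduct_neg, dotProduct_smul, he, h1]
        simp
      have h4 : ∀ s' ≠ s, ((c + c * D : ℕ) : ℤ) < slack ℓ K s' (I - j • e s) := by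
        intro s' hs'
        by_contra hcon
        refine hIR (hmemR I hIb s' hs' (by rw [h1]; simp) ?_)
        have h5 := abs_le.1 (hb' s')
        have h6 := h2 s' hs'
        push_cast at *
        rw [abs_le]
        constructor <;> linarith [h5.1, h5.2]
      refine Finset.mem_filter.2 ⟨hρ K hK _ fun s' => ?_, h3, h4⟩
      by_cases hs' : s' = s
      · rw [hs', h3]
        exact (abs_le.1 hj).1
      · have := h4 s' hs'
        push_cast at this
        have h7 : (0 : ℤ) ≤ c * D := by positivity
        linarith
    · intro I hI hI'
      refine hg.lip _ (Finset.mem_filter.1 hI).1 _ (Finset.mem_filter.1 hI').1 _ fun i => ?_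
      rw [Pi.add_apply, sub_add_cancel_left, abs_neg, Pi.smul_apply, smul_eq_mul]
      exact_mod_cast mul_abs_le_of_abs_le hj (heD' s i)
  -- No translation here: the layer at distance zero and the full facet differ only in ridge points.
  have step2 : |∑ I ∈ layerPoints ℓ ρ (c + c * D) K s 0, g I - ∑ I ∈ facetPoints ℓ ρ K s, g I|
      ≤ 2 * M * R.card + 0 * (layerPoints ℓ ρ (c + c * D) K s 0).card := by
    refine abs_sum_sub_sum_le_of_shift _ _ _ 0 _ ?_ hM le_rfl ?_ ?_ ?_
    · intro I hI
      refine hg.bound I ?_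
      rcases Finset.mem_union.1 hI with h1 | h1
      · exact (Finset.mem_filter.1 h1).1
      · exact (Finset.mem_filter.1 h1).1
    · intro I hI _
      obtain ⟨hIb, h1, h2⟩ := Finset.mem_filter.1 hI
      rw [add_zero]
      refine Finset.mem_filter.2 ⟨hIb, h1, fun s' => ?_⟩
      by_cases hs' : s' = s
      · rw [hs', h1]
      · exact le_of_lt (lt_of_le_of_lt (Nat.cast_nonneg _) (h2 s' hs'))
    · intro I hI hIR
      obtain ⟨hIb, h1, h2⟩ := Finset.mem_filter.1 hI
      rw [sub_zero]
      refine Finset.mem_filter.2 ⟨hIb, h1, fun s' hs' => ?_⟩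
      by_contra hcon
      refine hIR (hmemR I hIb s' hs' (by rw [h1]; simp) ?_)
      rw [abs_of_nonneg (h2 s')]
      push_cast at *
      have h7 : (0 : ℤ) ≤ c * D := by positivity
      linarith
    · intro I _ _
      rw [add_zero, sub_self, abs_zero]
  have hcard := card_layerPoints_le h ρ c (c + c * D) hK s hj
  have hfin : ((c * D : ℕ) * M / K) * (layerPoints ℓ ρ (c + c * D) K s j).card
      ≤ (c * D : ℕ) * ((2 * ρ + 1) ^ n * (2 * c + 1)) * M * ((K : ℝ) ^ n / K ^ 2) := by
    calc ((c * D : ℕ) * M / K) * (layerPoints ℓ ρ (c + c * D) K s j).card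
        ≤ ((c * D : ℕ) * M / K) * ((2 * ρ + 1) ^ n * (2 * c + 1) * ((K : ℝ) ^ n / K)) := by gcongr
      _ = _ := by field_simp
  calc _ ≤ _ := abs_sub_le _ (∑ I ∈ layerPoints ℓ ρ (c + c * D) K s 0, g I) _
    _ ≤ (2 * M * (C₁ * ((K : ℝ) ^ n / K ^ 2))
          + (c * D : ℕ) * ((2 * ρ + 1) ^ n * (2 * c + 1)) * M * ((K : ℝ) ^ n / K ^ 2))
        + 2 * M * (C₁ * ((K : ℝ) ^ n / K ^ 2)) := by
        refine add_le_add (step1.trans (add_le_add ?_ hfin)) (step2.trans ?_)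
        · gcongr
        · rw [zero_mul, add_zero]
          gcongr
    _ = _ := by ring

/-- A sum over the lattice points near the boundary of `K P`, with weights that depend only on the
distance from the nearest facet, is given by sums over the facets up to lower order. -/
theorem FacetNormals.abs_sum_sub_facet_le (h : FacetNormals ℓ) (c : ℕ) {ρ : ℕ}
    (hρ : IsBoxRadius ℓ c ρ) : ∃ C : ℝ, 0 ≤ C ∧ ∀ K : ℕ, 0 < K →
      ∀ (g : (Fin n → ℤ) → ℝ) (M : ℝ), 0 ≤ M → IsSlowlyVarying g ρ K M →
      ∀ (Φ : (Fin n → ℤ) → ℝ) (ψ : Fin d → ℤ → ℝ), (∀ I, |Φ I| ≤ 1) → (∀ s j, |ψ s j| ≤ 1) →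
      (∀ I, Φ I ≠ 0 → (∃ s, |slack ℓ K s I| ≤ c) ∧ ∀ s, -(c : ℤ) ≤ slack ℓ K s I) →
      (∀ I s, |slack ℓ K s I| ≤ c → (∀ s' ≠ s, c < slack ℓ K s' I) → Φ I = ψ s (slack ℓ K s I)) →
      |∑ I ∈ latticeBox n (ρ * K), Φ I * g I
          - ∑ s, (∑ j ∈ Finset.Icc (-(c : ℤ)) c, ψ s j) * ∑ I ∈ facetPoints ℓ ρ K s, g I|
        ≤ C * M * ((K : ℝ) ^ n / K ^ 2) := by
  classical
  obtain ⟨c', hcc', hlayer⟩ := h.abs_layer_sub_facet_le c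
  obtain ⟨C₁, hC₁, hlayer⟩ := hlayer ρ hρ
  obtain ⟨C₂, hC₂, hridge⟩ := h.card_ridgePoints_le ρ c'
  refine ⟨C₂ + d * ((2 * c + 1) * C₁), by positivity, ?_⟩
  intro K hK g M hM hg Φ ψ hΦ hψ hsupp hloc
  have hK0 : (0 : ℝ) < K := by exact_mod_cast hK
  -- The points near exactly one facet, with margin `c'` from the others; these sets are disjoint
  -- because `c ≤ c'`. A point with `Φ I ≠ 0` outside all of them is a ridge point.
  let F : Fin d → Finset (Fin n → ℤ) := fun s => (latticeBox n (ρ * K)).filter fun I =>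
    |slack ℓ K s I| ≤ c ∧ ∀ s' ≠ s, (c' : ℤ) < slack ℓ K s' I
  have hF : ∀ s, ∑ I ∈ F s, ψ s (slack ℓ K s I) * g I
      = ∑ j ∈ Finset.Icc (-(c : ℤ)) c, ψ s j * ∑ I ∈ layerPoints ℓ ρ c' K s j, g I := by
    intro s
    rw [← Finset.sum_fiberwise_of_maps_to (t := Finset.Icc (-(c : ℤ)) c)
      (g := fun I => slack ℓ K s I)]
    · refine Finset.sum_congr rfl fun j hj => ?_
      rw [Finset.mul_sum]
      refine Finset.sum_congr ?_ ?_
      · ext I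
        simp only [F, layerPoints, Finset.mem_filter, and_assoc]
        refine and_congr_right fun _ => ⟨fun hh => ⟨hh.2.2, hh.2.1⟩, fun hh => ⟨?_, hh.2, hh.1⟩⟩
        rw [hh.1, abs_le]
        exact Finset.mem_Icc.1 hj
      · intro I hI
        rw [(Finset.mem_filter.1 hI).2.1]
    · intro I hI
      rw [Finset.mem_Icc, ← abs_le]
      exact (Finset.mem_filter.1 hI).2.1
  have step1 : |∑ I ∈ latticeBox n (ρ * K), Φ I * g I - ∑ s, ∑ I ∈ F s, ψ s (slack ℓ K s I) * g I|
      ≤ C₂ * M * ((K : ℝ) ^ n / K ^ 2) := by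
    have e1 : ∑ s, ∑ I ∈ F s, ψ s (slack ℓ K s I) * g I = ∑ I ∈ latticeBox n (ρ * K),
        ∑ s, if (|slack ℓ K s I| ≤ c ∧ ∀ s' ≠ s, (c' : ℤ) < slack ℓ K s' I) then
          ψ s (slack ℓ K s I) * g I else 0 := by
      rw [Finset.sum_comm]
      exact Finset.sum_congr rfl fun s _ => Finset.sum_filter _ _
    rw [e1, ← Finset.sum_sub_distrib]
    have hpt : ∀ I ∈ latticeBox n (ρ * K), |Φ I * g I - ∑ s,
        if (|slack ℓ K s I| ≤ c ∧ ∀ s' ≠ s, (c' : ℤ) < slack ℓ K s' I) then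
          ψ s (slack ℓ K s I) * g I else 0| ≤ if I ∈ ridgePoints ℓ ρ c' K then M else 0 := by
      intro I hI
      by_cases hex : ∃ s, |slack ℓ K s I| ≤ c ∧ ∀ s' ≠ s, (c' : ℤ) < slack ℓ K s' I
      · obtain ⟨s, hs⟩ := hex
        rw [Finset.sum_eq_single s, if_pos hs, hloc I s hs.1 fun s' hs' =>
          lt_of_le_of_lt (by exact_mod_cast hcc') (hs.2 s' hs'), sub_self, abs_zero]
        · split_ifs
          · exact hM
          · exact le_rfl
        · intro s' _ hs'
          refine if_neg fun hcon => ?_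
          have h1 := hs.2 s' hs'
          have h2 := (abs_le.1 hcon.1).2
          have : (c : ℤ) ≤ c' := by exact_mod_cast hcc'
          omega
        · exact fun hcon => absurd (Finset.mem_univ _) hcon
      · rw [Finset.sum_eq_zero fun s _ => if_neg fun hs => hex ⟨s, hs⟩, sub_zero]
        by_cases h0 : Φ I = 0
        · rw [h0, zero_mul, abs_zero]
          split_ifs
          · exact hM
          · exact le_rfl
        · obtain ⟨⟨s, hs⟩, hall⟩ := hsupp I h0
          have : I ∈ ridgePoints ℓ ρ c' K := by
            by_contra hR
            refine hex ⟨s, hs, fun s' hs' => ?_⟩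
            by_contra hlt
            refine hR (Finset.mem_filter.2 ⟨hI, s, s', hs'.symm, ?_, ?_⟩)
            · exact hs.trans (by exact_mod_cast hcc')
            · rw [abs_le]
              have := hall s'
              have : (c : ℤ) ≤ c' := by exact_mod_cast hcc'
              omega
          rw [if_pos this, abs_mul]
          calc |Φ I| * |g I| ≤ 1 * M := mul_le_mul (hΦ I) (hg.bound I hI) (abs_nonneg _) zero_le_one
            _ = M := one_mul M
    calc _ ≤ _ := Finset.abs_sum_le_sum_abs _ _
      _ ≤ ∑ I ∈ latticeBox n (ρ * K), if I ∈ ridgePoints ℓ ρ c' K then M else 0 :=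
          Finset.sum_le_sum hpt
      _ = ((latticeBox n (ρ * K)).filter fun I => I ∈ ridgePoints ℓ ρ c' K).card * M := by
          rw [← Finset.sum_filter, Finset.sum_const, nsmul_eq_mul]
      _ ≤ (ridgePoints ℓ ρ c' K).card * M := by
          gcongr
          exact fun I hI => (Finset.mem_filter.1 hI).2
      _ ≤ (C₂ * ((K : ℝ) ^ n / K ^ 2)) * M := by
          gcongr
          exact hridge K hK
      _ = _ := by ring
  have step2 : |∑ s, ∑ I ∈ F s, ψ s (slack ℓ K s I) * g I
      - ∑ s, (∑ j ∈ Finset.Icc (-(c : ℤ)) c, ψ s j) * ∑ I ∈ facetPoints ℓ ρ K s, g I|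
      ≤ d * ((2 * c + 1) * C₁) * M * ((K : ℝ) ^ n / K ^ 2) := by
    rw [← Finset.sum_sub_distrib]
    calc _ ≤ _ := Finset.abs_sum_le_sum_abs _ _
      _ ≤ ∑ _s : Fin d, ∑ _j ∈ Finset.Icc (-(c : ℤ)) c, C₁ * M * ((K : ℝ) ^ n / K ^ 2) := by
          refine Finset.sum_le_sum fun s _ => ?_
          rw [hF, Finset.sum_mul, ← Finset.sum_sub_distrib]
          refine (Finset.abs_sum_le_sum_abs _ _).trans (Finset.sum_le_sum fun j hj => ?_)
          rw [← mul_sub, abs_mul]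
          calc _ ≤ 1 * (C₁ * M * ((K : ℝ) ^ n / K ^ 2)) := by
                refine mul_le_mul (hψ s j) ?_ (abs_nonneg _) zero_le_one
                exact hlayer K hK g M hM hg s j (abs_le.2 (Finset.mem_Icc.1 hj))
            _ = _ := one_mul _
      _ = _ := by
          have : ((c : ℤ) + 1 - -(c : ℤ)).toNat = 2 * c + 1 := by omega
          rw [Finset.sum_const, Finset.sum_const, Int.card_Icc, this, Finset.card_univ,
            Fintype.card_fin, nsmul_eq_mul, nsmul_eq_mul]
          push_cast
          ring
  calc _ ≤ _ := abs_sub_le _ (∑ s, ∑ I ∈ F s, ψ s (slack ℓ K s I) * g I) _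
    _ ≤ _ := add_le_add step1 step2
    _ = _ := by ring

end Collapse

/-! ### Unit cubes around lattice points and their intersections with `m P` -/

section Cubes

open MeasureTheory Metric

variable {n d : ℕ}

/-- An integral vector as a real vector. -/
def castVec (I : Fin n → ℤ) : Fin n → ℝ := fun j => I j

theorem castVec_dotProduct (a I : Fin n → ℤ) : castVec a ⬝ᵥ castVec I = ((a ⬝ᵥ I : ℤ) : ℝ) := by
  simp [castVec, dotProduct]

theorem castVec_ne_zero {a : Fin n → ℤ} (ha : a ≠ 0) : castVec a ≠ 0 := by
  intro h
  refine ha (funext fun j => ?_)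
  have := congrFun h j
  simpa [castVec] using this

/-- The polytope `m P`, for all real `m`. -/
def dilate (ℓ : Fin d → Fin n → ℤ) (m : ℝ) : Set (Fin n → ℝ) :=
  {x | ∀ s, castVec (ℓ s) ⬝ᵥ x ≤ m}

theorem isClosed_dilate (ℓ : Fin d → Fin n → ℤ) (m : ℝ) : IsClosed (dilate ℓ m) := by
  have : dilate ℓ m = ⋂ s, {x | castVec (ℓ s) ⬝ᵥ x ≤ m} := by
    ext x
    simp [dilate]
  rw [this]
  refine isClosed_iInter fun s => isClosed_le ?_ continuous_const
  unfold dotProduct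
  fun_prop

theorem continuous_dotProduct_const (a : Fin n → ℝ) : Continuous fun x : Fin n → ℝ => a ⬝ᵥ x := by
  unfold dotProduct
  fun_prop

/-- The unit cube centered at a lattice point. -/
def cube (I : Fin n → ℤ) : Set (Fin n → ℝ) := closedBall (castVec I) (1 / 2)

theorem volume_cube (I : Fin n → ℤ) : volume (cube I) = 1 := by
  rw [cube, Real.volume_pi_closedBall _ (by norm_num)]
  norm_num

theorem volume_closedBall_half : volume (closedBall (0 : Fin n → ℝ) (1 / 2)) = 1 := by
  rw [Real.volume_pi_closedBall _ (by norm_num)]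
  norm_num

theorem add_mem_cube {I : Fin n → ℤ} {y : Fin n → ℝ} :
    castVec I + y ∈ cube I ↔ ‖y‖ ≤ 1 / 2 := by
  rw [cube, mem_closedBall, dist_eq_norm, add_sub_cancel_left]

/-- The half-open unit cube centered at a lattice point. -/
def halfOpenCube (I : Fin n → ℤ) : Set (Fin n → ℝ) :=
  Set.univ.pi fun j => Set.Ico ((I j : ℝ) - 1 / 2) (I j + 1 / 2)

theorem halfOpenCube_ae_eq (I : Fin n → ℤ) : halfOpenCube I =ᵐ[volume] cube I := by
  rw [cube, closedBall_pi _ (by norm_num)]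
  have : (fun j => closedBall (castVec I j) (1 / 2 : ℝ))
      = fun j => Set.Icc ((I j : ℝ) - 1 / 2) (I j + 1 / 2) := by
    funext j
    rw [Real.closedBall_eq_Icc]
    rfl
  rw [this]
  have h2 := Measure.univ_pi_Ico_ae_eq_Icc (μ := fun _ : Fin n => (volume : Measure ℝ))
    (f := fun j => (I j : ℝ) - 1 / 2) (g := fun j => (I j : ℝ) + 1 / 2)
  rw [← Set.pi_univ_Icc] at h2
  exact h2

theorem mem_halfOpenCube {I : Fin n → ℤ} {x : Fin n → ℝ} :
    x ∈ halfOpenCube I ↔ ∀ j, ⌊x j + 1 / 2⌋ = I j := by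
  simp only [halfOpenCube, Set.mem_pi, Set.mem_univ, true_implies, Set.mem_Ico, Int.floor_eq_iff]
  refine forall_congr' fun j => ?_
  constructor <;> rintro ⟨h1, h2⟩ <;> constructor <;> linarith

theorem halfOpenCube_subset (I : Fin n → ℤ) : halfOpenCube I ⊆ cube I := by
  intro x hx
  rw [cube, mem_closedBall, dist_pi_le_iff (by norm_num)]
  intro j
  have := hx j (Set.mem_univ j)
  rw [Real.dist_eq, abs_le]
  simp only [castVec]
  constructor <;> linarith [this.1, this.2]

/-- The half-open cubes tile space, and they differ from the closed ones, which are balls of the sup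
norm, by null sets. -/
theorem setIntegral_eq_sum_cube {S : Set (Fin n → ℝ)} (hS : MeasurableSet S)
    {g : (Fin n → ℝ) → ℝ} (hg : IntegrableOn g S) {B : Finset (Fin n → ℤ)}
    (hB : ∀ I, (cube I ∩ S).Nonempty → I ∈ B) :
    ∫ x in S, g x = ∑ I ∈ B, ∫ x in cube I ∩ S, g x := by
  have hm : ∀ I : Fin n → ℤ, MeasurableSet (halfOpenCube I) := fun I =>
    MeasurableSet.univ_pi fun _ => measurableSet_Ico
  have hcover : S = ⋃ I ∈ B, halfOpenCube I ∩ S := by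
    ext x
    simp only [Set.mem_iUnion, Set.mem_inter_iff, exists_prop]
    refine ⟨fun hx => ?_, fun ⟨_, _, _, hx⟩ => hx⟩
    have hxI : x ∈ halfOpenCube fun j => ⌊x j + 1 / 2⌋ := mem_halfOpenCube.2 fun _ => rfl
    exact ⟨_, hB _ ⟨x, halfOpenCube_subset _ hxI, hx⟩, hxI, hx⟩
  have h1 : ∫ x in S, g x = ∫ x in ⋃ I ∈ B, halfOpenCube I ∩ S, g x := by rw [← hcover]
  rw [h1, integral_biUnion_finset B (fun I _ => (hm I).inter hS)]
  · exact Finset.sum_congr rfl fun I _ =>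
      setIntegral_congr_set ((halfOpenCube_ae_eq I).inter (ae_eq_refl S))
  · intro I _ I' _ hne
    refine Set.disjoint_left.2 fun x hx hx' => hne (funext fun j => ?_)
    rw [← mem_halfOpenCube.1 hx.1 j, mem_halfOpenCube.1 hx'.1 j]
  · exact fun I _ => hg.mono_set Set.inter_subset_right

theorem setIntegral_cube (I : Fin n → ℤ) (g : (Fin n → ℝ) → ℝ) :
    ∫ x in cube I, g x = ∫ y in closedBall 0 (1 / 2), g (castVec I + y) := by
  have h := (measurePreserving_add_left volume (castVec I)).setIntegral_preimage_emb
    (measurableEmbedding_addLeft _) g (cube I)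
  rw [← h]
  congr 2
  ext y
  rw [Set.mem_preimage, add_mem_cube, mem_closedBall_zero_iff]

theorem setIntegral_ball_neg (g : (Fin n → ℝ) → ℝ) :
    ∫ y in closedBall (0 : Fin n → ℝ) (1 / 2), g (-y) = ∫ y in closedBall 0 (1 / 2), g y := by
  have h := (Measure.measurePreserving_neg (volume : Measure (Fin n → ℝ))).setIntegral_preimage_emb
    (MeasurableEquiv.neg _).measurableEmbedding g (closedBall 0 (1 / 2))
  rw [← h]
  congr 2
  ext y
  simp

/-- The midpoint rule: averaging over the symmetry `y ↦ -y` of the cube replaces first differences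
by second differences, without any derivative of `g`. -/
theorem abs_setIntegral_cube_le {g : (Fin n → ℝ) → ℝ} (hg : Continuous g) (I : Fin n → ℤ) {δ : ℝ}
    (h : ∀ y : Fin n → ℝ, ‖y‖ ≤ 1 / 2 →
      |g (castVec I + y) + g (castVec I - y) - 2 * g (castVec I)| ≤ δ) :
    |∫ x in cube I, (g x - g (castVec I))| ≤ δ / 2 := by
  have hint : ∀ f : (Fin n → ℝ) → ℝ, Continuous f →
      IntegrableOn f (closedBall (0 : Fin n → ℝ) (1 / 2)) := fun f hf =>
    hf.continuousOn.integrableOn_compact (isCompact_closedBall 0 (1 / 2))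
  have e1 := setIntegral_cube I fun x => g x - g (castVec I)
  have e2 := setIntegral_ball_neg fun y => g (castVec I + y) - g (castVec I)
  have e3 : 2 * ∫ x in cube I, (g x - g (castVec I)) = ∫ y in closedBall (0 : Fin n → ℝ) (1 / 2),
      (g (castVec I + y) + g (castVec I - y) - 2 * g (castVec I)) := by
    rw [two_mul]
    conv_lhs => rw [e1]
    conv_lhs => enter [2]; rw [← e2]
    rw [← integral_add (hint _ (by fun_prop)) (hint _ (by fun_prop))]
    refine setIntegral_congr_fun isClosed_closedBall.measurableSet fun y _ => ?_
    simp only [sub_eq_add_neg]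
    ring
  have h4 := norm_setIntegral_le_of_norm_le_const (μ := volume)
    (s := closedBall (0 : Fin n → ℝ) (1 / 2)) (C := δ)
    (f := fun y => g (castVec I + y) + g (castVec I - y) - 2 * g (castVec I))
    (by rw [volume_closedBall_half]; exact ENNReal.one_lt_top)
    (fun y hy => h y (mem_closedBall_zero_iff.1 hy))
  rw [← e3, measureReal_def, volume_closedBall_half, ENNReal.toReal_one, mul_one, norm_mul,
    Real.norm_eq_abs, Real.norm_eq_abs, abs_two] at h4
  linarith

/-- A bound for the oscillation of the normals on the unit cube. -/
def normalBound (ℓ : Fin d → Fin n → ℤ) : ℕ := ∑ s, ∑ j, (ℓ s j).natAbs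

theorem abs_dotProduct_le (a : Fin n → ℝ) (y : Fin n → ℝ) :
    |a ⬝ᵥ y| ≤ (∑ j, |a j|) * ‖y‖ := by
  rw [dotProduct, Finset.sum_mul]
  refine (Finset.abs_sum_le_sum_abs _ _).trans (Finset.sum_le_sum fun j _ => ?_)
  rw [abs_mul]
  exact mul_le_mul_of_nonneg_left (norm_le_pi_norm y j) (abs_nonneg _)

variable (ℓ : Fin d → Fin n → ℤ)

theorem abs_normal_dotProduct_le (s : Fin d) {y : Fin n → ℝ} (hy : ‖y‖ ≤ 1 / 2) :
    |castVec (ℓ s) ⬝ᵥ y| ≤ normalBound ℓ := by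
  have h1 : ∑ j, |castVec (ℓ s) j| ≤ normalBound ℓ := by
    have h2 : ∑ j, (ℓ s j).natAbs ≤ normalBound ℓ :=
      Finset.single_le_sum (f := fun s => ∑ j, (ℓ s j).natAbs) (fun _ _ => Nat.zero_le _)
        (Finset.mem_univ s)
    calc ∑ j, |castVec (ℓ s) j| = ((∑ j, (ℓ s j).natAbs : ℕ) : ℝ) := by
          push_cast
          exact Finset.sum_congr rfl fun j _ => by
            rw [castVec, Nat.cast_natAbs, Int.cast_abs]
      _ ≤ _ := by exact_mod_cast h2
  have h3 := abs_dotProduct_le (castVec (ℓ s)) y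
  have h4 : (0 : ℝ) ≤ normalBound ℓ := Nat.cast_nonneg _
  nlinarith [norm_nonneg y]

/-- The volume of the part of the unit cube on one side of a hyperplane. -/
def halfCubeVolume (s : Fin d) (t : ℝ) : ℝ :=
  volume.real (closedBall (0 : Fin n → ℝ) (1 / 2) ∩ {y | castVec (ℓ s) ⬝ᵥ y ≤ t})

/-- The volume of the part of the unit cube at `I` that lies in `m P`. -/
def cubeWeight (m : ℝ) (I : Fin n → ℤ) : ℝ := volume.real (cube I ∩ dilate ℓ m)

theorem cubeWeight_nonneg (m : ℝ) (I : Fin n → ℤ) : 0 ≤ cubeWeight ℓ m I := measureReal_nonneg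

theorem cubeWeight_le_one (m : ℝ) (I : Fin n → ℤ) : cubeWeight ℓ m I ≤ 1 := by
  have h1 : volume.real (cube I) = 1 := by
    rw [measureReal_def, volume_cube, ENNReal.toReal_one]
  rw [← h1]
  exact measureReal_mono Set.inter_subset_left (by rw [volume_cube]; exact ENNReal.one_ne_top)

theorem halfCubeVolume_nonneg (s : Fin d) (t : ℝ) : 0 ≤ halfCubeVolume ℓ s t := measureReal_nonneg

theorem halfCubeVolume_le_one (s : Fin d) (t : ℝ) : halfCubeVolume ℓ s t ≤ 1 := by
  have h1 : volume.real (closedBall (0 : Fin n → ℝ) (1 / 2)) = 1 := by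
    rw [measureReal_def, volume_closedBall_half, ENNReal.toReal_one]
  rw [← h1]
  exact measureReal_mono Set.inter_subset_left
    (by rw [volume_closedBall_half]; exact ENNReal.one_ne_top)

theorem halfCubeVolume_eq_one (s : Fin d) {t : ℝ} (ht : normalBound ℓ ≤ t) :
    halfCubeVolume ℓ s t = 1 := by
  rw [halfCubeVolume, Set.inter_eq_left.2, measureReal_def, volume_closedBall_half,
    ENNReal.toReal_one]
  intro y hy
  exact (abs_le.1 (abs_normal_dotProduct_le ℓ s (mem_closedBall_zero_iff.1 hy))).2.trans ht

theorem halfCubeVolume_eq_zero (s : Fin d) {t : ℝ} (ht : t < -normalBound ℓ) :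
    halfCubeVolume ℓ s t = 0 := by
  refine (congrArg volume.real (Set.eq_empty_of_forall_notMem ?_)).trans measureReal_empty
  rintro y ⟨hy, hy'⟩
  have := (abs_le.1 (abs_normal_dotProduct_le ℓ s (mem_closedBall_zero_iff.1 hy))).1
  exact absurd (le_trans this hy') (not_le.2 ht)

theorem volume_hyperplane {a : Fin n → ℝ} (ha : a ≠ 0) (t : ℝ) :
    volume {y : Fin n → ℝ | a ⬝ᵥ y = t} = 0 := by
  have haa : a ⬝ᵥ a ≠ 0 := fun h => ha (dotProduct_self_eq_zero.1 h)
  let φ : (Fin n → ℝ) →ₗ[ℝ] ℝ := dotProductBilin ℝ ℝ a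
  have hφ : ∀ y, φ y = a ⬝ᵥ y := fun y => rfl
  have h0 : volume ((LinearMap.ker φ : Submodule ℝ (Fin n → ℝ)) : Set (Fin n → ℝ)) = 0 := by
    refine Measure.addHaar_submodule volume _ fun htop => haa ?_
    have : a ∈ LinearMap.ker φ := htop ▸ Submodule.mem_top
    exact this
  have : {y : Fin n → ℝ | a ⬝ᵥ y = t}
      = (fun y => y + -((t / (a ⬝ᵥ a)) • a)) ⁻¹' (LinearMap.ker φ : Submodule ℝ (Fin n → ℝ)) := by
    ext y
    simp only [Set.mem_ofPred_eq, Set.mem_preimage, SetLike.mem_coe, LinearMap.mem_ker, hφ,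
      dotProduct_add, dotProduct_neg, dotProduct_smul, smul_eq_mul]
    rw [div_mul_cancel₀ _ haa, ← sub_eq_add_neg, sub_eq_zero]
  rw [this, measure_preimage_add_right, h0]

/-- The reflection `y ↦ -y` exchanges the two half spaces, and the hyperplane between them is null.
This symmetry is the source of the factor one half in the boundary term. -/
theorem halfCubeVolume_add_neg {s : Fin d} (hs : ℓ s ≠ 0) (t : ℝ) :
    halfCubeVolume ℓ s t + halfCubeVolume ℓ s (-t) = 1 := by
  have hneg : halfCubeVolume ℓ s (-t)
      = volume.real (closedBall (0 : Fin n → ℝ) (1 / 2) ∩ {y | t ≤ castVec (ℓ s) ⬝ᵥ y}) := by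
    rw [halfCubeVolume, measureReal_def, measureReal_def,
      ← (Measure.measurePreserving_neg (volume : Measure (Fin n → ℝ))).measure_preimage_emb
        (MeasurableEquiv.neg _).measurableEmbedding]
    congr 2
    ext y
    simp
  have hne : ∀ A : Set (Fin n → ℝ), volume (closedBall (0 : Fin n → ℝ) (1 / 2) ∩ A) ≠ ⊤ := fun A =>
    ne_top_of_le_ne_top (by rw [volume_closedBall_half]; exact ENNReal.one_ne_top)
      (measure_mono Set.inter_subset_left)
  have hc := continuous_dotProduct_const (castVec (ℓ s))
  rw [hneg, halfCubeVolume, ← measureReal_union_add_inter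
    (isClosed_closedBall.measurableSet.inter (isClosed_le continuous_const hc).measurableSet)
    (hne _) (hne _)]
  have h1 : closedBall (0 : Fin n → ℝ) (1 / 2) ∩ {y | castVec (ℓ s) ⬝ᵥ y ≤ t} ∪
      closedBall (0 : Fin n → ℝ) (1 / 2) ∩ {y | t ≤ castVec (ℓ s) ⬝ᵥ y} = closedBall 0 (1 / 2) := by
    rw [← Set.inter_union_distrib_left, Set.inter_eq_left]
    exact fun y _ => le_total (castVec (ℓ s) ⬝ᵥ y) t
  have h2 : volume.real (closedBall (0 : Fin n → ℝ) (1 / 2) ∩ {y | castVec (ℓ s) ⬝ᵥ y ≤ t} ∩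
      (closedBall (0 : Fin n → ℝ) (1 / 2) ∩ {y | t ≤ castVec (ℓ s) ⬝ᵥ y})) = 0 := by
    rw [measureReal_def, measure_mono_null _ (volume_hyperplane (castVec_ne_zero hs) t),
      ENNReal.toReal_zero]
    exact fun y hy => le_antisymm hy.1.2 hy.2.2
  rw [h1, h2, add_zero, measureReal_def, volume_closedBall_half, ENNReal.toReal_one]

theorem cubeWeight_eq (m : ℝ) (I : Fin n → ℤ) : cubeWeight ℓ m I =
    volume.real (closedBall (0 : Fin n → ℝ) (1 / 2) ∩
      {y | ∀ s, castVec (ℓ s) ⬝ᵥ y ≤ m - castVec (ℓ s) ⬝ᵥ castVec I}) := by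
  rw [cubeWeight, measureReal_def, measureReal_def,
    ← (measurePreserving_add_left volume (castVec I)).measure_preimage_emb
      (measurableEmbedding_addLeft _)]
  congr 2
  ext y
  rw [Set.mem_preimage, Set.mem_inter_iff, add_mem_cube, Set.mem_inter_iff, mem_closedBall_zero_iff]
  refine and_congr_right fun _ => forall_congr' fun s => ?_
  rw [dotProduct_add, le_sub_iff_add_le']

/-- The other facets are too far away to cut the cube, so the weight depends only on the slack at
`s`. -/
theorem cubeWeight_eq_halfCubeVolume {m : ℝ} {I : Fin n → ℤ} {s : Fin d}
    (h : ∀ s' ≠ s, normalBound ℓ ≤ m - castVec (ℓ s') ⬝ᵥ castVec I) :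
    cubeWeight ℓ m I = halfCubeVolume ℓ s (m - castVec (ℓ s) ⬝ᵥ castVec I) := by
  rw [cubeWeight_eq, halfCubeVolume]
  congr 1
  ext y
  refine and_congr_right fun hy => ⟨fun h' => h' s, fun h' s' => ?_⟩
  by_cases hs : s' = s
  · rw [hs]
    exact h'
  · exact (abs_le.1 (abs_normal_dotProduct_le ℓ s' (mem_closedBall_zero_iff.1 hy))).2.trans (h s' hs)

theorem cube_subset_dilate {m : ℝ} {I : Fin n → ℤ}
    (h : ∀ s, normalBound ℓ ≤ m - castVec (ℓ s) ⬝ᵥ castVec I) : cube I ⊆ dilate ℓ m := by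
  intro x hx s
  have hx' : ‖x - castVec I‖ ≤ 1 / 2 := by
    rwa [cube, mem_closedBall, dist_eq_norm] at hx
  have h1 := (abs_le.1 (abs_normal_dotProduct_le ℓ s hx')).2
  rw [dotProduct_sub] at h1
  linarith [h s]

theorem cubeWeight_eq_one {m : ℝ} {I : Fin n → ℤ}
    (h : ∀ s, normalBound ℓ ≤ m - castVec (ℓ s) ⬝ᵥ castVec I) : cubeWeight ℓ m I = 1 := by
  rw [cubeWeight, Set.inter_eq_left.2 (cube_subset_dilate ℓ h), measureReal_def, volume_cube,
    ENNReal.toReal_one]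

theorem neg_normalBound_le {m : ℝ} {I : Fin n → ℤ} {x : Fin n → ℝ} (hx : x ∈ cube I)
    {s : Fin d} (hs : castVec (ℓ s) ⬝ᵥ x ≤ m) :
    -(normalBound ℓ : ℝ) ≤ m - castVec (ℓ s) ⬝ᵥ castVec I := by
  have hx' : ‖x - castVec I‖ ≤ 1 / 2 := by
    rwa [cube, mem_closedBall, dist_eq_norm] at hx
  have h1 := (abs_le.1 (abs_normal_dotProduct_le ℓ s hx')).1
  rw [dotProduct_sub] at h1
  linarith

theorem cubeWeight_eq_zero {m : ℝ} {I : Fin n → ℤ} {s : Fin d}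
    (h : m - castVec (ℓ s) ⬝ᵥ castVec I < -normalBound ℓ) : cubeWeight ℓ m I = 0 := by
  refine (congrArg volume.real (Set.eq_empty_of_forall_notMem ?_)).trans measureReal_empty
  rintro x ⟨hx, hx'⟩
  exact absurd (neg_normalBound_le ℓ hx (hx' s)) (not_le.2 h)

theorem sub_castVec_eq_slack (K : ℕ) (s : Fin d) (I : Fin n → ℤ) :
    (K : ℝ) - castVec (ℓ s) ⬝ᵥ castVec I = (slack ℓ K s I : ℝ) := by
  rw [castVec_dotProduct, slack]
  push_cast
  rfl

end Cubes

/-! ### Cube weights against lattice points: facet points count one half -/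

section EulerMaclaurin

open MeasureTheory Metric

variable {n d : ℕ} {ℓ : Fin d → Fin n → ℤ}

/-- Regularity that suffices for the second order Euler-Maclaurin formula: second differences at
lattice points on the scale `1 / K` are `O(1 / K ^ 2)` outside of `O(K ^ (n - 1))` points. -/
structure IsTame (f : (Fin n → ℝ) → ℝ) : Prop where
  cont : Continuous f
  lip : ∀ ρ : ℕ, ∃ M : ℝ, 0 ≤ M ∧ ∀ x y, ‖x‖ ≤ ρ → ‖y‖ ≤ ρ → |f x - f y| ≤ M * ‖x - y‖
  second : ∀ ρ : ℕ, ∃ M : ℝ, 0 ≤ M ∧ ∀ K : ℕ, 0 < K → ∃ E : Finset (Fin n → ℤ),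
    (E.card : ℝ) ≤ M * ((K : ℝ) ^ n / K) ∧ ∀ I ∈ latticeBox n (ρ * K), I ∉ E → ∀ y : Fin n → ℝ,
      ‖y‖ ≤ 1 / 2 → |f ((K : ℝ)⁻¹ • (castVec I + y)) + f ((K : ℝ)⁻¹ • (castVec I - y))
        - 2 * f ((K : ℝ)⁻¹ • castVec I)| ≤ M / K ^ 2

theorem FacetNormals.exists_isBoxRadius (h : FacetNormals ℓ) (c : ℕ) :
    ∃ ρ, IsBoxRadius ℓ c ρ := by
  obtain ⟨ρ, hρ⟩ := h.bounded
  refine ⟨ρ * (c + 1), fun K hK I hI => mem_latticeBox.2 fun j => ?_⟩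
  have hK1 : (1 : ℝ) ≤ K := by exact_mod_cast hK
  have hc : (0 : ℝ) ≤ c := Nat.cast_nonneg c
  have h1 := hρ (K + c) (by linarith) (castVec I) (fun s => by
    have h2 := sub_castVec_eq_slack ℓ K s I
    have h3 : (-(c : ℝ)) ≤ (slack ℓ K s I : ℝ) := by exact_mod_cast hI s
    change castVec (ℓ s) ⬝ᵥ castVec I ≤ _
    linarith) j
  have h4 : ((|I j| : ℤ) : ℝ) ≤ ((ρ * (c + 1) * K : ℕ) : ℝ) := by
    push_cast
    refine h1.trans ?_
    rw [mul_assoc]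
    refine mul_le_mul_of_nonneg_left ?_ (Nat.cast_nonneg ρ)
    nlinarith
  exact_mod_cast h4

theorem sum_Icc_sub_pred (f : ℤ → ℝ) (c : ℕ) :
    ∑ j ∈ Finset.Icc (-(c : ℤ)) c, (f j - f (j - 1)) = f c - f (-(c : ℤ) - 1) := by
  induction c with
  | zero => simp
  | succ c ih =>
    have : Finset.Icc (-((c + 1 : ℕ) : ℤ)) ((c + 1 : ℕ) : ℤ)
        = insert (-((c + 1 : ℕ) : ℤ)) (insert ((c + 1 : ℕ) : ℤ) (Finset.Icc (-(c : ℤ)) c)) := by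
      ext j
      simp only [Finset.mem_Icc, Finset.mem_insert]
      omega
    rw [this, Finset.sum_insert, Finset.sum_insert, ih]
    · have e1 : ((c + 1 : ℕ) : ℤ) - 1 = c := by omega
      have e2 : -(c : ℤ) - 1 = -((c + 1 : ℕ) : ℤ) := by omega
      rw [e1, e2]
      ring
    · simp only [Finset.mem_Icc]
      omega
    · simp only [Finset.mem_Icc, Finset.mem_insert]
      omega

/-- Pairing `j` with `-j`, the half-cube volumes add up to `(2 c + 1) / 2`, while `c + 1` of the
integers are nonnegative. -/
theorem sum_halfCubeVolume {s : Fin d} (hs : ℓ s ≠ 0) (c : ℕ) :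
    ∑ j ∈ Finset.Icc (-(c : ℤ)) c, (halfCubeVolume ℓ s j - if 0 ≤ j then 1 else 0) = -1 / 2 := by
  have hcard : (Finset.Icc (-(c : ℤ)) c).card = 2 * c + 1 := by
    rw [Int.card_Icc]
    omega
  have h1 : ∑ j ∈ Finset.Icc (-(c : ℤ)) c, halfCubeVolume ℓ s ((-j : ℤ) : ℝ)
      = ∑ j ∈ Finset.Icc (-(c : ℤ)) c, halfCubeVolume ℓ s j := by
    refine Finset.sum_nbij' (fun j => -j) (fun j => -j) ?_ ?_ ?_ ?_ ?_
    · intro j hj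
      simp only [Finset.mem_Icc] at hj ⊢
      omega
    · intro j hj
      simp only [Finset.mem_Icc] at hj ⊢
      omega
    all_goals intro j _; simp
  have h2 : ∑ j ∈ Finset.Icc (-(c : ℤ)) c, (halfCubeVolume ℓ s j
      + halfCubeVolume ℓ s ((-j : ℤ) : ℝ)) = 2 * c + 1 := by
    rw [Finset.sum_congr rfl fun j _ => by
      rw [Int.cast_neg, halfCubeVolume_add_neg ℓ hs], Finset.sum_const, hcard]
    simp
  have h3 : ∑ j ∈ Finset.Icc (-(c : ℤ)) c, (if 0 ≤ j then (1 : ℝ) else 0) = c + 1 := by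
    rw [← Finset.sum_filter, Finset.sum_const]
    have : (Finset.Icc (-(c : ℤ)) c).filter (fun j => 0 ≤ j) = Finset.Icc 0 (c : ℤ) := by
      ext j
      simp only [Finset.mem_filter, Finset.mem_Icc]
      omega
    rw [this, Int.card_Icc]
    simp
  rw [Finset.sum_add_distrib, h1] at h2
  rw [Finset.sum_sub_distrib, h3]
  linarith

variable (ℓ) in
/-- The lattice points of `K P`. -/
def polytopePoints (ρ K : ℕ) : Finset (Fin n → ℤ) :=
  (latticeBox n (ρ * K)).filter fun I => ∀ s, 0 ≤ slack ℓ K s I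

theorem card_latticeBox_le (ρ : ℕ) {K : ℕ} (hK : 0 < K) :
    ((latticeBox n (ρ * K)).card : ℝ) ≤ (2 * ρ + 1) ^ n * (K : ℝ) ^ n := by
  have h1 := card_le_of_fibre_injOn (Finset.Subset.refl (latticeBox n (ρ * K)))
    (∅ : Finset (Fin n)) (fun _ => ()) {()} (fun _ _ => Finset.mem_singleton_self _)
    (fun I _ I' _ hoff _ => funext fun j => hoff j (Finset.notMem_empty j))
  have h2 := pow_two_mul_add_one_le (n := n) ρ hK (Nat.zero_le n)
  rw [pow_zero, div_one] at h2
  refine le_trans ?_ h2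
  simp only [Finset.card_empty, Finset.card_singleton, mul_one] at h1
  exact_mod_cast h1

variable (ℓ) in
/-- The lattice points near the boundary of `K P`. -/
def nearBoundary (ρ c K : ℕ) : Finset (Fin n → ℤ) :=
  (latticeBox n (ρ * K)).filter fun I => ∃ s, |slack ℓ K s I| ≤ c

theorem FacetNormals.card_nearBoundary_le (h : FacetNormals ℓ) (ρ c : ℕ) {K : ℕ} (hK : 0 < K) :
    ((nearBoundary ℓ ρ c K).card : ℝ)
      ≤ d * ((2 * ρ + 1) ^ n * (2 * c + 1)) * ((K : ℝ) ^ n / K) := by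
  classical
  have hsub : nearBoundary ℓ ρ c K ⊆ Finset.univ.biUnion fun s =>
      (latticeBox n (ρ * K)).filter fun I => |slack ℓ K s I| ≤ c := by
    intro I hI
    obtain ⟨hI, s, hs⟩ := Finset.mem_filter.1 hI
    exact Finset.mem_biUnion.2 ⟨s, Finset.mem_univ s, Finset.mem_filter.2 ⟨hI, hs⟩⟩
  calc ((nearBoundary ℓ ρ c K).card : ℝ)
      ≤ ∑ s : Fin d, (((latticeBox n (ρ * K)).filter fun I => |slack ℓ K s I| ≤ c).card : ℝ) := by
        exact_mod_cast (Finset.card_le_card hsub).trans Finset.card_biUnion_le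
    _ ≤ ∑ _s : Fin d, (2 * ρ + 1) ^ n * (2 * c + 1) * ((K : ℝ) ^ n / K) := by
        refine Finset.sum_le_sum fun s _ => ?_
        refine card_near_hyperplane_le (h.ne_zero s) ρ c hK (-K) (Finset.filter_subset _ _) ?_
        intro I hI
        have h1 := (Finset.mem_filter.1 hI).2
        have h2 : ((ℓ s ⬝ᵥ I : ℤ) : ℝ) + -K = ((-slack ℓ K s I : ℤ) : ℝ) := by
          rw [slack]
          push_cast
          ring
        rw [h2, ← Int.cast_abs, abs_neg]
        exact_mod_cast h1
    _ = _ := by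
        rw [Finset.sum_const, Finset.card_univ, Fintype.card_fin, nsmul_eq_mul]
        ring

theorem slack_real_gt {K : ℕ} {s : Fin d} {I : Fin n → ℤ} {c : ℤ} (hc : c < slack ℓ K s I) :
    (c : ℝ) + 1 ≤ (K : ℝ) - castVec (ℓ s) ⬝ᵥ castVec I := by
  rw [sub_castVec_eq_slack]
  exact_mod_cast hc

theorem slack_real_lt {K : ℕ} {s : Fin d} {I : Fin n → ℤ} {c : ℤ} (hc : slack ℓ K s I < c) :
    (K : ℝ) - castVec (ℓ s) ⬝ᵥ castVec I < c := by
  rw [sub_castVec_eq_slack]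
  exact_mod_cast hc

/-- The weights of the cubes count boundary points by one half. -/
theorem FacetNormals.abs_weight_sub_le (h : FacetNormals ℓ) {ρ : ℕ}
    (hρ : IsBoxRadius ℓ (normalBound ℓ + 1) ρ) : ∃ C : ℝ, 0 ≤ C ∧ ∀ K : ℕ, 0 < K →
      ∀ (g : (Fin n → ℤ) → ℝ) (M : ℝ), 0 ≤ M → IsSlowlyVarying g ρ K M →
      |∑ I ∈ latticeBox n (ρ * K), cubeWeight ℓ K I * g I - ∑ I ∈ polytopePoints ℓ ρ K, g I
        + 1 / 2 * ∑ s, ∑ I ∈ facetPoints ℓ ρ K s, g I| ≤ C * M * ((K : ℝ) ^ n / K ^ 2) := by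
  obtain ⟨C, hC, H⟩ := h.abs_sum_sub_facet_le (normalBound ℓ + 1) hρ
  refine ⟨C, hC, fun K hK g M hM hg => ?_⟩
  -- The difference between the cube weight and the indicator of `K P` vanishes away from the
  -- boundary. Near a single facet it is a function of the slack with total `-1 / 2`.
  have H := H K hK g M hM hg
    (fun I => cubeWeight ℓ K I - if ∀ s, 0 ≤ slack ℓ K s I then 1 else 0)
    (fun s j => halfCubeVolume ℓ s j - if 0 ≤ j then 1 else 0) ?_ ?_ ?_ ?_
  · have e1 : ∑ I ∈ latticeBox n (ρ * K),
        (cubeWeight ℓ K I - if ∀ s, 0 ≤ slack ℓ K s I then 1 else 0) * g I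
        = ∑ I ∈ latticeBox n (ρ * K), cubeWeight ℓ K I * g I
          - ∑ I ∈ polytopePoints ℓ ρ K, g I := by
      rw [polytopePoints, Finset.sum_filter, ← Finset.sum_sub_distrib]
      refine Finset.sum_congr rfl fun I _ => ?_
      split_ifs <;> ring
    have e2 : ∑ s, (∑ j ∈ Finset.Icc (-((normalBound ℓ + 1 : ℕ) : ℤ)) ((normalBound ℓ + 1 : ℕ) : ℤ),
        (halfCubeVolume ℓ s j - if 0 ≤ j then 1 else 0)) * ∑ I ∈ facetPoints ℓ ρ K s, g I
        = -1 / 2 * ∑ s, ∑ I ∈ facetPoints ℓ ρ K s, g I := by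
      rw [Finset.mul_sum]
      exact Finset.sum_congr rfl fun s _ => by rw [sum_halfCubeVolume (h.ne_zero s)]
    rw [e1, e2] at H
    convert H using 2
    ring
  · intro I
    have h1 := cubeWeight_nonneg ℓ K I
    have h2 := cubeWeight_le_one ℓ K I
    rw [abs_le]
    split_ifs <;> constructor <;> linarith
  · intro s j
    have h1 := halfCubeVolume_nonneg ℓ s j
    have h2 := halfCubeVolume_le_one ℓ s j
    rw [abs_le]
    split_ifs <;> constructor <;> linarith
  · intro I hI
    have hall : ∀ s, -((normalBound ℓ + 1 : ℕ) : ℤ) ≤ slack ℓ K s I := by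
      by_contra! hcon
      obtain ⟨s, hs⟩ := hcon
      refine hI ?_
      have h1 := slack_real_lt hs
      push_cast at h1 hs
      rw [cubeWeight_eq_zero ℓ (s := s) (by linarith), if_neg, sub_zero]
      intro hcon
      have := hcon s
      omega
    refine ⟨?_, hall⟩
    by_contra! hcon
    have hbig : ∀ s, ((normalBound ℓ + 1 : ℕ) : ℤ) < slack ℓ K s I := by
      intro s
      have h1 := hcon s
      have h2 := hall s
      rw [lt_abs] at h1
      omega
    refine hI ?_
    rw [cubeWeight_eq_one, if_pos, sub_self]
    · intro s
      have := hbig s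
      omega
    · intro s
      have h1 := slack_real_gt (hbig s)
      push_cast at h1
      linarith
  · intro I s hs hothers
    have h1 : ∀ s' ≠ s, (normalBound ℓ : ℝ) ≤ K - castVec (ℓ s') ⬝ᵥ castVec I := by
      intro s' hs'
      have h1 := slack_real_gt (hothers s' hs')
      push_cast at h1
      linarith
    rw [cubeWeight_eq_halfCubeVolume ℓ h1, sub_castVec_eq_slack]
    congr 2
    refine propext ⟨fun hh => hh s, fun hh s' => ?_⟩
    by_cases hs' : s' = s
    · rw [hs']
      exact hh
    · have := hothers s' hs'
      omega

/-- The weights of a boundary layer of width one add up to one along each facet. -/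
theorem FacetNormals.abs_weight_diff_sub_le (h : FacetNormals ℓ) {ρ : ℕ}
    (hρ : IsBoxRadius ℓ (normalBound ℓ + 1) ρ) : ∃ C : ℝ, 0 ≤ C ∧ ∀ K : ℕ, 0 < K →
      ∀ (g : (Fin n → ℤ) → ℝ) (M : ℝ), 0 ≤ M → IsSlowlyVarying g ρ K M →
      |∑ I ∈ latticeBox n (ρ * K), (cubeWeight ℓ K I - cubeWeight ℓ (K - 1) I) * g I
        - ∑ s, ∑ I ∈ facetPoints ℓ ρ K s, g I| ≤ C * M * ((K : ℝ) ^ n / K ^ 2) := by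
  -- A cube is unaffected by a facet at slack beyond `normalBound ℓ`; the extra one makes room for
  -- the facets of `(K - 1) P`.
  obtain ⟨C, hC, H⟩ := h.abs_sum_sub_facet_le (normalBound ℓ + 1) hρ
  refine ⟨C, hC, fun K hK g M hM hg => ?_⟩
  have hsub : ∀ (s : Fin d) (I : Fin n → ℤ), (K : ℝ) - 1 - castVec (ℓ s) ⬝ᵥ castVec I
      = ((slack ℓ K s I - 1 : ℤ) : ℝ) := by
    intro s I
    rw [Int.cast_sub, ← sub_castVec_eq_slack, Int.cast_one]
    ring
  have H := H K hK g M hM hg (fun I => cubeWeight ℓ K I - cubeWeight ℓ (K - 1) I)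
    (fun s j => halfCubeVolume ℓ s j - halfCubeVolume ℓ s ((j - 1 : ℤ) : ℝ)) ?_ ?_ ?_ ?_
  · convert H using 3
    refine Finset.sum_congr rfl fun s _ => ?_
    -- The profile across the facet telescopes from an empty cube to a full one, so its total is
    -- `1`.
    rw [sum_Icc_sub_pred (fun j => halfCubeVolume ℓ s (j : ℝ)), halfCubeVolume_eq_one,
      halfCubeVolume_eq_zero, sub_zero, one_mul]
    · push_cast
      linarith
    · push_cast
      linarith
  · intro I
    rw [abs_le]
    constructor <;> linarith [cubeWeight_nonneg ℓ K I, cubeWeight_le_one ℓ K I,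
      cubeWeight_nonneg ℓ (K - 1) I, cubeWeight_le_one ℓ (K - 1) I]
  · intro s j
    rw [abs_le]
    constructor <;> linarith [halfCubeVolume_nonneg ℓ s j, halfCubeVolume_le_one ℓ s j,
      halfCubeVolume_nonneg ℓ s ((j - 1 : ℤ) : ℝ), halfCubeVolume_le_one ℓ s ((j - 1 : ℤ) : ℝ)]
  · intro I hI
    have hall : ∀ s, -((normalBound ℓ + 1 : ℕ) : ℤ) ≤ slack ℓ K s I := by
      by_contra! hcon
      obtain ⟨s, hs⟩ := hcon
      refine hI ?_
      have h1 := slack_real_lt hs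
      push_cast at h1
      rw [cubeWeight_eq_zero ℓ (s := s) (by linarith),
        cubeWeight_eq_zero ℓ (s := s) (by linarith), sub_zero]
    refine ⟨?_, hall⟩
    by_contra! hcon
    have hbig : ∀ s, ((normalBound ℓ + 1 : ℕ) : ℤ) < slack ℓ K s I := by
      intro s
      have h1 := hcon s
      have h2 := hall s
      rw [lt_abs] at h1
      omega
    refine hI ?_
    rw [cubeWeight_eq_one, cubeWeight_eq_one, sub_self]
    all_goals
      intro s
      have h1 := slack_real_gt (hbig s)
      push_cast at h1
      linarith
  · intro I s hs hothers
    have h1 : ∀ s' ≠ s, (normalBound ℓ : ℝ) + 1 ≤ K - castVec (ℓ s') ⬝ᵥ castVec I := by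
      intro s' hs'
      have h1 := slack_real_gt (hothers s' hs')
      push_cast at h1
      linarith
    rw [cubeWeight_eq_halfCubeVolume ℓ fun s' hs' => by linarith [h1 s' hs'],
      cubeWeight_eq_halfCubeVolume ℓ fun s' hs' => by linarith [h1 s' hs'],
      sub_castVec_eq_slack, hsub]

end EulerMaclaurin

/-! ### Euler-Maclaurin with the boundary term as an integral over a shell -/

section RiemannSum

open MeasureTheory Metric

variable {n d : ℕ} {ℓ : Fin d → Fin n → ℤ} {f : (Fin n → ℝ) → ℝ}

theorem isCompact_cube (I : Fin n → ℤ) : IsCompact (cube I) := isCompact_closedBall _ _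

theorem setIntegral_cube_inter_sub {g : (Fin n → ℝ) → ℝ} (hg : Continuous g)
    (D : Set (Fin n → ℝ)) (I : Fin n → ℤ) (a : ℝ) :
    (∫ x in cube I ∩ D, g x) - volume.real (cube I ∩ D) * a = ∫ x in cube I ∩ D, (g x - a) := by
  have hfin : volume (cube I ∩ D) ≠ ⊤ := ne_top_of_le_ne_top
    (by rw [volume_cube]; exact ENNReal.one_ne_top) (measure_mono Set.inter_subset_left)
  rw [integral_sub ((hg.continuousOn.integrableOn_compact (isCompact_cube I)).mono_set
    Set.inter_subset_left) (integrableOn_const hfin), setIntegral_const, smul_eq_mul]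

theorem abs_setIntegral_cube_inter_sub_le {g : (Fin n → ℝ) → ℝ} (hg : Continuous g)
    (D : Set (Fin n → ℝ)) (I : Fin n → ℤ) {δ : ℝ} (hδ : ∀ x ∈ cube I, |g x - g (castVec I)| ≤ δ) :
    |(∫ x in cube I ∩ D, g x) - volume.real (cube I ∩ D) * g (castVec I)| ≤ δ := by
  have hδ0 : 0 ≤ δ := (abs_nonneg _).trans
    (hδ (castVec I) (mem_closedBall_self (by norm_num)))
  have hvol : volume (cube I ∩ D) ≤ 1 := by
    rw [← volume_cube I]
    exact measure_mono Set.inter_subset_left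
  rw [setIntegral_cube_inter_sub hg]
  have h1 := norm_setIntegral_le_of_norm_le_const (μ := volume) (s := cube I ∩ D) (C := δ)
    (f := fun x => g x - g (castVec I)) (hvol.trans_lt ENNReal.one_lt_top)
    (fun x hx => hδ x hx.1)
  rw [Real.norm_eq_abs] at h1
  refine h1.trans ?_
  have h2 : volume.real (cube I ∩ D) ≤ 1 := ENNReal.toReal_le_of_le_ofReal zero_le_one (by simpa)
  nlinarith

theorem norm_castVec_le {ρ K : ℕ} {I : Fin n → ℤ} (hI : I ∈ latticeBox n (ρ * K)) :
    ‖castVec I‖ ≤ ρ * K := by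
  rw [pi_norm_le_iff_of_nonneg (by positivity)]
  intro j
  rw [castVec, Real.norm_eq_abs, ← Int.cast_abs]
  have := mem_latticeBox.1 hI j
  exact_mod_cast this

theorem norm_inv_smul_castVec_le {ρ K : ℕ} (hK : 0 < K) {I : Fin n → ℤ}
    (hI : I ∈ latticeBox n (ρ * K)) : ‖(K : ℝ)⁻¹ • castVec I‖ ≤ ρ := by
  have hK0 : (0 : ℝ) < K := by exact_mod_cast hK
  rw [norm_smul, norm_inv, Real.norm_natCast, inv_mul_le_iff₀ hK0, mul_comm]
  exact norm_castVec_le hI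

/-- Bounds for `f (x / K)` at lattice points and on the cubes around them. -/
theorem IsTame.exists_bounds (hf : IsTame f) (ρ : ℕ) : ∃ M : ℝ, 0 ≤ M ∧ ∀ K : ℕ, 0 < K →
    IsSlowlyVarying (fun I => f ((K : ℝ)⁻¹ • castVec I)) ρ K M ∧
    ∀ I ∈ latticeBox n (ρ * K), ∀ x ∈ cube I,
      |f ((K : ℝ)⁻¹ • x) - f ((K : ℝ)⁻¹ • castVec I)| ≤ M / K := by
  obtain ⟨M, hM, hlip⟩ := hf.lip (ρ + 1)
  refine ⟨|f 0| + M * (ρ + 1), by positivity, fun K hK => ?_⟩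
  have hK0 : (0 : ℝ) < K := by exact_mod_cast hK
  have hK1 : (1 : ℝ) ≤ K := by exact_mod_cast hK
  have hle : M ≤ |f 0| + M * (ρ + 1) := by nlinarith [abs_nonneg (f 0), Nat.cast_nonneg (α := ℝ) ρ]
  have hbox : ∀ I ∈ latticeBox n (ρ * K), ‖(K : ℝ)⁻¹ • castVec I‖ ≤ (ρ + 1 : ℕ) := fun I hI => by
    have := norm_inv_smul_castVec_le hK hI
    push_cast
    linarith
  refine ⟨⟨fun I hI => ?_, fun I hI I' hI' N hN => ?_⟩, fun I hI x hx => ?_⟩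
  · have h1 := hlip _ 0 (hbox I hI) (by rw [norm_zero]; positivity)
    have h2 := hbox I hI
    rw [sub_zero] at h1
    have h3 : |f ((K : ℝ)⁻¹ • castVec I)| ≤ |f 0| + |f ((K : ℝ)⁻¹ • castVec I) - f 0| := by
      have := abs_add_le (f 0) (f ((K : ℝ)⁻¹ • castVec I) - f 0)
      rwa [add_sub_cancel] at this
    push_cast at h2
    nlinarith
  · have h1 := hlip _ _ (hbox I hI) (hbox I' hI')
    rw [← smul_sub, norm_smul, norm_inv, Real.norm_natCast] at h1
    have h2 : ‖castVec I - castVec I'‖ ≤ N := by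
      rw [pi_norm_le_iff_of_nonneg (by positivity)]
      intro j
      have := hN j
      rw [Pi.sub_apply, castVec, castVec, Real.norm_eq_abs, ← Int.cast_sub, ← Int.cast_abs]
      exact_mod_cast this
    refine h1.trans ?_
    calc M * ((K : ℝ)⁻¹ * ‖castVec I - castVec I'‖)
        ≤ (|f 0| + M * (ρ + 1)) * ((K : ℝ)⁻¹ * N) := by gcongr
      _ = _ := by field_simp
  · have hx' : ‖x - castVec I‖ ≤ 1 / 2 := by
      rwa [cube, mem_closedBall, dist_eq_norm] at hx
    have hxn : ‖(K : ℝ)⁻¹ • x‖ ≤ (ρ + 1 : ℕ) := by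
      have h3 := norm_castVec_le hI
      have h4 := norm_add_le (castVec I) (x - castVec I)
      rw [add_sub_cancel] at h4
      rw [norm_smul, norm_inv, Real.norm_natCast, inv_mul_le_iff₀ hK0]
      push_cast
      nlinarith
    have h1 := hlip _ _ hxn (hbox I hI)
    rw [← smul_sub, norm_smul, norm_inv, Real.norm_natCast] at h1
    refine h1.trans ?_
    calc M * ((K : ℝ)⁻¹ * ‖x - castVec I‖)
        ≤ (|f 0| + M * (ρ + 1)) * ((K : ℝ)⁻¹ * 1) := by gcongr; linarith
      _ = _ := by field_simp

theorem setIntegral_dilate_eq_sum {ρ K : ℕ} (hK : 0 < K) (h : FacetNormals ℓ)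
    (hρ : IsBoxRadius ℓ (normalBound ℓ + 1) ρ) {m : ℝ} (hm : m ≤ K) {g : (Fin n → ℝ) → ℝ}
    (hg : Continuous g) :
    ∫ x in dilate ℓ m, g x = ∑ I ∈ latticeBox n (ρ * K), ∫ x in cube I ∩ dilate ℓ m, g x := by
  refine setIntegral_eq_sum_cube (isClosed_dilate ℓ m).measurableSet ?_ ?_
  · refine hg.continuousOn.integrableOn_compact ?_
    refine isCompact_of_isClosed_isBounded (isClosed_dilate ℓ m) ?_
    obtain ⟨ρ', hρ'⟩ := h.bounded
    refine (isBounded_closedBall (x := (0 : Fin n → ℝ)) (r := ρ' * K)).subset fun x hx => ?_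
    rw [mem_closedBall_zero_iff, pi_norm_le_iff_of_nonneg (by positivity)]
    exact hρ' K (by exact_mod_cast hK) x fun s => (hx s).trans hm
  · rintro I ⟨x, hxI, hx⟩
    refine hρ K hK I fun s => ?_
    have h1 := neg_normalBound_le ℓ hxI ((hx s).trans hm)
    rw [sub_castVec_eq_slack] at h1
    have h2 : (-(normalBound ℓ : ℤ)) ≤ slack ℓ K s I := by exact_mod_cast h1
    push_cast
    omega

theorem card_filter_or_le {α : Type*} [DecidableEq α] (B : Finset α) (A E : Finset α) :
    (B.filter fun I => I ∈ A ∨ I ∈ E).card ≤ A.card + E.card := by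
  refine (Finset.card_le_card fun I hI => ?_).trans (Finset.card_union_le A E)
  exact Finset.mem_union.2 (Finset.mem_filter.1 hI).2

/-- Outside of a boundary layer, a cube is contained in a polytope or disjoint from it. -/
theorem notMem_nearBoundary {ρ K : ℕ} {I : Fin n → ℤ} (hI : I ∈ latticeBox n (ρ * K))
    (hI' : I ∉ nearBoundary ℓ ρ (normalBound ℓ + 1) K) {m : ℝ} (hm : (K : ℝ) - 1 ≤ m)
    (hm' : m ≤ K) :
    ((∀ s, ((normalBound ℓ + 1 : ℕ) : ℤ) < slack ℓ K s I) ∧ cube I ⊆ dilate ℓ m) ∨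
      ((∃ s, slack ℓ K s I < -((normalBound ℓ + 1 : ℕ) : ℤ)) ∧ cube I ∩ dilate ℓ m = ∅) := by
  by_cases hall : ∀ s, -((normalBound ℓ + 1 : ℕ) : ℤ) ≤ slack ℓ K s I
  · have hbig : ∀ s, ((normalBound ℓ + 1 : ℕ) : ℤ) < slack ℓ K s I := by
      intro s
      by_contra hcon
      refine hI' (Finset.mem_filter.2 ⟨hI, s, abs_le.2 ⟨hall s, not_lt.1 hcon⟩⟩)
    refine Or.inl ⟨hbig, cube_subset_dilate ℓ fun s => ?_⟩
    have h1 := slack_real_gt (hbig s)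
    push_cast at h1
    linarith
  · push Not at hall
    obtain ⟨s, hs⟩ := hall
    refine Or.inr ⟨⟨s, hs⟩, Set.eq_empty_of_forall_notMem ?_⟩
    rintro x ⟨hx, hx'⟩
    have h1 := neg_normalBound_le ℓ hx (hx' s)
    have h2 := slack_real_lt hs
    push_cast at h2
    linarith

/-- The midpoint rule gives an error `O(K⁻²)` on each of the `O(K ^ n)` interior cubes. On the `O(K
^ (n - 1))` cubes that meet the boundary layer or the exceptional set, the Lipschitz bound gives
`O(K⁻¹)`. Both totals are `O(K ^ (n - 2))`. -/
theorem IsTame.abs_integral_sub_weight_le (hf : IsTame f) (h : FacetNormals ℓ) {ρ : ℕ}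
    (hρ : IsBoxRadius ℓ (normalBound ℓ + 1) ρ) : ∃ C : ℝ, 0 ≤ C ∧ ∀ K : ℕ, 0 < K →
      |(∫ x in dilate ℓ K, f ((K : ℝ)⁻¹ • x))
        - ∑ I ∈ latticeBox n (ρ * K), cubeWeight ℓ K I * f ((K : ℝ)⁻¹ • castVec I)|
      ≤ C * ((K : ℝ) ^ n / K ^ 2) := by
  classical
  obtain ⟨M₁, hM₁, H₁⟩ := hf.exists_bounds ρ
  obtain ⟨M₂, hM₂, H₂⟩ := hf.second ρ
  set D : ℝ := d * ((2 * ρ + 1) ^ n * (2 * (normalBound ℓ + 1 : ℕ) + 1)) with hD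
  refine ⟨(D + M₂) * M₁ + (2 * ρ + 1) ^ n * M₂, by positivity, fun K hK => ?_⟩
  have hK0 : (0 : ℝ) < K := by exact_mod_cast hK
  obtain ⟨-, hosc⟩ := H₁ K hK
  obtain ⟨E, hE, hsec⟩ := H₂ K hK
  have hg : Continuous fun x : Fin n → ℝ => f ((K : ℝ)⁻¹ • x) := hf.cont.comp (continuous_const_smul _)
  have hnb := h.card_nearBoundary_le ρ (normalBound ℓ + 1) hK
  rw [← hD] at hnb
  rw [setIntegral_dilate_eq_sum hK h hρ le_rfl hg, ← Finset.sum_sub_distrib]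
  have hpt : ∀ I ∈ latticeBox n (ρ * K), |(∫ x in cube I ∩ dilate ℓ K, f ((K : ℝ)⁻¹ • x))
      - cubeWeight ℓ K I * f ((K : ℝ)⁻¹ • castVec I)|
      ≤ (if I ∈ nearBoundary ℓ ρ (normalBound ℓ + 1) K ∨ I ∈ E then M₁ / K else 0) + M₂ / K ^ 2 := by
    intro I hI
    by_cases hex : I ∈ nearBoundary ℓ ρ (normalBound ℓ + 1) K ∨ I ∈ E
    · rw [if_pos hex]
      have h1 := abs_setIntegral_cube_inter_sub_le hg (dilate ℓ K) I (hosc I hI)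
      have h2 : 0 ≤ M₂ / (K : ℝ) ^ 2 := by positivity
      exact h1.trans (by linarith)
    · rw [if_neg hex, zero_add]
      push Not at hex
      rcases notMem_nearBoundary hI hex.1 (sub_le_self _ zero_le_one) le_rfl with h1 | h1
      · rw [cubeWeight, setIntegral_cube_inter_sub hg, Set.inter_eq_left.2 h1.2]
        refine (abs_setIntegral_cube_le hg I (δ := M₂ / K ^ 2) (hsec I hI hex.2)).trans ?_
        exact half_le_self (by positivity)
      · rw [cubeWeight, h1.2]
        simp only [Measure.restrict_empty, integral_zero_measure, measureReal_empty, zero_mul,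
          sub_zero, abs_zero]
        positivity
  calc _ ≤ _ := Finset.abs_sum_le_sum_abs _ _
    _ ≤ _ := Finset.sum_le_sum hpt
    _ = ((latticeBox n (ρ * K)).filter fun I =>
          I ∈ nearBoundary ℓ ρ (normalBound ℓ + 1) K ∨ I ∈ E).card * (M₁ / K)
        + (latticeBox n (ρ * K)).card * (M₂ / K ^ 2) := by
        rw [Finset.sum_add_distrib, ← Finset.sum_filter, Finset.sum_const, Finset.sum_const,
          nsmul_eq_mul, nsmul_eq_mul]
    _ ≤ (D * ((K : ℝ) ^ n / K) + M₂ * ((K : ℝ) ^ n / K)) * (M₁ / K)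
        + ((2 * ρ + 1) ^ n * (K : ℝ) ^ n) * (M₂ / K ^ 2) := by
        refine add_le_add (mul_le_mul_of_nonneg_right ?_ (by positivity))
          (mul_le_mul_of_nonneg_right (card_latticeBox_le ρ hK) (by positivity))
        refine le_trans ?_ (add_le_add hnb hE)
        exact_mod_cast card_filter_or_le _ _ _
    _ = _ := by
        field_simp

/-- Away from the boundary layer a cube meets `K P` and `(K - 1) P` in the same set and cancels. So
only `O(K ^ (n - 1))` cubes remain, and the Lipschitz bound suffices. -/
theorem IsTame.abs_integral_diff_sub_weight_le (hf : IsTame f) (h : FacetNormals ℓ) {ρ : ℕ}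
    (hρ : IsBoxRadius ℓ (normalBound ℓ + 1) ρ) : ∃ C : ℝ, 0 ≤ C ∧ ∀ K : ℕ, 0 < K →
      |(∫ x in dilate ℓ K, f ((K : ℝ)⁻¹ • x)) - (∫ x in dilate ℓ (K - 1), f ((K : ℝ)⁻¹ • x))
        - ∑ I ∈ latticeBox n (ρ * K), (cubeWeight ℓ K I - cubeWeight ℓ (K - 1) I)
          * f ((K : ℝ)⁻¹ • castVec I)|
      ≤ C * ((K : ℝ) ^ n / K ^ 2) := by
  classical
  obtain ⟨M, hM, H⟩ := hf.exists_bounds ρ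
  set D : ℝ := d * ((2 * ρ + 1) ^ n * (2 * (normalBound ℓ + 1 : ℕ) + 1)) with hD
  refine ⟨D * (2 * M), by positivity, fun K hK => ?_⟩
  have hK0 : (0 : ℝ) < K := by exact_mod_cast hK
  obtain ⟨-, hosc⟩ := H K hK
  have hg : Continuous fun x : Fin n → ℝ => f ((K : ℝ)⁻¹ • x) := hf.cont.comp (continuous_const_smul _)
  have hnb := h.card_nearBoundary_le ρ (normalBound ℓ + 1) hK
  rw [← hD] at hnb
  rw [setIntegral_dilate_eq_sum hK h hρ le_rfl hg,
    setIntegral_dilate_eq_sum hK h hρ (sub_le_self _ zero_le_one) hg, ← Finset.sum_sub_distrib,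
    ← Finset.sum_sub_distrib]
  have hpt : ∀ I ∈ latticeBox n (ρ * K), |(∫ x in cube I ∩ dilate ℓ K, f ((K : ℝ)⁻¹ • x))
      - (∫ x in cube I ∩ dilate ℓ (K - 1), f ((K : ℝ)⁻¹ • x))
      - (cubeWeight ℓ K I - cubeWeight ℓ (K - 1) I) * f ((K : ℝ)⁻¹ • castVec I)|
      ≤ if I ∈ nearBoundary ℓ ρ (normalBound ℓ + 1) K then 2 * M / K else 0 := by
    intro I hI
    split_ifs with hex
    · have h1 := abs_setIntegral_cube_inter_sub_le hg (dilate ℓ K) I (hosc I hI)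
      have h2 := abs_setIntegral_cube_inter_sub_le hg (dilate ℓ (K - 1)) I (hosc I hI)
      rw [mul_div_assoc, sub_mul, sub_sub_sub_comm]
      rw [cubeWeight, cubeWeight]
      refine (abs_sub _ _).trans ?_
      linarith
    · have h1 := notMem_nearBoundary hI hex (sub_le_self (K : ℝ) zero_le_one) le_rfl
      have h2 := notMem_nearBoundary hI hex le_rfl (sub_le_self (K : ℝ) zero_le_one)
      have : cube I ∩ dilate ℓ (K : ℝ) = cube I ∩ dilate ℓ ((K : ℝ) - 1) := by
        rcases h1 with h1 | h1 <;> rcases h2 with h2 | h2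
        · rw [Set.inter_eq_left.2 h1.2, Set.inter_eq_left.2 h2.2]
        · obtain ⟨s, hs⟩ := h2.1
          have := h1.1 s
          omega
        · obtain ⟨s, hs⟩ := h1.1
          have := h2.1 s
          omega
        · rw [h1.2, h2.2]
      rw [cubeWeight, cubeWeight, this]
      simp
  calc _ ≤ _ := Finset.abs_sum_le_sum_abs _ _
    _ ≤ _ := Finset.sum_le_sum hpt
    _ = ((latticeBox n (ρ * K)).filter fun I =>
          I ∈ nearBoundary ℓ ρ (normalBound ℓ + 1) K).card * (2 * M / K) := by
        rw [← Finset.sum_filter, Finset.sum_const, nsmul_eq_mul]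
    _ ≤ (D * ((K : ℝ) ^ n / K)) * (2 * M / K) := by
        refine mul_le_mul_of_nonneg_right (le_trans ?_ hnb) (by positivity)
        exact_mod_cast Finset.card_le_card fun I hI => (Finset.mem_filter.1 hI).2
    _ = _ := by
        field_simp

/-- The Euler-Maclaurin formula to second order for sums over the lattice points of `K P`. -/
theorem IsTame.abs_sum_sub_integral_le (hf : IsTame f) (h : FacetNormals ℓ) :
    ∃ C : ℝ, 0 ≤ C ∧ ∀ K : ℕ, 0 < K → ∀ S : Finset (Fin n → ℤ),
      (∀ I, I ∈ S ↔ ∀ s, 0 ≤ slack ℓ K s I) →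
      |∑ I ∈ S, f ((K : ℝ)⁻¹ • castVec I) - (3 / 2 * (∫ x in dilate ℓ K, f ((K : ℝ)⁻¹ • x))
        - 1 / 2 * ∫ x in dilate ℓ (K - 1), f ((K : ℝ)⁻¹ • x))| ≤ C * ((K : ℝ) ^ n / K ^ 2) := by
  obtain ⟨ρ, hρ⟩ := h.exists_isBoxRadius (normalBound ℓ + 1)
  obtain ⟨M, hM, H⟩ := hf.exists_bounds ρ
  obtain ⟨C₁, hC₁, H₁⟩ := h.abs_weight_sub_le hρ
  obtain ⟨C₂, hC₂, H₂⟩ := h.abs_weight_diff_sub_le hρ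
  obtain ⟨C₃, hC₃, H₃⟩ := hf.abs_integral_sub_weight_le h hρ
  obtain ⟨C₄, hC₄, H₄⟩ := hf.abs_integral_diff_sub_weight_le h hρ
  refine ⟨C₁ * M + C₂ * M + C₃ + C₄, by positivity, fun K hK S hS => ?_⟩
  have hsv := (H K hK).1
  have hSeq : S = polytopePoints ℓ ρ K := by
    ext I
    rw [hS, polytopePoints, Finset.mem_filter]
    refine ⟨fun hI => ⟨hρ K hK I fun s => ?_, hI⟩, fun hI => hI.2⟩
    have := hI s
    push_cast
    omega
  -- Up to the error, the lattice sum is the integral over `K P` plus half the facet sums, and the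
  -- facet sums are the integral over `K P` minus that over `(K - 1) P`. This gives the coefficients
  -- `3 / 2` and `-1 / 2`.
  have e1 := abs_le.1 (H₁ K hK _ M hM hsv)
  have e2 := abs_le.1 (H₂ K hK _ M hM hsv)
  have e3 := abs_le.1 (H₃ K hK)
  have e4 := abs_le.1 (H₄ K hK)
  have p1 : 0 ≤ C₁ * M * ((K : ℝ) ^ n / K ^ 2) := by positivity
  have p2 : 0 ≤ C₂ * M * ((K : ℝ) ^ n / K ^ 2) := by positivity
  have p3 : 0 ≤ C₃ * ((K : ℝ) ^ n / K ^ 2) := by positivity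
  have p4 : 0 ≤ C₄ * ((K : ℝ) ^ n / K ^ 2) := by positivity
  rw [hSeq, abs_le, add_mul, add_mul, add_mul]
  constructor <;> linarith [e1.1, e1.2, e2.1, e2.2, e3.1, e3.2, e4.1, e4.2]

theorem smul_mem_dilate {K : ℝ} (hK : 0 < K) {m : ℝ} {x : Fin n → ℝ} :
    K • x ∈ dilate ℓ m ↔ x ∈ dilate ℓ (m / K) := by
  simp only [dilate, Set.mem_ofPred_eq, dotProduct_smul, smul_eq_mul, le_div_iff₀' hK]

theorem setIntegral_dilate_inv_smul {K : ℝ} (hK : 0 < K) (m : ℝ) (g : (Fin n → ℝ) → ℝ) :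
    ∫ x in dilate ℓ m, g (K⁻¹ • x) = K ^ n * ∫ x in dilate ℓ (m / K), g x := by
  have h1 := Measure.setIntegral_comp_smul_of_pos (volume : Measure (Fin n → ℝ)) g (dilate ℓ m)
    (inv_pos.2 hK)
  have h2 : K⁻¹ • dilate ℓ m = dilate ℓ (m / K) := by
    ext x
    rw [← smul_mem_dilate hK, Set.mem_inv_smul_set_iff₀ hK.ne']
  rw [h1, h2, Module.finrank_fin_fun, smul_eq_mul, inv_pow, inv_inv]

/-- The Euler-Maclaurin formula, rescaled. -/
theorem IsTame.abs_riemannSum_sub_integral_le (hf : IsTame f) (h : FacetNormals ℓ) :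
    ∃ C : ℝ, 0 ≤ C ∧ ∀ K : ℕ, 0 < K → ∀ S : Finset (Fin n → ℤ),
      (∀ I, I ∈ S ↔ ∀ s, 0 ≤ slack ℓ K s I) →
      |(∑ I ∈ S, f ((K : ℝ)⁻¹ • castVec I)) / (K : ℝ) ^ n - (3 / 2 * (∫ x in dilate ℓ 1, f x)
        - 1 / 2 * ∫ x in dilate ℓ (1 - 1 / K), f x)| ≤ C / (K : ℝ) ^ 2 := by
  obtain ⟨C, hC, H⟩ := hf.abs_sum_sub_integral_le h
  refine ⟨C, hC, fun K hK S hS => ?_⟩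
  have hK0 : (0 : ℝ) < K := by exact_mod_cast hK
  have hKn : (0 : ℝ) < (K : ℝ) ^ n := by positivity
  have h1 := H K hK S hS
  rw [setIntegral_dilate_inv_smul hK0, setIntegral_dilate_inv_smul hK0, div_self hK0.ne',
    sub_div, div_self hK0.ne'] at h1
  have h2 : ∀ A B D : ℝ, A / (K : ℝ) ^ n - (3 / 2 * B - 1 / 2 * D)
      = (A - (3 / 2 * ((K : ℝ) ^ n * B) - 1 / 2 * ((K : ℝ) ^ n * D))) / (K : ℝ) ^ n := by
    intro A B D
    field_simp
  rw [h2, abs_div, abs_of_pos hKn, div_le_iff₀ hKn]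
  refine h1.trans (le_of_eq ?_)
  ring

end RiemannSum

section Tame

variable {n : ℕ} {f g : (Fin n → ℝ) → ℝ}

theorem IsTame.exists_bound (hf : IsTame f) (ρ : ℕ) :
    ∃ M : ℝ, 0 ≤ M ∧ ∀ x, ‖x‖ ≤ ρ → |f x| ≤ M := by
  obtain ⟨M, hM, h⟩ := hf.lip ρ
  refine ⟨|f 0| + M * ρ, by positivity, fun x hx => ?_⟩
  have h1 := h x 0 hx (by rw [norm_zero]; positivity)
  have h2 := abs_add_le (f 0) (f x - f 0)
  rw [add_sub_cancel] at h2
  rw [sub_zero] at h1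
  nlinarith

theorem IsTame.const_sub (hf : IsTame f) (c : ℝ) : IsTame fun x => c - f x where
  cont := continuous_const.sub hf.cont
  lip ρ := by
    obtain ⟨M, hM, h⟩ := hf.lip ρ
    refine ⟨M, hM, fun x y hx hy => ?_⟩
    rw [sub_sub_sub_cancel_left, abs_sub_comm]
    exact h x y hx hy
  second ρ := by
    obtain ⟨M, hM, h⟩ := hf.second ρ
    refine ⟨M, hM, fun K hK => ?_⟩
    obtain ⟨E, hE, h⟩ := h K hK
    refine ⟨E, hE, fun I hI hIE y hy => ?_⟩
    rw [← abs_neg]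
    convert h I hI hIE y hy using 2
    ring

theorem IsTame.abs_sub_le_div (hf : IsTame f) (ρ : ℕ) : ∃ M : ℝ, 0 ≤ M ∧ ∀ K : ℕ, 0 < K →
    ∀ I ∈ latticeBox n (ρ * K), ∀ y : Fin n → ℝ, ‖y‖ ≤ 1 / 2 →
      |f ((K : ℝ)⁻¹ • (castVec I + y)) - f ((K : ℝ)⁻¹ • castVec I)| ≤ M / K := by
  obtain ⟨M, hM, h⟩ := hf.exists_bounds ρ
  exact ⟨M, hM, fun K hK I hI y hy => (h K hK).2 I hI _ (add_mem_cube.2 hy)⟩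

/-- The second difference of a product consists of the second difference of each factor times the
central value of the other, plus two products of first differences, each `O(K⁻²)`. The exceptional
sets are united. -/
theorem IsTame.mul (hf : IsTame f) (hg : IsTame g) : IsTame fun x => f x * g x where
  cont := hf.cont.mul hg.cont
  lip ρ := by
    obtain ⟨M, hM, h⟩ := hf.lip ρ
    obtain ⟨M', hM', h'⟩ := hg.lip ρ
    obtain ⟨B, hB, b⟩ := hf.exists_bound ρ
    obtain ⟨B', hB', b'⟩ := hg.exists_bound ρ
    refine ⟨B * M' + B' * M, by positivity, fun x y hx hy => ?_⟩
    have e : f x * g x - f y * g y = f x * (g x - g y) + g y * (f x - f y) := by ring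
    rw [e, add_mul]
    refine (abs_add_le _ _).trans (add_le_add ?_ ?_)
    · rw [abs_mul, mul_assoc]
      exact mul_le_mul (b x hx) (h' x y hx hy) (abs_nonneg _) hB
    · rw [abs_mul, mul_assoc]
      exact mul_le_mul (b' y hy) (h x y hx hy) (abs_nonneg _) hB'
  second ρ := by
    classical
    obtain ⟨M, hM, h⟩ := hf.second ρ
    obtain ⟨M', hM', h'⟩ := hg.second ρ
    obtain ⟨B, hB, b⟩ := hf.exists_bound ρ
    obtain ⟨B', hB', b'⟩ := hg.exists_bound ρ
    obtain ⟨L, hL, l⟩ := hf.abs_sub_le_div ρ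
    obtain ⟨L', hL', l'⟩ := hg.abs_sub_le_div ρ
    refine ⟨M + M' + (B * M' + B' * M + 2 * (L * L')), by positivity, fun K hK => ?_⟩
    obtain ⟨E, hE, h⟩ := h K hK
    obtain ⟨E', hE', h'⟩ := h' K hK
    have hK0 : (0 : ℝ) < K := by exact_mod_cast hK
    refine ⟨E ∪ E', ?_, fun I hI hIE y hy => ?_⟩
    · have h1 : ((E ∪ E').card : ℝ) ≤ E.card + E'.card := by
        exact_mod_cast Finset.card_union_le E E'
      have h2 : 0 ≤ (B * M' + B' * M + 2 * (L * L')) * ((K : ℝ) ^ n / K) := by positivity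
      linarith
    · rw [Finset.mem_union, not_or] at hIE
      have hy' : ‖-y‖ ≤ 1 / 2 := by rwa [norm_neg]
      have hI0 := norm_inv_smul_castVec_le hK hI
      have s1 := h I hI hIE.1 y hy
      have s2 := h' I hI hIE.2 y hy
      have l1 := l K hK I hI y hy
      have l2 := l K hK I hI (-y) hy'
      have l3 := l' K hK I hI y hy
      have l4 := l' K hK I hI (-y) hy'
      have b1 := b _ hI0
      have b2 := b' _ hI0
      rw [← sub_eq_add_neg] at l2 l4
      generalize f ((K : ℝ)⁻¹ • (castVec I + y)) = f1 at *
      generalize f ((K : ℝ)⁻¹ • (castVec I - y)) = f2 at *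
      generalize f ((K : ℝ)⁻¹ • castVec I) = f0 at *
      generalize g ((K : ℝ)⁻¹ • (castVec I + y)) = g1 at *
      generalize g ((K : ℝ)⁻¹ • (castVec I - y)) = g2 at *
      generalize g ((K : ℝ)⁻¹ • castVec I) = g0 at *
      have e : f1 * g1 + f2 * g2 - 2 * (f0 * g0) = f0 * (g1 + g2 - 2 * g0)
          + g0 * (f1 + f2 - 2 * f0) + (f1 - f0) * (g1 - g0) + (f2 - f0) * (g2 - g0) := by ring
      have t1 : |f0 * (g1 + g2 - 2 * g0)| ≤ B * (M' / K ^ 2) := by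
        rw [abs_mul]
        exact mul_le_mul b1 s2 (abs_nonneg _) hB
      have t2 : |g0 * (f1 + f2 - 2 * f0)| ≤ B' * (M / K ^ 2) := by
        rw [abs_mul]
        exact mul_le_mul b2 s1 (abs_nonneg _) hB'
      have t3 : |(f1 - f0) * (g1 - g0)| ≤ L / K * (L' / K) := by
        rw [abs_mul]
        exact mul_le_mul l1 l3 (abs_nonneg _) (by positivity)
      have t4 : |(f2 - f0) * (g2 - g0)| ≤ L / K * (L' / K) := by
        rw [abs_mul]
        exact mul_le_mul l2 l4 (abs_nonneg _) (by positivity)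
      rw [e]
      have h3 : (M + M' + (B * M' + B' * M + 2 * (L * L'))) / (K : ℝ) ^ 2
          = (M + M') / K ^ 2 + (B * (M' / K ^ 2) + B' * (M / K ^ 2) + L / K * (L' / K)
            + L / K * (L' / K)) := by
        field_simp
        ring
      have h4 : 0 ≤ (M + M') / (K : ℝ) ^ 2 := by positivity
      rw [h3]
      rw [abs_le] at *
      constructor <;> linarith [t1.1, t1.2, t2.1, t2.2, t3.1, t3.2, t4.1, t4.2]

theorem abs_exp_sub_exp_le {a b B : ℝ} (ha : a ≤ B) (hb : b ≤ B) :
    |Real.exp a - Real.exp b| ≤ Real.exp B * |a - b| := by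
  wlog h : b ≤ a generalizing a b
  · rw [abs_sub_comm, abs_sub_comm a]
    exact this hb ha (le_of_not_ge h)
  rw [abs_of_nonneg (sub_nonneg.2 (Real.exp_le_exp.2 h)), abs_of_nonneg (sub_nonneg.2 h)]
  have h1 : Real.exp b = Real.exp a * Real.exp (b - a) := by
    rw [← Real.exp_add]
    congr 1
    ring
  have h2 := Real.add_one_le_exp (b - a)
  have h3 := Real.exp_le_exp.2 ha
  rw [h1]
  calc Real.exp a - Real.exp a * Real.exp (b - a) = Real.exp a * (1 - Real.exp (b - a)) := by ring
    _ ≤ Real.exp a * (a - b) := mul_le_mul_of_nonneg_left (by linarith) (Real.exp_pos a).le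
    _ ≤ Real.exp B * (a - b) := mul_le_mul_of_nonneg_right h3 (sub_nonneg.2 h)

/-- Along a line the second difference of the exponential is a perfect square, `e^p (e^(q/2) -
e^(-q/2))²`, with `q = O(1 / K)`. No exceptional points are needed. -/
theorem isTame_exp_dotProduct (a : Fin n → ℝ) : IsTame fun x => Real.exp (a ⬝ᵥ x) where
  cont := Real.continuous_exp.comp (continuous_dotProduct_const a)
  lip ρ := by
    set A : ℝ := ∑ j, |a j|
    have hA : 0 ≤ A := Finset.sum_nonneg fun j _ => abs_nonneg _
    have hb : ∀ x : Fin n → ℝ, ‖x‖ ≤ ρ → a ⬝ᵥ x ≤ A * ρ := fun x hx =>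
      ((le_abs_self _).trans (abs_dotProduct_le a x)).trans (mul_le_mul_of_nonneg_left hx hA)
    refine ⟨Real.exp (A * ρ) * A, by positivity, fun x y hx hy => ?_⟩
    refine (abs_exp_sub_exp_le (hb x hx) (hb y hy)).trans ?_
    rw [← dotProduct_sub, mul_assoc]
    exact mul_le_mul_of_nonneg_left (abs_dotProduct_le a _) (Real.exp_pos _).le
  second ρ := by
    set A : ℝ := ∑ j, |a j|
    have hA : 0 ≤ A := Finset.sum_nonneg fun j _ => abs_nonneg _
    refine ⟨Real.exp (A * ρ) * (Real.exp A * A) ^ 2, by positivity, fun K hK => ⟨∅, ?_, ?_⟩⟩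
    · rw [Finset.card_empty, Nat.cast_zero]
      positivity
    · intro I hI _ y hy
      have hK0 : (0 : ℝ) < K := by exact_mod_cast hK
      have hK1 : (K : ℝ)⁻¹ ≤ 1 := inv_le_one_of_one_le₀ (by exact_mod_cast hK)
      have h1 : a ⬝ᵥ ((K : ℝ)⁻¹ • castVec I) ≤ A * ρ :=
        ((le_abs_self _).trans (abs_dotProduct_le a _)).trans
          (mul_le_mul_of_nonneg_left (norm_inv_smul_castVec_le hK hI) hA)
      set p := a ⬝ᵥ ((K : ℝ)⁻¹ • castVec I)
      set q := (K : ℝ)⁻¹ * (a ⬝ᵥ y) with hq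
      have hq' : |q| ≤ A / K := by
        have h2 := abs_dotProduct_le a y
        rw [hq, abs_mul, abs_inv, Nat.abs_cast, div_eq_inv_mul]
        refine mul_le_mul_of_nonneg_left (h2.trans ?_) (by positivity)
        change A * ‖y‖ ≤ A
        nlinarith
      have hqA : |q| ≤ A := hq'.trans (div_le_self hA (by exact_mod_cast hK))
      have e1 : a ⬝ᵥ ((K : ℝ)⁻¹ • (castVec I + y)) = p + q := by
        rw [smul_add, dotProduct_add, dotProduct_smul _ a y, smul_eq_mul]
      have e2 : a ⬝ᵥ ((K : ℝ)⁻¹ • (castVec I - y)) = p - q := by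
        rw [smul_sub, dotProduct_sub, dotProduct_smul _ a y, smul_eq_mul]
      have e3 : Real.exp (p + q) + Real.exp (p - q) - 2 * Real.exp p
          = Real.exp p * (Real.exp (q / 2) - Real.exp (-(q / 2))) ^ 2 := by
        have h5 : Real.exp (q / 2) * Real.exp (-(q / 2)) = 1 := by
          rw [← Real.exp_add, add_neg_cancel, Real.exp_zero]
        have h6 : Real.exp (p + q) = Real.exp p * Real.exp (q / 2) ^ 2 := by
          rw [← Real.exp_nat_mul, ← Real.exp_add]
          congr 1
          push_cast
          ring
        have h7 : Real.exp (p - q) = Real.exp p * Real.exp (-(q / 2)) ^ 2 := by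
          rw [← Real.exp_nat_mul, ← Real.exp_add]
          congr 1
          push_cast
          ring
        rw [h6, h7]
        linear_combination 2 * Real.exp p * h5
      rw [e1, e2, e3, abs_mul, abs_of_pos (Real.exp_pos p), abs_pow]
      have hqq := abs_le.1 hqA
      have h4 : |Real.exp (q / 2) - Real.exp (-(q / 2))| ≤ Real.exp A * (A / K) := by
        refine (abs_exp_sub_exp_le (B := A) (by linarith [hqq.2]) (by linarith [hqq.1])).trans ?_
        rw [sub_neg_eq_add, add_halves]
        exact mul_le_mul_of_nonneg_left hq' (Real.exp_pos _).le
      calc Real.exp p * |Real.exp (q / 2) - Real.exp (-(q / 2))| ^ 2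
          ≤ Real.exp (A * ρ) * (Real.exp A * (A / K)) ^ 2 := by gcongr
        _ = _ := by ring

theorem abs_dotProduct_sub_le_sum {m : ℕ} (z : Fin (m + 1) → Fin n → ℝ) (t : Fin (m + 1))
    (x y : Fin n → ℝ) : |z t ⬝ᵥ x - z t ⬝ᵥ y| ≤ (∑ t, ∑ j, |z t j|) * ‖x - y‖ := by
  rw [← dotProduct_sub]
  refine (abs_dotProduct_le _ _).trans (mul_le_mul_of_nonneg_right ?_ (norm_nonneg _))
  exact Finset.single_le_sum (f := fun t => ∑ j, |z t j|)
    (fun t _ => Finset.sum_nonneg fun j _ => abs_nonneg _) (Finset.mem_univ t)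

theorem abs_sup_affine_sub_le {m : ℕ} (z : Fin (m + 1) → Fin n → ℝ) (c : Fin (m + 1) → ℝ)
    (x y : Fin n → ℝ) :
    |Finset.univ.sup' Finset.univ_nonempty (fun t => z t ⬝ᵥ x + c t)
      - Finset.univ.sup' Finset.univ_nonempty (fun t => z t ⬝ᵥ y + c t)|
      ≤ (∑ t, ∑ j, |z t j|) * ‖x - y‖ := by
  have key : ∀ x y : Fin n → ℝ, Finset.univ.sup' Finset.univ_nonempty (fun t => z t ⬝ᵥ x + c t)
      ≤ Finset.univ.sup' Finset.univ_nonempty (fun t => z t ⬝ᵥ y + c t)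
        + (∑ t, ∑ j, |z t j|) * ‖x - y‖ := by
    intro x y
    refine Finset.sup'_le _ _ fun t ht => ?_
    have h1 := Finset.le_sup' (fun t => z t ⬝ᵥ y + c t) ht
    have h2 := (abs_le.1 (abs_dotProduct_sub_le_sum z t x y)).2
    linarith
  have h1 := key x y
  have h2 := key y x
  rw [norm_sub_rev] at h2
  rw [abs_le]
  constructor <;> linarith

/-- A maximum of affine functions with integral slopes is affine near all lattice points of `K P`
outside of a neighbourhood of finitely many hyperplanes. -/
theorem isTame_sup_affine {m : ℕ} (z : Fin (m + 1) → Fin n → ℤ) (c : Fin (m + 1) → ℝ) :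
    IsTame fun x => Finset.univ.sup' Finset.univ_nonempty fun t => castVec (z t) ⬝ᵥ x + c t where
  cont := by
    refine Continuous.finset_sup'_apply _ fun t _ => ?_
    exact (continuous_dotProduct_const _).add continuous_const
  lip ρ := ⟨∑ t, ∑ j, |castVec (z t) j|,
    Finset.sum_nonneg fun t _ => Finset.sum_nonneg fun j _ => abs_nonneg _,
    fun x y _ _ => abs_sup_affine_sub_le _ c x y⟩
  second ρ := by
    classical
    -- After multiplication by `K`, each piece changes by at most `N / 2` within a cube. The
    -- exceptional set consists of the lattice points where two pieces of different slope differ by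
    -- at most `N`.
    obtain ⟨N, hN⟩ := exists_nat_ge (∑ t, ∑ j, |castVec (z t) j|)
    let E : ℕ → Finset (Fin n → ℤ) := fun K =>
      (Finset.univ.filter fun p : Fin (m + 1) × Fin (m + 1) => z p.1 - z p.2 ≠ 0).biUnion fun p =>
        (latticeBox n (ρ * K)).filter fun I =>
          |(((z p.1 - z p.2) ⬝ᵥ I : ℤ) : ℝ) + K * (c p.1 - c p.2)| ≤ N
    refine ⟨((m + 1) * (m + 1) : ℕ) * ((2 * ρ + 1) ^ n * (2 * N + 1)), by positivity, fun K hK => ⟨E K, ?_, ?_⟩⟩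
    · calc ((E K).card : ℝ) ≤ ∑ p ∈ Finset.univ.filter fun p : Fin (m + 1) × Fin (m + 1) =>
            z p.1 - z p.2 ≠ 0, (((latticeBox n (ρ * K)).filter fun I =>
              |(((z p.1 - z p.2) ⬝ᵥ I : ℤ) : ℝ) + K * (c p.1 - c p.2)| ≤ N).card : ℝ) := by
            exact_mod_cast Finset.card_biUnion_le
        _ ≤ ∑ p ∈ Finset.univ.filter fun p : Fin (m + 1) × Fin (m + 1) =>
            z p.1 - z p.2 ≠ 0, (2 * ρ + 1) ^ n * (2 * N + 1) * ((K : ℝ) ^ n / K) := by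
            refine Finset.sum_le_sum fun p hp => ?_
            exact card_near_hyperplane_le (Finset.mem_filter.1 hp).2 ρ N hK _
              (Finset.filter_subset _ _) fun I hI => (Finset.mem_filter.1 hI).2
        _ ≤ ∑ _p : Fin (m + 1) × Fin (m + 1),
            (2 * ρ + 1) ^ n * (2 * N + 1) * ((K : ℝ) ^ n / K) :=
            Finset.sum_le_sum_of_subset_of_nonneg (Finset.filter_subset _ _)
              fun _ _ _ => by positivity
        _ = _ := by
            rw [Finset.sum_const, Finset.card_univ, Fintype.card_prod, Fintype.card_fin,
              nsmul_eq_mul]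
            ring
    · intro I hI hIE y hy
      have hK0 : (0 : ℝ) < K := by exact_mod_cast hK
      obtain ⟨t, -, ht⟩ := Finset.exists_mem_eq_sup' Finset.univ_nonempty
        fun t => castVec (z t) ⬝ᵥ ((K : ℝ)⁻¹ • castVec I) + c t
      have htop : ∀ t', castVec (z t') ⬝ᵥ ((K : ℝ)⁻¹ • castVec I) + c t'
          ≤ castVec (z t) ⬝ᵥ ((K : ℝ)⁻¹ • castVec I) + c t := fun t' => by
        rw [← ht]
        exact Finset.le_sup' (fun t => castVec (z t) ⬝ᵥ ((K : ℝ)⁻¹ • castVec I) + c t)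
          (Finset.mem_univ t')
      -- A piece that is maximal at the centre stays maximal on the whole cube, so the maximum is
      -- affine there and the second difference is zero. Pieces with equal slopes keep a constant
      -- gap and need no exclusion.
      have hstay : ∀ y : Fin n → ℝ, ‖y‖ ≤ 1 / 2 →
          Finset.univ.sup' Finset.univ_nonempty
            (fun t => castVec (z t) ⬝ᵥ ((K : ℝ)⁻¹ • (castVec I + y)) + c t)
            = castVec (z t) ⬝ᵥ ((K : ℝ)⁻¹ • (castVec I + y)) + c t := by
        intro y hy
        refine le_antisymm (Finset.sup'_le _ _ fun t' _ => ?_)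
          (Finset.le_sup' (fun t => castVec (z t) ⬝ᵥ ((K : ℝ)⁻¹ • (castVec I + y)) + c t)
            (Finset.mem_univ t))
        have h1 := htop t'
        by_cases hz : z t - z t' = 0
        · rw [← sub_eq_zero.1 hz] at h1 ⊢
          linarith
        · have h2 : (N : ℝ) < |(((z t - z t') ⬝ᵥ I : ℤ) : ℝ) + K * (c t - c t')| := by
            by_contra hcon
            exact hIE (Finset.mem_biUnion.2 ⟨(t, t'),
              Finset.mem_filter.2 ⟨Finset.mem_univ _, hz⟩,
              Finset.mem_filter.2 ⟨hI, not_lt.1 hcon⟩⟩)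
          have h3 : (((z t - z t') ⬝ᵥ I : ℤ) : ℝ)
              = castVec (z t) ⬝ᵥ castVec I - castVec (z t') ⬝ᵥ castVec I := by
            rw [castVec_dotProduct, castVec_dotProduct, sub_dotProduct]
            push_cast
            rfl
          have h4 := abs_le.1 (abs_dotProduct_sub_le_sum (fun t => castVec (z t)) t y 0)
          have h5 := abs_le.1 (abs_dotProduct_sub_le_sum (fun t => castVec (z t)) t' y 0)
          rw [dotProduct_zero, sub_zero, sub_zero] at h4 h5
          have h6 : (∑ t, ∑ j, |castVec (z t) j|) * ‖y‖ ≤ N / 2 := by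
            have h7 : 0 ≤ ∑ t, ∑ j, |castVec (z t) j| :=
              Finset.sum_nonneg fun t _ => Finset.sum_nonneg fun j _ => abs_nonneg _
            nlinarith
          simp only [dotProduct_smul, dotProduct_add, smul_eq_mul] at h1 ⊢
          have h8 : 0 ≤ (castVec (z t) ⬝ᵥ castVec I - castVec (z t') ⬝ᵥ castVec I)
              + K * (c t - c t') := by
            have e : K * ((K : ℝ)⁻¹ * (castVec (z t) ⬝ᵥ castVec I) + c t
                - ((K : ℝ)⁻¹ * (castVec (z t') ⬝ᵥ castVec I) + c t'))
                = (castVec (z t) ⬝ᵥ castVec I - castVec (z t') ⬝ᵥ castVec I)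
                  + K * (c t - c t') := by
              field_simp
              ring
            rw [← e]
            exact mul_nonneg hK0.le (sub_nonneg.2 h1)
          rw [h3, abs_of_nonneg h8] at h2
          rw [← sub_nonneg]
          have e : (K : ℝ)⁻¹ * (castVec (z t) ⬝ᵥ castVec I + castVec (z t) ⬝ᵥ y) + c t
              - ((K : ℝ)⁻¹ * (castVec (z t') ⬝ᵥ castVec I + castVec (z t') ⬝ᵥ y) + c t')
              = (K : ℝ)⁻¹ * ((castVec (z t) ⬝ᵥ castVec I - castVec (z t') ⬝ᵥ castVec I)
                  + K * (c t - c t') + castVec (z t) ⬝ᵥ y - castVec (z t') ⬝ᵥ y) := by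
            field_simp
            ring
          rw [e]
          refine mul_nonneg (inv_nonneg.2 hK0.le) ?_
          linarith [h4.1, h5.2]
      have h1 := hstay y hy
      have h2 := hstay (-y) (by rwa [norm_neg])
      rw [← sub_eq_add_neg] at h2
      rw [h1, h2, ht]
      have : castVec (z t) ⬝ᵥ ((K : ℝ)⁻¹ • (castVec I + y)) + c t
          + (castVec (z t) ⬝ᵥ ((K : ℝ)⁻¹ • (castVec I - y)) + c t)
          - 2 * (castVec (z t) ⬝ᵥ ((K : ℝ)⁻¹ • castVec I) + c t) = 0 := by
        simp only [dotProduct_smul, dotProduct_add, dotProduct_sub, smul_eq_mul]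
        ring
      rw [this, abs_zero]
      positivity

theorem isTame_dotProduct (a : Fin n → ℝ) : IsTame fun x => a ⬝ᵥ x where
  cont := continuous_dotProduct_const a
  lip ρ := ⟨∑ j, |a j|, Finset.sum_nonneg fun j _ => abs_nonneg _, fun x y _ _ => by
    rw [← dotProduct_sub]
    exact abs_dotProduct_le a _⟩
  second ρ := ⟨0, le_rfl, fun K hK => ⟨∅, by simp, fun I _ _ y _ => by
    have : a ⬝ᵥ ((K : ℝ)⁻¹ • (castVec I + y)) + a ⬝ᵥ ((K : ℝ)⁻¹ • (castVec I - y))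
        - 2 * (a ⬝ᵥ ((K : ℝ)⁻¹ • castVec I)) = 0 := by
      simp only [dotProduct_smul, dotProduct_add, dotProduct_sub, smul_eq_mul]
      ring
    rw [this]
    simp⟩⟩

theorem isTame_one : IsTame fun _ : Fin n → ℝ => (1 : ℝ) := by
  simpa using isTame_exp_dotProduct (0 : Fin n → ℝ)

end Tame

/-! ### Cones over facets: volume as radial measure times `dσ` -/

section ConeMeasure

open MeasureTheory Metric

variable {n d : ℕ}

/-- An integral covector as an element of the Euclidean space. -/
def normalVec (a : Fin n → ℤ) : EuclideanSpace ℝ (Fin n) := WithLp.toLp 2 fun j => (a j : ℝ)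

theorem inner_normalVec (a : Fin n → ℤ) (x : EuclideanSpace ℝ (Fin n)) :
    inner ℝ (normalVec a) x = pair a x := by
  rw [PiLp.inner_apply]
  refine Finset.sum_congr rfl fun j _ => ?_
  simp [normalVec, mul_comm]

theorem normalVec_ne_zero {a : Fin n → ℤ} (ha : a ≠ 0) : normalVec a ≠ 0 := by
  intro h
  refine ha (funext fun j => ?_)
  have := congrArg (fun v : EuclideanSpace ℝ (Fin n) => v j) h
  simpa [normalVec] using this

theorem pair_smul (a : Fin n → ℤ) (s : ℝ) (x : EuclideanSpace ℝ (Fin n)) :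
    pair a (s • x) = s * pair a x := by
  rw [← inner_normalVec, ← inner_normalVec, inner_smul_right]

theorem continuous_pair (a : Fin n → ℤ) : Continuous (pair a) := by
  unfold pair
  fun_prop

/-- The volume as an integral of the areas of the slices by parallel hyperplanes. -/
theorem volume_eq_lintegral_slice {a : Fin n → ℤ} (ha : a ≠ 0)
    {B : Set (EuclideanSpace ℝ (Fin n))} (hB : MeasurableSet B) :
    volume B = ENNReal.ofReal ‖normalVec a‖⁻¹ * ∫⁻ s : ℝ, μHE[n - 1] (B ∩ {x | pair a x = s}) := by
  have hv := normalVec_ne_zero ha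
  have hv' : ‖normalVec a‖ ≠ 0 := norm_ne_zero_iff.2 hv
  -- The direction is scaled so that its pairing with `a` is one; the slicing parameter is then the
  -- level of `pair a`, and the norm of the direction is the factor `‖normalVec a‖⁻¹`.
  have hw : (‖normalVec a‖ ^ 2)⁻¹ • normalVec a ≠ 0 := smul_ne_zero (by positivity) hv
  have h := EuclideanGeometry.euclideanHausdorffMeasure_eq_lintegral
    (0 : EuclideanSpace ℝ (Fin n)) hw hB
  rw [finrank_euclideanSpace_fin, EuclideanSpace.euclideanHausdorffMeasure_eq_volume] at h
  have h1 : ‖(‖normalVec a‖ ^ 2)⁻¹ • normalVec a‖ₑ = ENNReal.ofReal ‖normalVec a‖⁻¹ := by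
    rw [← ofReal_norm, norm_smul, norm_inv, norm_pow, norm_norm]
    congr 1
    field_simp
  rw [h, h1]
  congr 1
  refine lintegral_congr fun s => ?_
  congr 2
  ext x
  rw [SetLike.mem_coe, AffineSubspace.mem_mk', Submodule.mem_orthogonal_singleton_iff_inner_right,
    inner_smul_left, vadd_eq_add, add_zero, vsub_eq_sub, inner_sub_right, inner_smul_right,
    inner_smul_right, real_inner_self_eq_norm_sq, inv_mul_cancel₀ (by positivity), mul_one,
    mul_eq_zero, sub_eq_zero, inner_normalVec]
  refine or_iff_right ?_
  simpa using hv

variable (ℓ : Fin d → Fin n → ℤ) (i : Fin d)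

/-- The part of the cone over the facet `i` below the level `t`. -/
def slabCone (t : ℝ) : Set (EuclideanSpace ℝ (Fin n)) :=
  {x | (0 < pair (ℓ i) x ∧ pair (ℓ i) x ≤ t) ∧ ∀ j, pair (ℓ j) x ≤ pair (ℓ i) x}

theorem measurableSet_slabCone (t : ℝ) : MeasurableSet (slabCone ℓ i t) := by
  refine ((isOpen_lt continuous_const (continuous_pair _)).measurableSet.inter
    (isClosed_le (continuous_pair _) continuous_const).measurableSet).inter ?_
  have : {x : EuclideanSpace ℝ (Fin n) | ∀ j, pair (ℓ j) x ≤ pair (ℓ i) x}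
      = ⋂ j, {x | pair (ℓ j) x ≤ pair (ℓ i) x} := by
    ext x
    simp
  change MeasurableSet {x : EuclideanSpace ℝ (Fin n) | ∀ j, pair (ℓ j) x ≤ pair (ℓ i) x}
  rw [this]
  exact MeasurableSet.iInter fun j =>
    (isClosed_le (continuous_pair _) (continuous_pair _)).measurableSet

theorem isClosed_polytope : IsClosed (polytope ℓ) := by
  have : polytope ℓ = ⋂ i, {x | pair (ℓ i) x ≤ 1} := by
    ext x
    simp [polytope]
  rw [this]
  exact isClosed_iInter fun i => isClosed_le (continuous_pair _) continuous_const

theorem isClosed_facet : IsClosed (facet ℓ i) :=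
  (isClosed_polytope ℓ).inter (isClosed_eq (continuous_pair _) continuous_const)

theorem slabCone_inter_slice {s t : ℝ} (hs : s ∈ Set.Ioc 0 t)
    (B : Set (EuclideanSpace ℝ (Fin n))) :
    slabCone ℓ i t ∩ B ∩ {x | pair (ℓ i) x = s} = s • (facet ℓ i ∩ (fun y => s • y) ⁻¹' B) := by
  ext x
  rw [Set.mem_smul_set_iff_inv_smul_mem₀ hs.1.ne']
  simp only [slabCone, facet, polytope, Set.mem_inter_iff, Set.mem_ofPred_eq, Set.mem_preimage,
    pair_smul, smul_inv_smul₀ hs.1.ne', inv_mul_le_iff₀ hs.1, inv_mul_eq_iff_eq_mul₀ hs.1.ne',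
    mul_one]
  constructor
  · rintro ⟨⟨⟨-, h⟩, hB⟩, rfl⟩
    exact ⟨⟨h, rfl⟩, hB⟩
  · rintro ⟨⟨h, rfl⟩, hB⟩
    exact ⟨⟨⟨hs, h⟩, hB⟩, rfl⟩

/-- The slice of the cone at level `s` is `s` times the facet, which produces the density `s ^ (n -
1)`. -/
theorem volume_slabCone_inter (hi : ℓ i ≠ 0) (t : ℝ) {B : Set (EuclideanSpace ℝ (Fin n))}
    (hB : MeasurableSet B) : volume (slabCone ℓ i t ∩ B)
      = ENNReal.ofReal ‖normalVec (ℓ i)‖⁻¹ * ∫⁻ s in Set.Ioc 0 t, ENNReal.ofReal (s ^ (n - 1))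
        * μHE[n - 1] (facet ℓ i ∩ (fun y => s • y) ⁻¹' B) := by
  rw [volume_eq_lintegral_slice hi ((measurableSet_slabCone ℓ i t).inter hB),
    ← lintegral_indicator measurableSet_Ioc]
  congr 1
  refine lintegral_congr fun s => ?_
  by_cases hs : s ∈ Set.Ioc 0 t
  · rw [Set.indicator_of_mem hs, slabCone_inter_slice ℓ i hs,
      Measure.euclideanHausdorffMeasure_smul₀ _ hs.1.ne', ENNReal.smul_def, smul_eq_mul]
    congr 1
    rw [ENNReal.ofReal_pow hs.1.le, ENNReal.coe_pow, ← enorm_eq_nnnorm,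
      Real.enorm_eq_ofReal hs.1.le]
  · rw [Set.indicator_of_notMem hs]
    have : slabCone ℓ i t ∩ B ∩ {x | pair (ℓ i) x = s} = ∅ := by
      refine Set.eq_empty_of_forall_notMem ?_
      rintro x ⟨⟨h, -⟩, rfl⟩
      exact hs h.1
    rw [this, measure_empty]

/-- The measure `dσ` on the facet `i`. -/
def facetMeasure : Measure (EuclideanSpace ℝ (Fin n)) :=
  ENNReal.ofReal ‖normalVec (ℓ i)‖⁻¹ • (μHE[n - 1]).restrict (facet ℓ i)

theorem slabCone_one_subset : slabCone ℓ i 1 ⊆ polytope ℓ := fun _ hx j => (hx.2 j).trans hx.1.2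

/-- The cone below level one lies in the bounded set `P`, and its volume is a positive multiple of
the area of the facet. -/
theorem isFiniteMeasure_facetMeasure (hi : ℓ i ≠ 0) (hP : Bornology.IsBounded (polytope ℓ)) :
    IsFiniteMeasure (facetMeasure ℓ i) := by
  have hfin : volume (slabCone ℓ i 1 ∩ Set.univ) < ⊤ := by
    rw [Set.inter_univ]
    exact (hP.subset (slabCone_one_subset ℓ i)).measure_lt_top
  rw [volume_slabCone_inter ℓ i hi 1 MeasurableSet.univ] at hfin
  simp only [Set.preimage_univ, Set.inter_univ] at hfin
  have hm : Measurable fun s : ℝ => ENNReal.ofReal (s ^ (n - 1)) := by fun_prop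
  rw [lintegral_mul_const _ hm] at hfin
  have hv : ENNReal.ofReal ‖normalVec (ℓ i)‖⁻¹ ≠ 0 := by
    rw [Ne, ENNReal.ofReal_eq_zero, not_le]
    exact inv_pos.2 (norm_pos_iff.2 (normalVec_ne_zero hi))
  have hc : ∫⁻ s in Set.Ioc (0 : ℝ) 1, ENNReal.ofReal (s ^ (n - 1)) ≠ 0 := by
    rw [Ne, lintegral_eq_zero_iff hm]
    intro h0
    rw [Filter.EventuallyEq, ae_restrict_iff' measurableSet_Ioc] at h0
    have h1 : volume (Set.Ioc (0 : ℝ) 1) = 0 := by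
      refine measure_mono_null (fun s hs => ?_) (ae_iff.1 h0)
      simp [hs.1, hs.2]
    simp at h1
  refine ⟨?_⟩
  rw [facetMeasure, Measure.smul_apply, Measure.restrict_apply_univ, smul_eq_mul]
  refine ENNReal.mul_lt_top ENNReal.ofReal_lt_top ?_
  by_contra htop
  rw [not_lt, top_le_iff] at htop
  rw [htop, ENNReal.mul_top hc, ENNReal.mul_top hv] at hfin
  exact lt_irrefl _ hfin

/-- The measure `s ^ (n - 1) ds` on the interval `(0, t]`. -/
def radialMeasure (n : ℕ) (t : ℝ) : Measure ℝ :=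
  (volume.restrict (Set.Ioc 0 t)).withDensity fun s => ENNReal.ofReal (s ^ (n - 1))

instance (t : ℝ) : SFinite (radialMeasure n t) := by
  unfold radialMeasure
  infer_instance

/-- Polar coordinates on the cone over a facet. -/
theorem map_smul_radialMeasure (hi : ℓ i ≠ 0) (hP : Bornology.IsBounded (polytope ℓ)) (t : ℝ) :
    ((radialMeasure n t).prod (facetMeasure ℓ i)).map (fun p => p.1 • p.2)
      = volume.restrict (slabCone ℓ i t) := by
  have := isFiniteMeasure_facetMeasure ℓ i hi hP
  have hc : Measurable fun p : ℝ × EuclideanSpace ℝ (Fin n) => p.1 • p.2 := by fun_prop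
  ext B hB
  rw [Measure.map_apply hc hB, Measure.prod_apply (hc hB), Measure.restrict_apply hB,
    Set.inter_comm, volume_slabCone_inter ℓ i hi t hB, radialMeasure,
    lintegral_withDensity_eq_lintegral_mul _ (by fun_prop) (measurable_measure_prodMk_left (hc hB)),
    ← lintegral_const_mul' _ _ ENNReal.ofReal_ne_top]
  refine lintegral_congr fun s => ?_
  have hm : MeasurableSet ((fun y : EuclideanSpace ℝ (Fin n) => s • y) ⁻¹' B) :=
    (measurable_const_smul s) hB
  rw [Pi.mul_apply, facetMeasure, Measure.smul_apply, smul_eq_mul]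
  have : Prod.mk s ⁻¹' ((fun p : ℝ × EuclideanSpace ℝ (Fin n) => p.1 • p.2) ⁻¹' B)
      = (fun y : EuclideanSpace ℝ (Fin n) => s • y) ⁻¹' B := rfl
  rw [this, Measure.restrict_apply hm, Set.inter_comm]
  ring

end ConeMeasure

/-! ### Primitive and distinct normals from the vertices -/

section SmoothFano

variable {n d : ℕ} {ℓ : Fin d → Fin n → ℤ}

theorem pair_add (a : Fin n → ℤ) (x y : EuclideanSpace ℝ (Fin n)) :
    pair a (x + y) = pair a x + pair a y := by
  rw [← inner_normalVec, ← inner_normalVec, ← inner_normalVec, inner_add_right]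

theorem isExtreme_facet (i : Fin d) : IsExtreme ℝ (polytope ℓ) (facet ℓ i) := by
  refine ⟨fun x hx => hx.1, ?_⟩
  rintro x hx y hy z hz ⟨a, b, ha, hb, hab, rfl⟩
  have h1 := hz.2
  rw [pair_add, pair_smul, pair_smul] at h1
  refine ⟨hx, le_antisymm (hx i) ?_⟩
  have h2 : b * pair (ℓ i) y ≤ b := mul_le_of_le_one_right hb.le (hy i)
  nlinarith

namespace IsSmoothFano

theorem isCompact_polytope (hP : IsSmoothFano ℓ) : IsCompact (polytope ℓ) :=
  Metric.isCompact_of_isClosed_isBounded (isClosed_polytope ℓ) hP.bounded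

/-- A facet is compact and nonempty, so it has an extreme point; this is a vertex of `P` because the
facet is an extreme subset. -/
theorem exists_vertex (hP : IsSmoothFano ℓ) (i : Fin d) :
    ∃ v ∈ (polytope ℓ).extremePoints ℝ, pair (ℓ i) v = 1 := by
  have hc : IsCompact (facet ℓ i) :=
    hP.isCompact_polytope.of_isClosed_subset (isClosed_facet ℓ i) fun _ hx => hx.1
  obtain ⟨v, hv⟩ := hc.extremePoints_nonempty (hP.facet_nonempty i)
  exact ⟨v, (isExtreme_facet i).extremePoints_subset_extremePoints hv, (extremePoints_subset hv).2⟩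

/-- At a vertex on the facet the normals form a basis of the lattice. The dual basis vector shows
that the normal is primitive, and independence shows that no normal is repeated. -/
theorem facetNormals (hP : IsSmoothFano ℓ) : FacetNormals ℓ where
  bounded := by
    obtain ⟨C, hC⟩ := hP.bounded.exists_norm_le
    obtain ⟨ρ, hρ⟩ := exists_nat_ge C
    refine ⟨ρ, fun m hm x hx j => ?_⟩
    have hmem : m⁻¹ • WithLp.toLp 2 x ∈ polytope ℓ := fun s => by
      rw [pair_smul, inv_mul_le_iff₀ hm, mul_one]
      exact hx s
    have h1 := (PiLp.norm_apply_le (m⁻¹ • WithLp.toLp 2 x : EuclideanSpace ℝ (Fin n)) j).trans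
      ((hC _ hmem).trans hρ)
    rw [PiLp.smul_apply, norm_smul, norm_inv, Real.norm_of_nonneg hm.le, inv_mul_le_iff₀ hm,
      mul_comm] at h1
    exact h1
  exists_dual s := by
    obtain ⟨v, hv, hs⟩ := hP.exists_vertex s
    let b := Module.Basis.mk (hP.linearIndependent v hv) (hP.span_eq_top v hv).ge
    refine ⟨fun j => b.coord ⟨s, hs⟩ (Pi.single j 1), ?_⟩
    have h1 := LinearMap.pi_apply_eq_sum_univ (b.coord ⟨s, hs⟩) (ℓ s)
    have h2 : b.coord ⟨s, hs⟩ (ℓ s) = 1 := by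
      have h3 : b ⟨s, hs⟩ = ℓ s := Module.Basis.mk_apply _ _ _
      rw [← h3, Module.Basis.coord_apply, Module.Basis.repr_self, Finsupp.single_eq_same]
    rw [h2] at h1
    refine (Finset.sum_congr rfl fun j _ => ?_).trans h1.symm
    have h3 : (Pi.single j 1 : Fin n → ℤ) = fun j' => if j = j' then 1 else 0 := by
      ext j'
      simp [Pi.single_apply, eq_comm]
    rw [smul_eq_mul, ← h3]
  injective s s' h := by
    obtain ⟨v, hv, hs⟩ := hP.exists_vertex s
    have h1 := (hP.linearIndependent v hv).injective
      (a₁ := ⟨s, hs⟩) (a₂ := ⟨s', by rw [← h]; exact hs⟩) h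
    exact congrArg Subtype.val h1

end IsSmoothFano

end SmoothFano

/-! ### Integration over `t P` in polar coordinates -/

section PolarCoordinates

open MeasureTheory Metric

variable {n d : ℕ} {ℓ : Fin d → Fin n → ℤ} {f : EuclideanSpace ℝ (Fin n) → ℝ}

theorem setIntegral_slabCone (hf : Continuous f) (hP : Bornology.IsBounded (polytope ℓ)) {i : Fin d}
    (hi : ℓ i ≠ 0) {t : ℝ} (ht : t ≤ 1) : ∫ x in slabCone ℓ i t, f x
      = ∫ y, (∫ s in Set.Ioc 0 t, s ^ (n - 1) * f (s • y)) ∂facetMeasure ℓ i := by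
  have := isFiniteMeasure_facetMeasure ℓ i hi hP
  have hc : Continuous fun p : ℝ × EuclideanSpace ℝ (Fin n) => p.1 • p.2 := by fun_prop
  have hint : IntegrableOn f (slabCone ℓ i t) := by
    refine (hf.continuousOn.integrableOn_compact
      (isCompact_of_isClosed_isBounded (isClosed_polytope ℓ) hP)).mono_set fun x hx => ?_
    exact fun j => (hx.2 j).trans (hx.1.2.trans ht)
  rw [IntegrableOn, ← map_smul_radialMeasure ℓ i hi hP,
    integrable_map_measure hf.aestronglyMeasurable hc.aemeasurable] at hint
  rw [← map_smul_radialMeasure ℓ i hi hP, integral_map hc.aemeasurable hf.aestronglyMeasurable,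
    
    integral_prod_symm (fun p : ℝ × EuclideanSpace ℝ (Fin n) => f (p.1 • p.2)) hint]
  refine integral_congr_ae (Filter.Eventually.of_forall fun y => ?_)
  change ∫ s, f (s • y) ∂radialMeasure n t = _
  rw [radialMeasure, integral_withDensity_eq_integral_toReal_smul (by fun_prop)
    (Filter.Eventually.of_forall fun _ => ENNReal.ofReal_lt_top)]
  refine setIntegral_congr_fun measurableSet_Ioc fun s hs => ?_
  change (ENNReal.ofReal (s ^ (n - 1))).toReal • f (s • y) = _
  rw [ENNReal.toReal_ofReal (pow_nonneg hs.1.le _), smul_eq_mul]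

theorem volume_pair_eq_zero {a : Fin n → ℤ} (ha : a ≠ 0) :
    volume {x : EuclideanSpace ℝ (Fin n) | pair a x = 0} = 0 := by
  have h0 : volume {(0 : ℝ)}  = 0 := by simp
  rw [volume_eq_lintegral_slice ha (isClosed_eq (continuous_pair a) continuous_const).measurableSet,
    lintegral_congr_ae (g := fun _ => 0), lintegral_zero, mul_zero]
  rw [Filter.EventuallyEq, ae_iff]
  refine measure_mono_null (fun s hs => ?_) h0
  by_contra hs0
  refine hs ?_
  have : {x : EuclideanSpace ℝ (Fin n) | pair a x = 0} ∩ {x | pair a x = s} = ∅ := by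
    refine Set.eq_empty_of_forall_notMem ?_
    rintro x ⟨h1, rfl⟩
    exact hs0 h1
  rw [this, measure_empty]

theorem pair_sub_left (a b : Fin n → ℤ) (x : EuclideanSpace ℝ (Fin n)) :
    pair (a - b) x = pair a x - pair b x := by
  simp [pair, sub_mul]

/-- Integration over `t P` in polar coordinates. -/
theorem FacetNormals.setIntegral_eq_sum_polar (h : FacetNormals ℓ) (hn : 0 < n)
    (hP : Bornology.IsBounded (polytope ℓ)) (hf : Continuous f) {t : ℝ} (ht0 : 0 ≤ t) (ht : t ≤ 1) :
    ∫ x in {x | ∀ j, pair (ℓ j) x ≤ t}, f x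
      = ∑ i, ∫ y, (∫ s in Set.Ioc 0 t, s ^ (n - 1) * f (s • y)) ∂facetMeasure ℓ i := by
  have hunion : {x : EuclideanSpace ℝ (Fin n) | ∀ j, pair (ℓ j) x ≤ t}
      = (⋃ i, slabCone ℓ i t) ∪ {0} := by
    ext x
    simp only [Set.mem_ofPred_eq, Set.mem_union, Set.mem_iUnion, Set.mem_singleton_iff]
    constructor
    · intro hx
      by_cases hpos : ∃ s, 0 < pair (ℓ s) x
      · obtain ⟨s, hs⟩ := hpos
        obtain ⟨i, -, hi⟩ := Finset.exists_max_image Finset.univ (fun j => pair (ℓ j) x)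
          ⟨s, Finset.mem_univ s⟩
        exact Or.inl ⟨i, ⟨hs.trans_le (hi s (Finset.mem_univ s)), hx i⟩,
          fun j => hi j (Finset.mem_univ j)⟩
      -- A point on which no normal is positive lies in `m P` for every `m > 0`, so boundedness
      -- forces it to be the origin.
      · push Not at hpos
        right
        obtain ⟨ρ, hρ⟩ := h.bounded
        ext j
        have h1 : ∀ m : ℝ, 0 < m → |x j| ≤ ρ * m := fun m hm =>
          hρ m hm x (fun s => (hpos s).trans hm.le) j
        refine abs_nonpos_iff.1 (le_of_forall_pos_le_add fun ε hε => ?_)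
        have hρ1 : (0 : ℝ) < ρ + 1 := by positivity
        have h2 := h1 (ε / (ρ + 1)) (by positivity)
        rw [zero_add]
        refine h2.trans ?_
        rw [mul_div_assoc', div_le_iff₀ hρ1]
        nlinarith
    · rintro (⟨i, hx⟩ | rfl) j
      · exact (hx.2 j).trans hx.1.2
      · simpa [pair] using ht0
  have hnull : volume ({0} : Set (EuclideanSpace ℝ (Fin n))) = 0 := by
    have : Nonempty (Fin n) := ⟨⟨0, hn⟩⟩
    exact measure_singleton _
  rw [hunion, setIntegral_congr_set (union_ae_eq_left_of_ae_eq_empty (ae_eq_empty.2 hnull)),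
    integral_iUnion_ae, tsum_fintype]
  · exact Finset.sum_congr rfl fun i _ => setIntegral_slabCone hf hP (h.ne_zero i) ht
  · exact fun i => (measurableSet_slabCone ℓ i t).nullMeasurableSet
  -- Two cones overlap only where `pair (ℓ i)` and `pair (ℓ j)` agree, which is a hyperplane since
  -- the normals are distinct.
  · intro i j hij
    refine measure_mono_null (fun x hx => ?_)
      (volume_pair_eq_zero (sub_ne_zero.2 fun he => hij (h.injective he)))
    change pair (ℓ i - ℓ j) x = 0
    rw [pair_sub_left, sub_eq_zero]
    exact le_antisymm (hx.2.2 i) (hx.1.2 j)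
  · refine (hf.continuousOn.integrableOn_compact
      (isCompact_of_isClosed_isBounded (isClosed_polytope ℓ) hP)).mono_set ?_
    refine Set.iUnion_subset fun i x hx j => ?_
    exact (hx.2 j).trans (hx.1.2.trans ht)

/-- The density of `dσ` is constant on each facet and equals the factor that appears when the volume
is sliced by the levels of the normal. -/
theorem inner_unitNormal {i : Fin d} {x : EuclideanSpace ℝ (Fin n)} (hx : x ∈ facet ℓ i) :
    inner ℝ (unitNormal ℓ i) x = ‖normalVec (ℓ i)‖⁻¹ := by
  change inner ℝ (‖normalVec (ℓ i)‖⁻¹ • normalVec (ℓ i)) x = _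
  rw [inner_smul_left, inner_normalVec, hx.2, mul_one]
  rfl

theorem boundaryIntegral_eq_sum (ℓ : Fin d → Fin n → ℤ) (f : EuclideanSpace ℝ (Fin n) → ℝ) :
    boundaryIntegral ℓ f = ∑ i, ∫ y, f y ∂facetMeasure ℓ i := by
  refine Finset.sum_congr rfl fun i _ => ?_
  rw [facetMeasure, integral_smul_measure, ENNReal.toReal_ofReal (by positivity), smul_eq_mul,
    ← integral_const_mul]
  refine setIntegral_congr_fun (isClosed_facet ℓ i).measurableSet fun x hx => ?_
  change f x * inner ℝ (unitNormal ℓ i) x = _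
  rw [inner_unitNormal hx, mul_comm]

end PolarCoordinates

/-! ### Thin shells, the divergence theorem and the final form of Euler-Maclaurin -/

section BoundaryLayer

open MeasureTheory Metric

variable {n d : ℕ} {ℓ : Fin d → Fin n → ℤ} {f : EuclideanSpace ℝ (Fin n) → ℝ}

theorem ae_facetMeasure (ℓ : Fin d → Fin n → ℤ) (i : Fin d) :
    ∀ᵐ y ∂facetMeasure ℓ i, y ∈ facet ℓ i := by
  rw [facetMeasure]
  exact Measure.ae_smul_measure (ae_restrict_mem (isClosed_facet ℓ i).measurableSet) _

theorem isCompact_polytope (hP : Bornology.IsBounded (polytope ℓ)) : IsCompact (polytope ℓ) :=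
  isCompact_of_isClosed_isBounded (isClosed_polytope ℓ) hP

theorem integrable_facetMeasure (hP : Bornology.IsBounded (polytope ℓ)) {i : Fin d} (hi : ℓ i ≠ 0)
    (hf : Continuous f) : Integrable f (facetMeasure ℓ i) := by
  have := isFiniteMeasure_facetMeasure ℓ i hi hP
  obtain ⟨C, hC⟩ := (isCompact_polytope hP).exists_bound_of_continuousOn hf.continuousOn
  refine Integrable.of_bound hf.aestronglyMeasurable C ?_
  filter_upwards [ae_facetMeasure ℓ i] with y hy
  exact hC y hy.1

theorem continuous_radialIntegral (hf : Continuous f) (a b : ℝ) :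
    Continuous fun y => ∫ s in a..b, s ^ (n - 1) * f (s • y) :=
  intervalIntegral.continuous_parametric_intervalIntegral_of_continuous'
    (f := fun y s => s ^ (n - 1) * f (s • y)) (by unfold Function.uncurry; fun_prop) a b

theorem FacetNormals.setIntegral_eq_sum_interval (h : FacetNormals ℓ) (hn : 0 < n)
    (hP : Bornology.IsBounded (polytope ℓ)) (hf : Continuous f) {t : ℝ} (ht0 : 0 ≤ t) (ht : t ≤ 1) :
    ∫ x in {x | ∀ j, pair (ℓ j) x ≤ t}, f x
      = ∑ i, ∫ y, (∫ s in 0..t, s ^ (n - 1) * f (s • y)) ∂facetMeasure ℓ i := by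
  rw [h.setIntegral_eq_sum_polar hn hP hf ht0 ht]
  simp only [intervalIntegral.integral_of_le ht0]

theorem one_sub_pow_le {s : ℝ} (hs : 0 ≤ s) (m : ℕ) : 1 - s ^ m ≤ m * (1 - s) := by
  have := one_add_mul_le_pow (a := s - 1) (by linarith) m
  rw [add_sub_cancel] at this
  linarith

/-- The integral over a thin layer along the boundary. -/
theorem FacetNormals.abs_layer_sub_boundaryIntegral_le (h : FacetNormals ℓ) (hn : 0 < n)
    (hP : Bornology.IsBounded (polytope ℓ)) (hf : Continuous f) {M : ℝ}
    (hM : ∀ y ∈ polytope ℓ, ∀ s ∈ Set.Icc (0 : ℝ) 1, |f (s • y) - f y| ≤ M * (1 - s)) :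
    ∃ C : ℝ, ∀ ε ∈ Set.Icc (0 : ℝ) 1, |(∫ x in polytope ℓ, f x)
      - (∫ x in {x | ∀ j, pair (ℓ j) x ≤ 1 - ε}, f x) - ε * boundaryIntegral ℓ f| ≤ C * ε ^ 2 := by
  obtain ⟨B, hB⟩ := (isCompact_polytope hP).exists_bound_of_continuousOn hf.continuousOn
  -- On the ray through `y` the integrand differs from `f y` by at most `D (1 - s)`: the first
  -- summand comes from the factor `s ^ (n - 1)`, the second from the variation of `f`. Over an
  -- interval of length `ε` this yields `D ε ^ 2`.
  set D : ℝ := ((n - 1 : ℕ) : ℝ) * B + M with hD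
  refine ⟨∑ i, D * (facetMeasure ℓ i).real Set.univ, fun ε hε => ?_⟩
  have hcont : ∀ y, Continuous fun s : ℝ => s ^ (n - 1) * f (s • y) := fun y => by fun_prop
  have e1 := h.setIntegral_eq_sum_interval hn hP hf zero_le_one le_rfl
  have e2 := h.setIntegral_eq_sum_interval hn hP hf (sub_nonneg.2 hε.2) (sub_le_self 1 hε.1)
  change ∫ x in polytope ℓ, f x = _ at e1
  rw [e1, e2, boundaryIntegral_eq_sum, Finset.mul_sum, ← Finset.sum_sub_distrib,
    ← Finset.sum_sub_distrib, Finset.sum_mul]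
  refine (Finset.abs_sum_le_sum_abs _ _).trans (Finset.sum_le_sum fun i _ => ?_)
  have := isFiniteMeasure_facetMeasure ℓ i (h.ne_zero i) hP
  have hint := fun t => integrable_facetMeasure hP (h.ne_zero i) (continuous_radialIntegral hf 0 t)
  have hint2 : Integrable (fun y => (∫ s in 0..1, s ^ (n - 1) * f (s • y))
      - ∫ s in 0..(1 - ε), s ^ (n - 1) * f (s • y)) (facetMeasure ℓ i) :=
    (hint 1).sub (hint (1 - ε))
  rw [← integral_sub (hint _) (hint _), ← integral_const_mul,
    ← integral_sub hint2 ((integrable_facetMeasure hP (h.ne_zero i) hf).const_mul ε)]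
  have hbound : ∀ᵐ y ∂facetMeasure ℓ i, ‖((∫ s in 0..1, s ^ (n - 1) * f (s • y))
      - ∫ s in 0..(1 - ε), s ^ (n - 1) * f (s • y)) - ε * f y‖ ≤ D * ε ^ 2 := by
    filter_upwards [ae_facetMeasure ℓ i] with y hy
    have e3 : ε * f y = ∫ _s in (1 - ε)..1, f y := by
      rw [intervalIntegral.integral_const, smul_eq_mul]
      ring
    rw [intervalIntegral.integral_interval_sub_left ((hcont y).intervalIntegrable _ _)
      ((hcont y).intervalIntegrable _ _), e3, ← intervalIntegral.integral_sub
      ((hcont y).intervalIntegrable _ _) intervalIntegrable_const]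
    have h1 := intervalIntegral.norm_integral_le_of_norm_le_const (a := 1 - ε) (b := 1)
      (f := fun s => s ^ (n - 1) * f (s • y) - f y) (C := D * ε) ?_
    · rw [sub_sub_cancel, abs_of_nonneg hε.1] at h1
      refine h1.trans (le_of_eq ?_)
      ring
    · intro s hs
      rw [Set.uIoc_of_le (by linarith [hε.1])] at hs
      have hs0 : 0 ≤ s := by linarith [hs.1, hε.2]
      have h2 := hM y hy.1 s ⟨hs0, hs.2⟩
      have h3 := hB y hy.1
      have h4 := one_sub_pow_le hs0 (n - 1)
      have h5 : s ^ (n - 1) ≤ 1 := pow_le_one₀ hs0 hs.2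
      have h6 : 0 ≤ s ^ (n - 1) := pow_nonneg hs0 _
      have hB0 : 0 ≤ B := (norm_nonneg _).trans h3
      rw [Real.norm_eq_abs] at h3
      have e4 : s ^ (n - 1) * f (s • y) - f y
          = s ^ (n - 1) * (f (s • y) - f y) - (1 - s ^ (n - 1)) * f y := by ring
      have h7 : |s ^ (n - 1) * (f (s • y) - f y)| ≤ M * (1 - s) := by
        rw [abs_mul, abs_of_nonneg h6]
        nlinarith [abs_nonneg (f (s • y) - f y)]
      have h8 : |(1 - s ^ (n - 1)) * f y| ≤ ((n - 1 : ℕ) : ℝ) * (1 - s) * B := by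
        rw [abs_mul, abs_of_nonneg (sub_nonneg.2 h5)]
        exact mul_le_mul h4 h3 (abs_nonneg _) (by linarith)
      have h9 : 0 ≤ ((n - 1 : ℕ) : ℝ) * B := by positivity
      have h10 : 0 ≤ M := by
        have h11 := (abs_nonneg _).trans (hM y hy.1 0 ⟨le_rfl, zero_le_one⟩)
        linarith
      rw [Real.norm_eq_abs, e4]
      refine (abs_sub _ _).trans ((add_le_add h7 h8).trans ?_)
      rw [hD]
      nlinarith [hs.1]
  have h1 := norm_integral_le_of_norm_le_const hbound
  rw [Real.norm_eq_abs] at h1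
  refine h1.trans (le_of_eq ?_)
  ring

theorem thetaFun_smul (θ : Fin n → ℝ) (s : ℝ) (x : EuclideanSpace ℝ (Fin n)) :
    thetaFun θ (s • x) = s * thetaFun θ x := by
  simp only [thetaFun, PiLp.smul_apply, smul_eq_mul, Finset.mul_sum]
  exact Finset.sum_congr rfl fun j _ => by ring

theorem continuous_thetaFun (θ : Fin n → ℝ) : Continuous (thetaFun θ) := by
  unfold thetaFun
  fun_prop

/-- The divergence theorem for the vector field `exp θ x`. -/
theorem FacetNormals.boundaryIntegral_exp (h : FacetNormals ℓ) (hn : 0 < n)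
    (hP : Bornology.IsBounded (polytope ℓ)) (θ : Fin n → ℝ) :
    boundaryIntegral ℓ (fun x => Real.exp (thetaFun θ x))
      = ∫ x in polytope ℓ, (n + thetaFun θ x) * Real.exp (thetaFun θ x) := by
  have hc := continuous_thetaFun θ
  have e1 := h.setIntegral_eq_sum_interval (f := fun x => (n + thetaFun θ x) * Real.exp (thetaFun θ x))
    hn hP (by fun_prop) zero_le_one le_rfl
  change ∫ x in polytope ℓ, _ = _ at e1
  rw [e1, boundaryIntegral_eq_sum]
  refine Finset.sum_congr rfl fun i _ => integral_congr_ae (Filter.Eventually.of_forall fun y => ?_)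
  change _ = ∫ s in (0 : ℝ)..1, s ^ (n - 1) * ((n + thetaFun θ (s • y)) * Real.exp (thetaFun θ (s • y)))
  simp only [thetaFun_smul]
  generalize thetaFun θ y = a
  -- As `θ` is linear, the radial integrand is an exact derivative. Its primitive vanishes at `s =
  -- 0` because `n > 0`, and only the value on the facet is left.
  have hderiv : ∀ s : ℝ, HasDerivAt (fun s => s ^ n * Real.exp (s * a))
      (s ^ (n - 1) * ((n + s * a) * Real.exp (s * a))) s := by
    intro s
    have h1 := (hasDerivAt_pow n s).mul ((hasDerivAt_mul_const a (x := s)).exp)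
    have h2 : s ^ n = s ^ (n - 1) * s := by rw [← pow_succ, Nat.sub_add_cancel hn]
    refine h1.congr_deriv ?_
    rw [h2]
    ring
  rw [intervalIntegral.integral_eq_sub_of_hasDerivAt (fun s _ => hderiv s)
    (Continuous.intervalIntegrable (by fun_prop) _ _)]
  simp [hn.ne']

/-- Coordinates identify the integrals over `t P`. -/
theorem setIntegral_dilate (ℓ : Fin d → Fin n → ℤ) (t : ℝ) (g : (Fin n → ℝ) → ℝ) :
    ∫ x in dilate ℓ t, g x
      = ∫ x in {x : EuclideanSpace ℝ (Fin n) | ∀ j, pair (ℓ j) x ≤ t}, g (WithLp.ofLp x) :=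
  ((PiLp.volume_preserving_ofLp (Fin n)).setIntegral_preimage_emb
    (MeasurableEquiv.toLp 2 (Fin n → ℝ)).symm.measurableEmbedding g (dilate ℓ t)).symm

/-- The Euler-Maclaurin formula for lattice points of `K P`, in terms of boundary integrals. -/
theorem IsTame.abs_riemannSum_sub_le {g : (Fin n → ℝ) → ℝ} (hg : IsTame g) (h : FacetNormals ℓ)
    (hn : 0 < n) (hP : Bornology.IsBounded (polytope ℓ)) :
    ∃ C : ℝ, ∀ K : ℕ, 0 < K → ∀ S : Finset (Fin n → ℤ),
      (∀ I, I ∈ S ↔ ∀ s, 0 ≤ slack ℓ K s I) →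
      |(∑ I ∈ S, g ((K : ℝ)⁻¹ • castVec I)) / (K : ℝ) ^ n
        - ((∫ x in polytope ℓ, g (WithLp.ofLp x))
          + boundaryIntegral ℓ (fun x => g (WithLp.ofLp x)) / (2 * K))| ≤ C / (K : ℝ) ^ 2 := by
  obtain ⟨C, hC, H⟩ := hg.abs_riemannSum_sub_integral_le h
  have hcont : Continuous fun x : EuclideanSpace ℝ (Fin n) => g (WithLp.ofLp x) :=
    hg.cont.comp (PiLp.continuous_ofLp 2 _)
  obtain ⟨ρ, hρ⟩ := h.bounded
  obtain ⟨M, hM, hlip⟩ := hg.lip ρ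
  have hnorm : ∀ y ∈ polytope ℓ, ‖WithLp.ofLp y‖ ≤ ρ := by
    intro y hy
    rw [pi_norm_le_iff_of_nonneg (by positivity)]
    intro j
    have := hρ 1 one_pos (WithLp.ofLp y) hy j
    rwa [mul_one] at this
  obtain ⟨C', H'⟩ := h.abs_layer_sub_boundaryIntegral_le hn hP hcont (M := M * ρ) (by
    intro y hy s hs
    have h1 := hnorm y hy
    have h2 := hlip (s • WithLp.ofLp y) (WithLp.ofLp y) (by
      rw [norm_smul, Real.norm_of_nonneg hs.1]
      nlinarith [norm_nonneg (WithLp.ofLp y), hs.2]) h1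
    refine h2.trans ?_
    have h3 : s • WithLp.ofLp y - WithLp.ofLp y = -((1 - s) • WithLp.ofLp y) := by
      rw [sub_smul, one_smul, neg_sub]
    rw [h3, norm_neg, norm_smul, Real.norm_of_nonneg (sub_nonneg.2 hs.2)]
    have := mul_le_mul_of_nonneg_left h1 (mul_nonneg hM (sub_nonneg.2 hs.2))
    linarith)
  refine ⟨C + C' / 2, fun K hK S hS => ?_⟩
  have hK0 : (0 : ℝ) < K := by exact_mod_cast hK
  have hK1 : (K : ℝ)⁻¹ ≤ 1 := inv_le_one_of_one_le₀ (by exact_mod_cast hK)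
  have h1 := H K hK S hS
  -- With `ε = 1 / K`, the combination with coefficients `3 / 2` and `-1 / 2` is the integral over
  -- `P` plus half the integral over the shell.
  have h2 := H' (K : ℝ)⁻¹ ⟨(inv_pos.2 hK0).le, hK1⟩
  rw [setIntegral_dilate, setIntegral_dilate, one_div (K : ℝ)] at h1
  change |_ - (3 / 2 * (∫ x in polytope ℓ, g (WithLp.ofLp x)) - _)| ≤ _ at h1
  generalize boundaryIntegral ℓ (fun x => g (WithLp.ofLp x)) = Bd at *
  have e1 : Bd / (2 * K) = (K : ℝ)⁻¹ * Bd / 2 := by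
    field_simp
  have e2 : (C + C' / 2) / (K : ℝ) ^ 2 = C / (K : ℝ) ^ 2 + C' * ((K : ℝ)⁻¹) ^ 2 / 2 := by
    field_simp
  rw [e1, e2]
  rw [abs_le] at *
  constructor <;> linarith [h1.1, h1.2, h2.1, h2.2]

end BoundaryLayer

/-! ### The asymptotic quotient and the two coefficients -/

section Expansion

open MeasureTheory Metric Filter Topology Asymptotics

/-- With `f₀`, `f₁` the coefficients of the quotient, `N - D (f₀ + f₁ x)` is the error of `N`, minus
the error of `D` times a bounded factor, minus `d₁ f₁ x²`. Dividing by `D` is harmless since its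
limit is not zero. -/
theorem isBigO_div_sub {N D x : ℕ → ℝ} {n₀ n₁ d₀ d₁ : ℝ} (hx : Tendsto x atTop (𝓝 0))
    (hN : (fun k => N k - (n₀ + n₁ * x k)) =O[atTop] fun k => x k ^ 2)
    (hD : (fun k => D k - (d₀ + d₁ * x k)) =O[atTop] fun k => x k ^ 2) (hd : d₀ ≠ 0) :
    (fun k => N k / D k - (n₀ / d₀ + (n₁ - n₀ / d₀ * d₁) / d₀ * x k)) =O[atTop]
      fun k => x k ^ 2 := by
  set f₀ := n₀ / d₀ with hf₀
  set f₁ := (n₁ - f₀ * d₁) / d₀ with hf₁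
  have hx2 : Tendsto (fun k => x k ^ 2) atTop (𝓝 0) := by
    simpa using hx.pow 2
  have hDlim : Tendsto D atTop (𝓝 d₀) := by
    have h1 := (hD.trans_tendsto hx2).add ((hx.const_mul d₁).const_add d₀)
    simpa using h1
  have hinv : (fun k => (D k)⁻¹) =O[atTop] fun _ => (1 : ℝ) :=
    (hDlim.inv₀ hd).isBigO_one ℝ
  have hF : (fun k => f₀ + f₁ * x k) =O[atTop] fun _ => (1 : ℝ) :=
    ((hx.const_mul f₁).const_add f₀).isBigO_one ℝ
  have h1 : (fun k => (D k - (d₀ + d₁ * x k)) * (f₀ + f₁ * x k)) =O[atTop] fun k => x k ^ 2 := by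
    simpa using hD.mul hF
  have h2 : (fun k => d₁ * f₁ * x k ^ 2) =O[atTop] fun k => x k ^ 2 :=
    (isBigO_refl _ _).const_mul_left _
  have h3 := (hinv.mul ((hN.sub h1).sub h2))
  simp only [one_mul] at h3
  refine h3.congr' ?_ EventuallyEq.rfl
  filter_upwards [hDlim.eventually_ne hd] with k hk
  have e0 : n₀ = f₀ * d₀ := (div_mul_cancel₀ _ hd).symm
  have e1 : n₁ = f₁ * d₀ + f₀ * d₁ := by
    rw [hf₁, div_mul_cancel₀ _ hd]
    ring
  clear_value f₀ f₁
  rw [e0, e1]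
  field_simp
  ring

/-- Subtract the two expansions: the limit gives `a = a'`, and division by `x` gives `b = b'`. -/
theorem eq_of_isBigO_sub {q x : ℕ → ℝ} {a b a' b' : ℝ} (hx : Tendsto x atTop (𝓝 0))
    (hx0 : ∀ᶠ k in atTop, x k ≠ 0)
    (h : (fun k => q k - (a + b * x k)) =O[atTop] fun k => x k ^ 2)
    (h' : (fun k => q k - (a' + b' * x k)) =O[atTop] fun k => x k ^ 2) : a = a' ∧ b = b' := by
  have h1 := h'.sub h
  have hx2 : Tendsto (fun k => x k ^ 2) atTop (𝓝 0) := by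
    simpa using hx.pow 2
  have ha : a = a' := by
    have h2 := h1.trans_tendsto hx2
    have h3 : Tendsto (fun k => q k - (a' + b' * x k) - (q k - (a + b * x k))) atTop
        (𝓝 (a - a')) := by
      have h4 : Tendsto (fun k => (a - a') + (b - b') * x k) atTop (𝓝 (a - a' + (b - b') * 0)) :=
        (hx.const_mul _).const_add _
      rw [mul_zero, add_zero] at h4
      exact h4.congr fun k => by ring
    exact sub_eq_zero.1 (tendsto_nhds_unique h3 h2)
  refine ⟨ha, ?_⟩
  subst ha
  have h2 : (fun _ : ℕ => b - b') =O[atTop] x := by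
    have h3 := h1.mul (isBigO_refl (fun k => (x k)⁻¹) atTop)
    refine h3.congr' ?_ ?_
    · filter_upwards [hx0] with k hk
      field_simp
      ring
    · filter_upwards [hx0] with k hk
      field_simp
  exact sub_eq_zero.1 (tendsto_nhds_unique tendsto_const_nhds (h2.trans_tendsto hx))

variable {n d : ℕ} {ℓ : Fin d → Fin n → ℤ}

theorem scaledPoint_eq (k r : ℕ) (I : Fin n → ℤ) :
    scaledPoint k r I = WithLp.toLp 2 (((k * r : ℕ) : ℝ)⁻¹ • castVec I) := by
  ext j
  simp [scaledPoint, castVec, div_eq_inv_mul]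

theorem scaledPoint_mem_polytope_iff {k r : ℕ} (hk : 0 < k) (hr : 0 < r) {I : Fin n → ℤ} :
    scaledPoint k r I ∈ polytope ℓ ↔ ∀ s, 0 ≤ slack ℓ (k * r) s I := by
  have hK : (0 : ℝ) < k * r := by positivity
  refine forall_congr' fun s => ?_
  rw [pair, sum_mul_scaledPoint, div_le_one hK, slack, sub_nonneg]
  have : ∑ j, (ℓ s j : ℝ) * I j = ((ℓ s ⬝ᵥ I : ℤ) : ℝ) := by simp [dotProduct]
  rw [this]
  exact_mod_cast Iff.rfl

theorem RatPL.isTame_eval {w : RatPL n} (hw : ∀ t j, ∃ z : ℤ, w.a t j = z) :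
    IsTame fun x => w.eval (WithLp.toLp 2 x) := by
  choose z hz using hw
  convert isTame_sup_affine z fun t => (w.c t : ℝ) using 2 with x
  rw [RatPL.eval]
  refine Finset.sup'_congr _ rfl fun t _ => ?_
  simp [dotProduct, castVec, hz]

theorem RatPL.continuous_eval (w : RatPL n) : Continuous w.eval := by
  unfold RatPL.eval
  refine Continuous.finset_sup'_apply _ fun t _ => ?_
  fun_prop

theorem IsTame.isBigO_riemannSum {g : EuclideanSpace ℝ (Fin n) → ℝ}
    (hg : IsTame fun x => g (WithLp.toLp 2 x)) (h : FacetNormals ℓ) (hn : 0 < n)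
    (hP : Bornology.IsBounded (polytope ℓ)) {r : ℕ} (hr : 0 < r) {S : ℕ → Finset (Fin n → ℤ)}
    (hS : ∀ k, 0 < k → ∀ I, I ∈ S k ↔ scaledPoint k r I ∈ polytope ℓ) :
    (fun k : ℕ => (∑ I ∈ S k, g (scaledPoint k r I)) / (k * r : ℝ) ^ n
      - ((∫ x in polytope ℓ, g x) + boundaryIntegral ℓ g / 2 * (k * r : ℝ)⁻¹)) =O[atTop]
      fun k : ℕ => (k * r : ℝ)⁻¹ ^ 2 := by
  obtain ⟨C, hC⟩ := hg.abs_riemannSum_sub_le h hn hP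
  refine IsBigO.of_bound C ?_
  filter_upwards [eventually_gt_atTop 0] with k hk
  have h1 := hC (k * r) (Nat.mul_pos hk hr) (S k) fun I => by
    rw [hS k hk, scaledPoint_mem_polytope_iff hk hr]
  have h2 : ∑ I ∈ S k, g (WithLp.toLp 2 (((k * r : ℕ) : ℝ)⁻¹ • castVec I))
      = ∑ I ∈ S k, g (scaledPoint k r I) :=
    Finset.sum_congr rfl fun I _ => by rw [scaledPoint_eq]
  simp only [WithLp.toLp_ofLp] at h1
  rw [h2] at h1
  push_cast at h1
  rw [Real.norm_eq_abs, Real.norm_of_nonneg (pow_nonneg (inv_nonneg.2 (by positivity)) 2),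
    inv_pow, ← div_eq_mul_inv C]
  convert h1 using 3
  rw [← div_eq_mul_inv, div_div]

theorem IsSmoothFano.integrableOn (hP : IsSmoothFano ℓ) {f : EuclideanSpace ℝ (Fin n) → ℝ}
    (hf : Continuous f) : IntegrableOn f (polytope ℓ) :=
  hf.continuousOn.integrableOn_compact hP.isCompact_polytope

theorem volume_polytope_pos (ℓ : Fin d → Fin n → ℤ) : 0 < volume (polytope ℓ) := by
  have hopen : IsOpen {x : EuclideanSpace ℝ (Fin n) | ∀ i, pair (ℓ i) x < 1} := by
    have : {x : EuclideanSpace ℝ (Fin n) | ∀ i, pair (ℓ i) x < 1}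
        = ⋂ i, {x | pair (ℓ i) x < 1} := by
      ext x
      simp
    rw [this]
    exact isOpen_iInter_of_finite fun i => isOpen_lt (continuous_pair _) continuous_const
  refine (hopen.measure_pos volume ⟨0, fun i => ?_⟩).trans_le (measure_mono fun x hx i => (hx i).le)
  simp [pair]

theorem IsSmoothFano.volP_pos (hP : IsSmoothFano ℓ) : 0 < volP ℓ :=
  ENNReal.toReal_pos (volume_polytope_pos ℓ).ne' hP.bounded.measure_lt_top.ne

theorem volP_eq_integral (ℓ : Fin d → Fin n → ℤ) : volP ℓ = ∫ _x in polytope ℓ, (1 : ℝ) := by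
  rw [setIntegral_const, smul_eq_mul, mul_one]
  rfl

/-- The divergence theorem with `θ = 0`. It supplies the second coefficient `n V / 2` in the
expansion of `N_k`. -/
theorem IsSmoothFano.boundaryIntegral_one (hP : IsSmoothFano ℓ) (hn : 0 < n) :
    boundaryIntegral ℓ (fun _ => 1) = n * volP ℓ := by
  have h := hP.facetNormals.boundaryIntegral_exp hn hP.bounded 0
  have h0 : ∀ x : EuclideanSpace ℝ (Fin n), thetaFun 0 x = 0 := fun x => by simp [thetaFun]
  simp only [h0, Real.exp_zero, add_zero] at h
  rw [h, integral_const_mul, volP_eq_integral]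

/-- The functional `𝓛` vanishes on constants. -/
theorem IsSmoothFano.calL_eq (hP : IsSmoothFano ℓ) (hn : 0 < n) (θ : Fin n → ℝ)
    {f : EuclideanSpace ℝ (Fin n) → ℝ} (hf : Continuous f) (R : ℝ) :
    calL ℓ θ f = n * (∫ x in polytope ℓ, Real.exp (thetaFun θ x) * (R - f x))
      + (∫ x in polytope ℓ, Real.exp (thetaFun θ x) * thetaFun θ x * (R - f x))
      - boundaryIntegral ℓ (fun x => Real.exp (thetaFun θ x) * (R - f x)) := by
  have hθ := continuous_thetaFun θ
  have hN := hP.facetNormals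
  have e1 : boundaryIntegral ℓ (fun x => Real.exp (thetaFun θ x) * (R - f x))
      = R * boundaryIntegral ℓ (fun x => Real.exp (thetaFun θ x))
        - boundaryIntegral ℓ (fun x => f x * Real.exp (thetaFun θ x)) := by
    rw [boundaryIntegral_eq_sum, boundaryIntegral_eq_sum, boundaryIntegral_eq_sum, Finset.mul_sum,
      ← Finset.sum_sub_distrib]
    refine Finset.sum_congr rfl fun i _ => ?_
    rw [← integral_const_mul, ← integral_sub
      (integrable_facetMeasure hP.bounded (hN.ne_zero i) (by fun_prop))
      (integrable_facetMeasure hP.bounded (hN.ne_zero i) (by fun_prop))]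
    refine integral_congr_ae (Eventually.of_forall fun x => ?_)
    change _ = R * Real.exp (thetaFun θ x) - f x * Real.exp (thetaFun θ x)
    ring
  have e2 : n * (∫ x in polytope ℓ, Real.exp (thetaFun θ x) * (R - f x))
      + (∫ x in polytope ℓ, Real.exp (thetaFun θ x) * thetaFun θ x * (R - f x))
      = R * (∫ x in polytope ℓ, (n + thetaFun θ x) * Real.exp (thetaFun θ x))
        - ∫ x in polytope ℓ, (n + thetaFun θ x) * Real.exp (thetaFun θ x) * f x := by
    rw [← integral_const_mul, ← integral_const_mul, ← integral_add
      (hP.integrableOn (by fun_prop)) (hP.integrableOn (by fun_prop)), ← integral_sub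
      (hP.integrableOn (by fun_prop)) (hP.integrableOn (by fun_prop))]
    refine integral_congr_ae (Eventually.of_forall fun x => ?_)
    change n * (Real.exp (thetaFun θ x) * (R - f x)) + Real.exp (thetaFun θ x) * thetaFun θ x
      * (R - f x) = R * ((n + thetaFun θ x) * Real.exp (thetaFun θ x))
        - (n + thetaFun θ x) * Real.exp (thetaFun θ x) * f x
    ring
  rw [calL, e2, e1, hN.boundaryIntegral_exp hn hP.bounded]
  ring

theorem tendsto_inv_mul_atTop {r : ℕ} (hr : 0 < r) :
    Tendsto (fun k : ℕ => (k * r : ℝ)⁻¹) atTop (𝓝 0) := by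
  refine tendsto_inv_atTop_zero.comp ?_
  exact tendsto_natCast_atTop_atTop.atTop_mul_const (by exact_mod_cast hr)

theorem hasFutakiExpansion_iff {w : RatPL n} {R r : ℕ} {θ : Fin n → ℝ} {F₀ F₁ : ℝ} :
    HasFutakiExpansion ℓ w R r θ F₀ F₁ ↔
      (fun k : ℕ => -(sumS1 ℓ w R r θ k - sumS2 ℓ w R r θ k) /
        ((k * r : ℝ) * dimSections ℓ w R r k) - (F₀ + F₁ * (k * r : ℝ)⁻¹)) =O[atTop]
      fun k : ℕ => (k * r : ℝ)⁻¹ ^ 2 := by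
  simp only [HasFutakiExpansion, div_eq_mul_inv F₁, one_div, inv_pow]

/-- Numerator and denominator are both divided by `K ^ (n + 1)` and expanded as Riemann sums, and
the quotient is expanded by `isBigO_div_sub`. Its linear coefficient is `𝓛(w) / (2 V)` by
`IsSmoothFano.calL_eq`, which absorbs `R`. -/
theorem IsSmoothFano.hasFutakiExpansion (hP : IsSmoothFano ℓ) (hn : 0 < n) {w : RatPL n} {R r : ℕ}
    (h : IsDegeneration ℓ w R r) (θ : Fin n → ℝ) :
    HasFutakiExpansion ℓ w R r θ
      (-(1 / volP ℓ) * ∫ x in polytope ℓ, Real.exp (thetaFun θ x) * (R - w.eval x))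
      (calL ℓ θ w.eval / (2 * volP ℓ)) := by
  have hN := hP.facetNormals
  have hr := h.pos_r
  have hV := hP.volP_pos
  obtain ⟨ρ, hρ⟩ := hN.exists_isBoxRadius 0
  let S : ℕ → Finset (Fin n → ℤ) := fun k => polytopePoints ℓ ρ (k * r)
  have hS : ∀ k, 0 < k → ∀ I, I ∈ S k ↔ scaledPoint k r I ∈ polytope ℓ := by
    intro k hk I
    rw [scaledPoint_mem_polytope_iff hk hr]
    change I ∈ polytopePoints ℓ ρ (k * r) ↔ _
    rw [polytopePoints, Finset.mem_filter]
    exact ⟨fun hI => hI.2, fun hI => ⟨hρ _ (Nat.mul_pos hk hr) I (by simpa using hI), hI⟩⟩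
  have hexp : IsTame fun x : Fin n → ℝ => Real.exp (thetaFun θ (WithLp.toLp 2 x)) :=
    isTame_exp_dotProduct θ
  have hθ : IsTame fun x : Fin n → ℝ => thetaFun θ (WithLp.toLp 2 x) := isTame_dotProduct θ
  have hw := (RatPL.isTame_eval h.slopes).const_sub (R : ℝ)
  have a1 := (IsTame.isBigO_riemannSum
    (g := fun x => Real.exp (thetaFun θ x) * (R - w.eval x)) (hexp.mul hw) hN hn hP.bounded hr hS)
  have a2 := (IsTame.isBigO_riemannSum
    (g := fun x => Real.exp (thetaFun θ x) * thetaFun θ x * (R - w.eval x))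
    ((hexp.mul hθ).mul hw) hN hn hP.bounded hr hS)
  have a3 := (IsTame.isBigO_riemannSum (g := fun _ => 1) isTame_one hN hn hP.bounded hr hS)
  rw [hP.boundaryIntegral_one hn, ← volP_eq_integral] at a3
  have hcalL := hP.calL_eq hn θ w.continuous_eval R
  generalize (∫ x in polytope ℓ, Real.exp (thetaFun θ x) * (R - w.eval x)) = A at *
  generalize (∫ x in polytope ℓ, Real.exp (thetaFun θ x) * thetaFun θ x * (R - w.eval x)) = A' at *
  generalize boundaryIntegral ℓ (fun x => Real.exp (thetaFun θ x) * (R - w.eval x)) = B at *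
  generalize boundaryIntegral ℓ
    (fun x => Real.exp (thetaFun θ x) * thetaFun θ x * (R - w.eval x)) = B' at *
  have hx := tendsto_inv_mul_atTop hr
  have hx1 : (fun k : ℕ => (k * r : ℝ)⁻¹) =O[atTop] fun _ => (1 : ℝ) := hx.isBigO_one ℝ
  have a4 := (hx1.mul a2).const_mul_left (1 / 2)
  simp only [one_mul] at a4
  -- `S₂` carries one power of `K` less than `S₁`, so its boundary term is of order `K⁻²` and goes
  -- into the error. Only its integral `A'` reaches `F₁`.
  have a5 : (fun k : ℕ => B' / 4 * (k * r : ℝ)⁻¹ ^ 2) =O[atTop] fun k : ℕ => (k * r : ℝ)⁻¹ ^ 2 :=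
    (isBigO_refl _ _).const_mul_left _
  have a6 := isBigO_div_sub (N := fun k : ℕ => -((∑ I ∈ S k,
      Real.exp (thetaFun θ (scaledPoint k r I)) * (R - w.eval (scaledPoint k r I))) / (k * r : ℝ) ^ n
      - 1 / 2 * (k * r : ℝ)⁻¹ * ((∑ I ∈ S k, Real.exp (thetaFun θ (scaledPoint k r I)) *
        thetaFun θ (scaledPoint k r I) * (R - w.eval (scaledPoint k r I))) / (k * r : ℝ) ^ n)))
    (n₀ := -A) (n₁ := (A' - B) / 2) hx
    (((a4.add a5).sub a1).congr_left fun k => by ring) a3 hV.ne'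
  rw [hasFutakiExpansion_iff]
  refine a6.congr' ?_ EventuallyEq.rfl
  filter_upwards [eventually_gt_atTop 0] with k hk
  have hK : (0 : ℝ) < k * r := by positivity
  rw [sumS1_eq h hP.bounded θ hk (hS k hk), sumS2_eq h hP.bounded θ hk (hS k hk),
    dimSections_eq h hP.bounded hk (hS k hk), hcalL]
  generalize ∑ I ∈ S k, Real.exp (thetaFun θ (scaledPoint k r I)) *
    (R - w.eval (scaledPoint k r I)) = s₁
  generalize ∑ I ∈ S k, Real.exp (thetaFun θ (scaledPoint k r I)) *
    thetaFun θ (scaledPoint k r I) * (R - w.eval (scaledPoint k r I)) = s₂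
  rw [Finset.sum_const, nsmul_eq_mul, mul_one]
  generalize ((S k).card : ℝ) = c
  generalize (k * r : ℝ) = K at hK
  congr 1
  · field_simp
  · field_simp
    ring

theorem IsSmoothFano.hasFutakiExpansion_iff_eq (hP : IsSmoothFano ℓ) (hn : 0 < n) {w : RatPL n}
    {R r : ℕ} (h : IsDegeneration ℓ w R r) (θ : Fin n → ℝ) (F₀ F₁ : ℝ) :
    HasFutakiExpansion ℓ w R r θ F₀ F₁ ↔
      F₀ = -(1 / volP ℓ) * ∫ x in polytope ℓ, Real.exp (thetaFun θ x) * (R - w.eval x) ∧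
      F₁ = calL ℓ θ w.eval / (2 * volP ℓ) := by
  have h1 := hP.hasFutakiExpansion hn h θ
  refine ⟨fun h2 => ?_, fun h2 => ?_⟩
  · refine eq_of_isBigO_sub (tendsto_inv_mul_atTop h.pos_r) ?_ (hasFutakiExpansion_iff.1 h2)
      (hasFutakiExpansion_iff.1 h1)
    filter_upwards [eventually_gt_atTop 0] with k hk
    have := h.pos_r
    positivity
  · rw [h2.1, h2.2]
    exact h1

/-- The leading coefficients for different heights of the degeneration polytope differ. -/
theorem IsSmoothFano.leading_ne (hP : IsSmoothFano ℓ) (θ : Fin n → ℝ)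
    {f : EuclideanSpace ℝ (Fin n) → ℝ} (hf : Continuous f) {R R' : ℝ} (hR : R ≠ R') :
    -(1 / volP ℓ) * ∫ x in polytope ℓ, Real.exp (thetaFun θ x) * (R - f x) ≠
      -(1 / volP ℓ) * ∫ x in polytope ℓ, Real.exp (thetaFun θ x) * (R' - f x) := by
  have hθ := continuous_thetaFun θ
  have hV := hP.volP_pos
  have hpos : 0 < ∫ x in polytope ℓ, Real.exp (thetaFun θ x) := by
    have : NeZero (volume.restrict (polytope ℓ)) :=
      ⟨fun h0 => (volume_polytope_pos ℓ).ne' (Measure.restrict_eq_zero.1 h0)⟩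
    exact integral_exp_pos (hP.integrableOn (by fun_prop))
  intro heq
  have h1 := mul_left_cancel₀ (neg_ne_zero.2 (one_div_ne_zero hV.ne')) heq
  rw [← sub_eq_zero, ← integral_sub (hP.integrableOn (by fun_prop))
    (hP.integrableOn (by fun_prop))] at h1
  have h2 : ∀ x, Real.exp (thetaFun θ x) * (R - f x) - Real.exp (thetaFun θ x) * (R' - f x)
      = (R - R') * Real.exp (thetaFun θ x) := fun x => by ring
  simp only [h2] at h1
  rw [integral_const_mul] at h1
  exact mul_ne_zero (sub_ne_zero.2 hR) hpos.ne' h1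

end Expansion

end ToricFutaki

end

theorem mainTheorem6 {n d : ℕ} (hn : 0 < n) (ℓ : Fin d → Fin n → ℤ)
    (hP : ToricFutaki.IsSmoothFano ℓ) (θ : Fin n → ℝ) (u : ToricFutaki.RatPL n)
    (hu : ∀ x ∈ ToricFutaki.polytope ℓ, 0 < u.eval x) (l : ℕ) (hl : 0 < l) :
    (∀ R r : ℕ, ToricFutaki.IsDegeneration ℓ (u.scale l) R r →
      ∀ F₀ F₁ : ℝ, ToricFutaki.HasFutakiExpansion ℓ (u.scale l) R r θ F₀ F₁ ↔
        F₀ = -(1 / ToricFutaki.volP ℓ) * ∫ x in ToricFutaki.polytope ℓ,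
            Real.exp (ToricFutaki.thetaFun θ x) * (R - l * u.eval x) ∧
        F₁ = ToricFutaki.calL ℓ θ (fun x => l * u.eval x) / (2 * ToricFutaki.volP ℓ)) ∧
    (∀ R r R' r' : ℕ, ToricFutaki.IsDegeneration ℓ (u.scale l) R r →
      ToricFutaki.IsDegeneration ℓ (u.scale l) R' r' →
      ∀ F₀ F₁ F₀' F₁' : ℝ, ToricFutaki.HasFutakiExpansion ℓ (u.scale l) R r θ F₀ F₁ →
        ToricFutaki.HasFutakiExpansion ℓ (u.scale l) R' r' θ F₀' F₁' →
        F₁ = F₁' ∧ (R ≠ R' → F₀ ≠ F₀')) := by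
  have heval : (u.scale l).eval = fun x => l * u.eval x := funext (u.eval_scale l)
  have key := fun R r (h : ToricFutaki.IsDegeneration ℓ (u.scale l) R r) =>
    hP.hasFutakiExpansion_iff_eq hn h θ
  simp only [heval] at key
  refine ⟨key, fun R r R' r' h h' F₀ F₁ F₀' F₁' hF hF' => ?_⟩
  obtain ⟨rfl, rfl⟩ := (key R r h F₀ F₁).1 hF
  obtain ⟨rfl, rfl⟩ := (key R' r' h' F₀' F₁').1 hF'
  -- The formula for `F₁` contains neither `R` nor `r`, so the first equality is definitional after
  -- substitution. `F₀` is strictly monotone in `R` because `∫_P e^θ > 0`.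
  exact ⟨rfl, fun hR => hP.leading_ne θ (continuous_const.mul u.continuous_eval) (Nat.cast_injective.ne hR)⟩
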